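/- Let $L^3$ be the three-sorted first-order language with sorts $0,1,2$ (naturals, reals, i.e. functions from naturals to naturals, and functionals from reals to naturals), $+,\times,<,0,1$ on sort $0$, application $r(n)$ and $F(r)$, and operations $F*r$ and $k^\smallfrown r$ with values of sort $1$; superscripts on variables indicate sorts. A $\Sigma^0_0$ formula has only bounded quantifiers, over sort $0$, and no equalities between objects of sort $1$ or $2$; an arithmetical formula has quantifiers of sort $0$ only and no such equalities. $\Sigma^0_1$ formulas are $\exists x^0\theta$ with $\theta$ in $\Sigma^0_0$; $\Sigma^1_1$ formulas are $\exists x^1\theta$ with $\theta$ arithmetical. Parameters of all sorts are allowed throughout. $\mathsf{RCA}_0^3$ consists of the axioms $P^-$ of discretely ordered semirings and $\Sigma^0_1$-induction for sort $0$, extensionality for sorts $1$ and $2$, the schemes $$\forall x^0\exists!y^0\varphi(x,y)\to\exists f^1\forall x^0\varphi(x,f(x)),\qquad \forall x^1\exists!y^0\varphi(x,y)\to\exists F^2\forall x^1\varphi(x,F(x))\qquad(\varphi\in\Sigma^0_1),$$ and the axioms $(k^\smallfrown r)(0)=k$, $(k^\smallfrown r)(n+1)=r(n)$, $(F*r)(k)=F(k^\smallfrown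 r)$. Write $\mathbb{R}$ for the objects of sort $1$. Fix the pairing $\langle x,y\rangle(2n)=x(n)$, $\langle x,y\rangle(2n+1)=y(n)$ of reals, and a standard coding by reals of finite and of infinite sequences of reals; each finite sequence has exactly one code. A set of reals, of pairs of reals or of finite sequences of reals is given by a functional whose value is $1$ at (the codes of) its members and different from $1$ at (the codes of) the other such objects. A tree $T\subseteq\mathbb{R}^{<\omega}$ contains the empty sequence and is closed under initial segments; it is well-founded if every infinite sequence of reals has a finite initial segment outside $T$. A linear order on a set of reals is a well-ordering if there is no infinite descending sequence. A strategy is a functional $\Sigma$, whose move at the position $s\in\mathbb{R}^{<\omega}$ is the real $\Sigma*s$; $(\Sigma\otimes\Pi)_k$ is the sequence of the first $k$ moves when player I, who moves first, uses $\Sigma$ and player II uses $\Pi$. An assertion that $(\Sigma\otimes\Pi)_k$ is, or is not, in $T$ includes the assertion that this sequence exists. The principles are as follows. * $\Delta_1^{\mathbb{R}}\text{-}\mathsf{Det}$ (clopen determinacy for reals): for every well-founded tree $T\subseteq\mathbb{R}^{<\omega}$, either $\exists\Sigma\,\forall\Pi\,\exists k\,[(\Sigma\otimes\Pi)_{2k+1}\in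 T\wedge(\Sigma\otimes\Pi)_{2k+2}\notin T]$, or $\exists\Pi\,\forall\Sigma\,\exists k\,[(\Sigma\otimes\Pi)_{2k}\in T\wedge(\Sigma\otimes\Pi)_{2k+1}\notin T]$. * $\mathsf{BR}_1(\mathbb{R})$: for every well-founded tree $T\subseteq\mathbb{R}^{<\omega}$ there is a functional $h$ with values in $\{0,1\}$ such that for all $\sigma\in T$: $h(\sigma)=0\iff\forall a^1(\sigma^\smallfrown\langle a\rangle\in T\to h(\sigma^\smallfrown\langle a\rangle)=1)$. * $\mathsf{TR}_1(\mathbb{R})$ (a scheme): let $W$ code a well-ordering of a set $\mathrm{dom}(W)$ of reals, that is, $W$ has values in $\{0,1,2\}$ and $W(\langle a,b\rangle)$ is $0$ if $a<_Wb$, $1$ if $b\le_Wa$, and $2$ if $a,b$ are not both in $\mathrm{dom}(W)$. Let $\varphi(x^1,Y^2)$ be $\Sigma^1_1$. Then there is a functional $X$ such that for all $a\in\mathrm{dom}(W)$ and all reals $b$, $X(\langle a,b\rangle)$ is $1$ if $\varphi(b,X^{[<_Wa]})$ holds and $0$ otherwise; here $X^{[<_Wa]}(\langle c,b\rangle)$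 is $X(\langle c,b\rangle)$ if $c<_Wa$ and $0$ otherwise. * $\mathsf{WO}(\mathbb{R})$: there is a functional $F$ such that $\{(a,b):F(\langle a,b\rangle)=1\}$ is a (strict) well-ordering of $\mathbb{R}$. * $\mathsf{SF}(\mathbb{R})$: for every functional $F$ with $\forall r^1\exists s^1\,F(\langle r,s\rangle)=1$ there is a functional $G$ with $\forall r^1\,F(\langle r,G*r\rangle)=1$. **Lemma.** Over $\mathsf{RCA}_0^3$ (that is, in every model of $\mathsf{RCA}_0^3$; by completeness this is the same as provability): (i) $\Delta_1^{\mathbb{R}}\text{-}\mathsf{Det}$ implies $\mathsf{TR}_1(\mathbb{R})+\mathsf{SF}(\mathbb{R})$. (ii) $\Delta_1^{\mathbb{R}}\text{-}\mathsf{Det}$ is equivalent to $\mathsf{BR}_1(\mathbb{R})+\mathsf{SF}(\mathbb{R})$. (iii) $\mathsf{TR}_1(\mathbb{R})+\mathsf{WO}(\mathbb{R})+\mathsf{SF}(\mathbb{R})$ implies $\Delta_1^{\mathbb{R}}\text{-}\mathsf{Det}$. -/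

import Mathlib

universe u

/-! ## The three-sorted language -/

/-- The sorts: naturals (type 0), reals (type 1), functionals from reals to naturals (type 2). -/
inductive L3Sort : Type
  | s0 | s1 | s2
  deriving DecidableEq

/-- Terms; each sort has countably many variables. -/
inductive L3Term : L3Sort → Type
  | var (s : L3Sort) (n : ℕ) : L3Term s
  | zero : L3Term .s0
  | one : L3Term .s0
  | add (t u : L3Term .s0) : L3Term .s0
  | mul (t u : L3Term .s0) : L3Term .s0
  | app0 (r : L3Term .s1) (t : L3Term .s0) : L3Term .s0
  | app1 (F : L3Term .s2) (r : L3Term .s1) : L3Term .s0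
  | star (F : L3Term .s2) (r : L3Term .s1) : L3Term .s1
  | cons (t : L3Term .s0) (r : L3Term .s1) : L3Term .s1

/-- The type-0 variable with index `n` occurs in the term. -/
def L3Term.HasVar0 (n : ℕ) : {s : L3Sort} → L3Term s → Prop
  | _, .var s m => s = .s0 ∧ m = n
  | _, .zero => False
  | _, .one => False
  | _, .add t u => t.HasVar0 n ∨ u.HasVar0 n
  | _, .mul t u => t.HasVar0 n ∨ u.HasVar0 n
  | _, .app0 r t => r.HasVar0 n ∨ t.HasVar0 n
  | _, .app1 F r => F.HasVar0 n ∨ r.HasVar0 n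
  | _, .star F r => F.HasVar0 n ∨ r.HasVar0 n
  | _, .cons t r => t.HasVar0 n ∨ r.HasVar0 n

/-- Formulas of the three-sorted first-order language. -/
inductive L3Formula : Type
  | eq (s : L3Sort) (t u : L3Term s) : L3Formula
  | lt (t u : L3Term .s0) : L3Formula
  | not (φ : L3Formula) : L3Formula
  | and (φ ψ : L3Formula) : L3Formula
  | or (φ ψ : L3Formula) : L3Formula
  | imp (φ ψ : L3Formula) : L3Formula
  | all (s : L3Sort) (n : ℕ) (φ : L3Formula) : L3Formula
  | ex (s : L3Sort) (n : ℕ) (φ : L3Formula) : L3Formula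

namespace L3Formula

/-- `Σ⁰₀`: only bounded type-0 quantifiers, no equality between objects of type 1 or 2. -/
inductive IsSigma00 : L3Formula → Prop
  | eq (t u : L3Term .s0) : IsSigma00 (.eq .s0 t u)
  | lt (t u : L3Term .s0) : IsSigma00 (.lt t u)
  | not {φ : L3Formula} : IsSigma00 φ → IsSigma00 (.not φ)
  | and {φ ψ : L3Formula} : IsSigma00 φ → IsSigma00 ψ → IsSigma00 (.and φ ψ)
  | or {φ ψ : L3Formula} : IsSigma00 φ → IsSigma00 ψ → IsSigma00 (.or φ ψ)
  | imp {φ ψ : L3Formula} : IsSigma00 φ → IsSigma00 ψ → IsSigma00 (.imp φ ψ)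
  | ball {φ : L3Formula} (n : ℕ) (t : L3Term .s0) : ¬ t.HasVar0 n → IsSigma00 φ →
      IsSigma00 (.all .s0 n (.imp (.lt (.var .s0 n) t) φ))
  | bex {φ : L3Formula} (n : ℕ) (t : L3Term .s0) : ¬ t.HasVar0 n → IsSigma00 φ →
      IsSigma00 (.ex .s0 n (.and (.lt (.var .s0 n) t) φ))

/-- `Σ⁰₁`: one type-0 existential quantifier in front of a `Σ⁰₀` formula. -/
def IsSigma01 (φ : L3Formula) : Prop :=
  ∃ (n : ℕ) (θ : L3Formula), IsSigma00 θ ∧ φ = .ex .s0 n θ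

/-- Arithmetical (`Σ¹₀ = Π¹₀`): arbitrary quantifiers of type 0 and no others, no equality between
objects of type 1 or 2. -/
inductive IsArith : L3Formula → Prop
  | eq (t u : L3Term .s0) : IsArith (.eq .s0 t u)
  | lt (t u : L3Term .s0) : IsArith (.lt t u)
  | not {φ : L3Formula} : IsArith φ → IsArith (.not φ)
  | and {φ ψ : L3Formula} : IsArith φ → IsArith ψ → IsArith (.and φ ψ)
  | or {φ ψ : L3Formula} : IsArith φ → IsArith ψ → IsArith (.or φ ψ)
  | imp {φ ψ : L3Formula} : IsArith φ → IsArith ψ → IsArith (.imp φ ψ)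
  | all {φ : L3Formula} (n : ℕ) : IsArith φ → IsArith (.all .s0 n φ)
  | ex {φ : L3Formula} (n : ℕ) : IsArith φ → IsArith (.ex .s0 n φ)

/-- `Σ¹₁`: one type-1 existential quantifier in front of an arithmetical formula. -/
def IsSigma11 (φ : L3Formula) : Prop :=
  ∃ (n : ℕ) (θ : L3Formula), IsArith θ ∧ φ = .ex .s1 n θ

end L3Formula

/-! ## Structures and satisfaction -/

/-- Structures for the language: three carriers `N`, `R`, `F` (types 0, 1, 2), arithmetic on `N`,
the two application operators, the operation `*` and the operation `⌢` (here `cons`). -/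
structure L3Structure : Type (u + 1) where
  N : Type u
  R : Type u
  F : Type u
  zero : N
  one : N
  add : N → N → N
  mul : N → N → N
  lt : N → N → Prop
  app0 : R → N → N
  app1 : F → R → N
  star : F → R → R
  cons : N → R → R

namespace L3Structure

instance (M : L3Structure.{u}) : Zero M.N := ⟨M.zero⟩
instance (M : L3Structure.{u}) : One M.N := ⟨M.one⟩
instance (M : L3Structure.{u}) : Add M.N := ⟨M.add⟩
instance (M : L3Structure.{u}) : Mul M.N := ⟨M.mul⟩
instance (M : L3Structure.{u}) : LT M.N := ⟨M.lt⟩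
instance (M : L3Structure.{u}) : CoeFun M.R (fun _ => M.N → M.N) := ⟨M.app0⟩
instance (M : L3Structure.{u}) : CoeFun M.F (fun _ => M.R → M.N) := ⟨M.app1⟩

/-- The carrier of each sort. -/
def Carrier (M : L3Structure.{u}) : L3Sort → Type u
  | .s0 => M.N
  | .s1 => M.R
  | .s2 => M.F

/-- Assignments of values to all variables. Parameters of a formula are values of its variables. -/
abbrev Val (M : L3Structure.{u}) : Type u := (p : L3Sort × ℕ) → M.Carrier p.1

/-- Change the value of the variable of sort `s` and index `n` to `a`. -/
def Val.set {M : L3Structure.{u}} (v : M.Val) (s : L3Sort) (n : ℕ) (a : M.Carrier s) : M.Val :=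
  Function.update v (s, n) a

/-- The value of a term. -/
def eval (M : L3Structure.{u}) (v : M.Val) : {s : L3Sort} → L3Term s → M.Carrier s
  | _, .var s n => v (s, n)
  | _, .zero => M.zero
  | _, .one => M.one
  | _, .add t u => M.add (M.eval v t) (M.eval v u)
  | _, .mul t u => M.mul (M.eval v t) (M.eval v u)
  | _, .app0 r t => M.app0 (M.eval v r) (M.eval v t)
  | _, .app1 F r => M.app1 (M.eval v F) (M.eval v r)
  | _, .star F r => M.star (M.eval v F) (M.eval v r)
  | _, .cons t r => M.cons (M.eval v t) (M.eval v r)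

/-- Tarskian satisfaction. -/
def Sat (M : L3Structure.{u}) : M.Val → L3Formula → Prop
  | v, .eq _ t u => M.eval v t = M.eval v u
  | v, .lt t u => M.lt (M.eval v t) (M.eval v u)
  | v, .not φ => ¬ M.Sat v φ
  | v, .and φ ψ => M.Sat v φ ∧ M.Sat v ψ
  | v, .or φ ψ => M.Sat v φ ∨ M.Sat v ψ
  | v, .imp φ ψ => M.Sat v φ → M.Sat v ψ
  | v, .all s n φ => ∀ a : M.Carrier s, M.Sat (v.set s n a) φ
  | v, .ex s n φ => ∃ a : M.Carrier s, M.Sat (v.set s n a) φ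

/-! ## The base theory -/

/-- The axioms `P⁻` of (the nonnegative part of) a discretely ordered ring. -/
structure PMinus (M : L3Structure.{u}) : Prop where
  add_assoc : ∀ x y z : M.N, (x + y) + z = x + (y + z)
  add_comm : ∀ x y : M.N, x + y = y + x
  mul_assoc : ∀ x y z : M.N, (x * y) * z = x * (y * z)
  mul_comm : ∀ x y : M.N, x * y = y * x
  mul_add : ∀ x y z : M.N, x * (y + z) = x * y + x * z
  add_zero : ∀ x : M.N, x + 0 = x
  mul_zero : ∀ x : M.N, x * 0 = 0
  mul_one : ∀ x : M.N, x * 1 = x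
  lt_trans : ∀ x y z : M.N, x < y → y < z → x < z
  lt_irrefl : ∀ x : M.N, ¬ x < x
  lt_total : ∀ x y : M.N, x < y ∨ x = y ∨ y < x
  add_lt_add : ∀ x y z : M.N, x < y → x + z < y + z
  mul_lt_mul : ∀ x y z : M.N, 0 < z → x < y → x * z < y * z
  exists_sub : ∀ x y : M.N, x < y → ∃ z : M.N, x + z = y
  zero_lt_one : (0 : M.N) < 1
  one_le : ∀ x : M.N, 0 < x → 1 < x ∨ 1 = x
  zero_le : ∀ x : M.N, 0 < x ∨ 0 = x

/-- `M` is a model of the theory RCA₀³. The schemes range over all formulas of the class in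
question and, through the assignment `v`, over all parameters. -/
structure IsModelRCA03 (M : L3Structure.{u}) : Prop where
  pMinus : M.PMinus
  induction : ∀ φ : L3Formula, φ.IsSigma01 → ∀ (v : M.Val) (i : ℕ),
    M.Sat (v.set .s0 i (0 : M.N)) φ →
    (∀ x : M.N, M.Sat (v.set .s0 i x) φ → M.Sat (v.set .s0 i (x + 1 : M.N)) φ) →
    ∀ x : M.N, M.Sat (v.set .s0 i x) φ
  ext1 : ∀ f g : M.R, (∀ x : M.N, f x = g x) ↔ f = g
  ext2 : ∀ f g : M.F, (∀ x : M.R, f x = g x) ↔ f = g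
  comp1 : ∀ φ : L3Formula, φ.IsSigma01 → ∀ (v : M.Val) (i j : ℕ), i ≠ j →
    (∀ x : M.N, ∃! y : M.N, M.Sat ((v.set .s0 i x).set .s0 j y) φ) →
    ∃ f : M.R, ∀ x : M.N, M.Sat ((v.set .s0 i x).set .s0 j (f x)) φ
  comp2 : ∀ φ : L3Formula, φ.IsSigma01 → ∀ (v : M.Val) (i j : ℕ),
    (∀ x : M.R, ∃! y : M.N, M.Sat ((v.set .s1 i x).set .s0 j y) φ) →
    ∃ f : M.F, ∀ x : M.R, M.Sat ((v.set .s1 i x).set .s0 j (f x)) φ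
  cons_zero : ∀ (k : M.N) (r : M.R), M.cons k r 0 = k
  cons_succ : ∀ (k : M.N) (r : M.R) (n : M.N), M.cons k r (n + 1) = r n
  star_app : ∀ (f : M.F) (r : M.R) (k : M.N), M.star f r k = f (M.cons k r)

variable (M : L3Structure.{u})

/-! ## Coding of pairs and of finite and infinite sequences of reals

All notions below are relations expressed inside the structure; in a model of RCA₀³ the pairs,
rows, initial segments and one-point extensions in question exist and are unique. -/

/-- `p = ⟨x, y⟩`, the pairing `p(2n) = x(n)`, `p(2n+1) = y(n)`, a bijection `ℝ² ≅ ℝ`. -/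
def IsPair (p x y : M.R) : Prop :=
  ∀ n : M.N, p (n + n) = x n ∧ p (n + n + 1) = y n

/-- `f(⟨x, y⟩) = c`. -/
def PairVal (f : M.F) (x y : M.R) (c : M.N) : Prop :=
  ∃ p : M.R, M.IsPair p x y ∧ f p = c

/-- The injective pairing `(m, n) ↦ (m + n)² + m` of naturals. -/
def natPair (m n : M.N) : M.N := (m + n) * (m + n) + m

/-- `r` is the `i`th row of `f`; a real `f` codes the infinite sequence of its rows. -/
def IsRow (r f : M.R) (i : M.N) : Prop :=
  ∀ n : M.N, r n = f (M.natPair i n)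

/-- `s` is the code of a finite sequence of reals: `s(0)` is its length `k`, the entries
`s_0, …, s_{k-1}` are stored as `s(⟨i, n⟩ + 1) = s_i(n)`, and all the other values of `s` are `0`.
Every finite sequence has exactly one code; the code of the empty sequence is the zero real. -/
def IsSeq (s : M.R) : Prop :=
  ∀ m : M.N, s (m + 1) = 0 ∨ ∃ i n : M.N, i < s 0 ∧ m = M.natPair i n

/-- The length of a coded sequence. -/
def len (s : M.R) : M.N := s 0

/-- The value at `n` of the `i`th entry of a coded sequence. -/
def entry (s : M.R) (i n : M.N) : M.N := s (M.natPair i n + 1)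

/-- The sequences `s` and `t` have the same entries at all indices below `k`. -/
def AgreeBelow (s t : M.R) (k : M.N) : Prop :=
  ∀ i : M.N, i < k → ∀ n : M.N, M.entry s i n = M.entry t i n

/-- The sequence `s` is an initial segment of the sequence `t`. -/
def IsInit (s t : M.R) : Prop :=
  M.IsSeq s ∧ M.IsSeq t ∧ (M.len s < M.len t ∨ M.len s = M.len t) ∧ M.AgreeBelow s t (M.len s)

/-- `t = s⌢⟨a⟩` for finite sequences `s`, `t`. -/
def IsSnoc (t s a : M.R) : Prop :=
  M.IsSeq s ∧ M.IsSeq t ∧ M.len t = M.len s + 1 ∧ M.AgreeBelow t s (M.len s) ∧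
    ∀ n : M.N, M.entry t (M.len s) n = a n

/-- `s` is the finite sequence of the first `k` rows of `f`. -/
def IsRestr (s f : M.R) (k : M.N) : Prop :=
  M.IsSeq s ∧ M.len s = k ∧ ∀ i : M.N, i < k → ∀ n : M.N, M.entry s i n = f (M.natPair i n)

/-! ## Trees and games -/

/-- The finite sequence `s` belongs to the set of finite sequences given by `T`. -/
def Mem (s : M.R) (T : M.F) : Prop := M.IsSeq s ∧ T s = 1

/-- `T` is a tree: it contains the empty sequence and is closed under initial segments. -/
def IsTree (T : M.F) : Prop :=
  (∃ e : M.R, M.len e = 0 ∧ M.Mem e T) ∧ ∀ s t : M.R, M.IsInit s t → M.Mem t T → M.Mem s T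

/-- `T` is well-founded: every infinite sequence of reals has an initial segment outside `T`. -/
def IsWFTree (T : M.F) : Prop :=
  ∀ f : M.R, ∃ (k : M.N) (s : M.R), M.IsRestr s f k ∧ ¬ M.Mem s T

/-- `s` codes `(S ⊗ P)_k`, the first `k` moves when player I follows the strategy `S` and player II
follows `P`: the entries at even indices `i` are `S` applied to the sequence of the first `i`
moves, those at odd indices are `P` applied to it. A functional `S` acts on reals by `S * t`. -/
def IsPlay (S P : M.F) (k : M.N) (s : M.R) : Prop :=
  M.IsSeq s ∧ M.len s = k ∧
  (∀ j : M.N, j + j < k → ∃ t : M.R, M.IsInit t s ∧ M.len t = j + j ∧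
    ∀ n : M.N, M.entry s (j + j) n = M.star S t n) ∧
  (∀ j : M.N, j + j + 1 < k → ∃ t : M.R, M.IsInit t s ∧ M.len t = j + j + 1 ∧
    ∀ n : M.N, M.entry s (j + j + 1) n = M.star P t n)

/-- `(S ⊗ P)_k` exists and lies in `T`. -/
def PlayIn (S P : M.F) (k : M.N) (T : M.F) : Prop :=
  ∃ s : M.R, M.IsPlay S P k s ∧ M.Mem s T

/-- `(S ⊗ P)_k` exists and does not lie in `T`. -/
def PlayOut (S P : M.F) (k : M.N) (T : M.F) : Prop :=
  ∃ s : M.R, M.IsPlay S P k s ∧ ¬ M.Mem s T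

/-- Player I has a winning strategy in the clopen game `T` (II is the first to leave `T`). -/
def WinI (T : M.F) : Prop :=
  ∃ S : M.F, ∀ P : M.F, ∃ k : M.N, M.PlayIn S P (k + k + 1) T ∧ M.PlayOut S P (k + k + 1 + 1) T

/-- Player II has a winning strategy in the clopen game `T` (I is the first to leave `T`). -/
def WinII (T : M.F) : Prop :=
  ∃ P : M.F, ∀ S : M.F, ∃ k : M.N, M.PlayIn S P (k + k) T ∧ M.PlayOut S P (k + k + 1) T

/-- Clopen determinacy for reals. -/
def ClopenDet : Prop :=
  ∀ T : M.F, M.IsTree T → M.IsWFTree T → M.WinI T ∨ M.WinII T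

/-! ## Bar recursion, selection, well-orderings and transfinite recursion -/

/-- Bar recursion BR₁(ℝ). -/
def BR1 : Prop :=
  ∀ T : M.F, M.IsTree T → M.IsWFTree T →
    ∃ h : M.F, (∀ x : M.R, h x = 0 ∨ h x = 1) ∧
      ∀ s : M.R, M.Mem s T →
        (h s = 0 ↔ ∀ a t : M.R, M.IsSnoc t s a → M.Mem t T → h t = 1)

/-- The selection principle SF(ℝ). -/
def SF : Prop :=
  ∀ f : M.F, (∀ r : M.R, ∃ s : M.R, M.PairVal f r s 1) →
    ∃ g : M.F, ∀ r : M.R, M.PairVal f r (M.star g r) 1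

/-- `D` is strictly linearly ordered by `L`, and there is no infinite `L`-descending sequence of
elements of `D` among the sequences coded by reals of `M`. -/
def IsWellOrder (D : M.R → Prop) (L : M.R → M.R → Prop) : Prop :=
  (∀ a, D a → ¬ L a a) ∧
  (∀ a b c, D a → D b → D c → L a b → L b c → L a c) ∧
  (∀ a b, D a → D b → L a b ∨ a = b ∨ L b a) ∧
  ¬ ∃ f : M.R, ∀ n : M.N, ∃ a b : M.R,
    M.IsRow a f n ∧ M.IsRow b f (n + 1) ∧ D a ∧ D b ∧ L b a

/-- The well-ordering principle WO(ℝ). -/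
def WO : Prop :=
  ∃ f : M.F, M.IsWellOrder (fun _ => True) (fun a b => M.PairVal f a b 1)

/-- The domain of an order coded as below. -/
def Dom (W : M.F) (a : M.R) : Prop := ¬ M.PairVal W a a (1 + 1)

/-- The strict order relation coded by `W`. -/
def Less (W : M.F) (a b : M.R) : Prop := M.PairVal W a b 0

/-- `W` codes a well-ordering of the set `Dom W` of reals: its values are `0`, `1`, `2`, and
`W(⟨a, b⟩)` is `0` if `a < b`, `1` if `b ≤ a`, and `2` if `a`, `b` are not both in the domain. -/
def IsWOCode (W : M.F) : Prop :=
  (∀ x : M.R, W x = 0 ∨ W x = 1 ∨ W x = 1 + 1) ∧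
  (∀ a b : M.R, M.PairVal W a b (1 + 1) ↔ ¬ (M.Dom W a ∧ M.Dom W b)) ∧
  M.IsWellOrder (M.Dom W) (M.Less W)

/-- `Y = X^{[<a]}`: it agrees with `X` on the columns `W`-below `a` and is `0` elsewhere, where the
`c`th column of `X` is `b ↦ X(⟨c, b⟩)`. -/
def IsBelow (Y X W : M.F) (a : M.R) : Prop :=
  ∀ c p b : M.R, M.IsPair p c b →
    (M.Less W c a → Y p = X p) ∧ (¬ M.Less W c a → Y p = 0)

/-- Transfinite recursion TR₁(ℝ): for every coded well-ordering `W` and every `Σ¹₁` formula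
`φ(x, Y)` with parameters (`x` the type-1 variable `i`, `Y` the type-2 variable `j`), there is `X`
with `X(⟨a, b⟩) = 1` if `φ(b, X^{[<a]})` and `X(⟨a, b⟩) = 0` otherwise, for all `a` in the domain
of `W` and all `b`. -/
def TR1 : Prop :=
  ∀ W : M.F, M.IsWOCode W → ∀ φ : L3Formula, φ.IsSigma11 → ∀ (v : M.Val) (i j : ℕ),
    ∃ X : M.F, ∀ a : M.R, M.Dom W a → ∃ Y : M.F, M.IsBelow Y X W a ∧ ∀ b : M.R,
      (M.Sat ((v.set .s1 i b).set .s2 j Y) φ → M.PairVal X a b 1) ∧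
      (¬ M.Sat ((v.set .s1 i b).set .s2 j Y) φ → M.PairVal X a b 0)

end L3Structure

/-! The principles are compared by labelling the positions of a well-founded game: label 0 if every
child inside the tree has label 1 (the player to move loses), label 1 otherwise. Bar recursion
provides the labels. Given them and selection, a winning strategy moves from each position labelled
1 to a child labelled 0; well-foundedness ends the play, and it is the opponent who leaves the tree
(`clopenDet_of_br1`).

Conversely, determinacy gives one strategy for one game, whereas all labels are needed at once. In
`ClopenDet.exists_isGraphRec`, for a relation `E` without infinite paths, player I names any real
`x`, II either passes by repeating `x` or moves along `E`, and from then on both move along `E` in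
turn; whoever cannot move loses. Passing is right exactly where the player to move would lose.
Playing two runs of the game against each other shows that I has no winning strategy and that the
passes of a winning strategy of II are the label 0 of the recursion. Bar recursion is the case of
the child relation (`ClopenDet.br1`). Selection comes from a game of two moves (`ClopenDet.sf`).

For transfinite recursion, a `Σ¹₁` statement about a functional `Y` is brought into the form "some
real passes an effective test and predicts countably many values of `Y` correctly"
(`sigma11_isQuery`). Then `E` is a debate: a claim is defended by such a real, and the opponent
attacks one of its predictions about an earlier column (`ClopenDet.tr1`).

For the last implication, a well-ordering of the reals turns the tree into its Kleene–Brouwer order,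
a well-ordering by dependent choice (`SF.kb_wellFounded`). Children precede parents, so transfinite
recursion computes the labels (`br1_of_tr1`).

These arguments need comprehension for quantifiers over reals, the class `RealQuant`. Each set of
hypotheses yields it first, by a tree of height two, a game of three moves or a one-point
well-ordering. Definability is handled by the closure properties of `Eff`, the functions realized by
functionals of the model. -/

namespace L3Structure

/-- `M` is a model of RCA₀³, as a type class. -/
class Model (M : L3Structure.{u}) : Prop where
  out : M.IsModelRCA03
  nonemptyR : Nonempty M.R
  nonemptyF : Nonempty M.F

variable {M : L3Structure.{u}} [hM : Model M]

/-! ## Arithmetic in the model -/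

theorem pMinus : M.PMinus := hM.out.pMinus

noncomputable instance : CommSemiring M.N where
  add := (· + ·)
  mul := (· * ·)
  zero := 0
  one := 1
  add_assoc := pMinus.add_assoc
  add_comm := pMinus.add_comm
  zero_add x := by rw [pMinus.add_comm]; exact pMinus.add_zero x
  add_zero := pMinus.add_zero
  mul_assoc := pMinus.mul_assoc
  mul_comm := pMinus.mul_comm
  left_distrib := pMinus.mul_add
  right_distrib x y z := by
    rw [pMinus.mul_comm, pMinus.mul_add, pMinus.mul_comm z x, pMinus.mul_comm z y]
  mul_zero := pMinus.mul_zero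
  zero_mul x := by rw [pMinus.mul_comm]; exact pMinus.mul_zero x
  mul_one := pMinus.mul_one
  one_mul x := by rw [pMinus.mul_comm]; exact pMinus.mul_one x
  nsmul := nsmulRec

noncomputable instance : LinearOrder M.N where
  le x y := x < y ∨ x = y
  lt := (· < ·)
  le_refl x := Or.inr rfl
  le_trans := by
    rintro x y z (h | rfl) (h' | rfl)
    · exact Or.inl (pMinus.lt_trans _ _ _ h h')
    · exact Or.inl h
    · exact Or.inl h'
    · exact Or.inr rfl
  lt_iff_le_not_ge x y := by
    constructor
    · intro h
      refine ⟨Or.inl h, ?_⟩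
      rintro (h' | rfl)
      · exact pMinus.lt_irrefl _ (pMinus.lt_trans _ _ _ h h')
      · exact pMinus.lt_irrefl _ h
    · rintro ⟨h | rfl, h'⟩
      · exact h
      · exact absurd (Or.inr rfl) h'
  le_antisymm := by
    rintro x y (h | rfl) (h' | h')
    · exact absurd (pMinus.lt_trans _ _ _ h h') (pMinus.lt_irrefl _)
    · exact h'.symm
    · rfl
    · rfl
  le_total x y := by
    rcases pMinus.lt_total x y with h | h | h
    · exact Or.inl (Or.inl h)
    · exact Or.inl (Or.inr h)
    · exact Or.inr (Or.inl h)
  toDecidableLE := Classical.decRel _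

instance : IsStrictOrderedRing M.N where
  add_le_add_left x y h z := by
    rcases h with h | rfl
    · exact Or.inl (pMinus.add_lt_add _ _ _ h)
    · exact le_rfl
  le_of_add_le_add_left x y z h := by
    rcases lt_trichotomy y z with h' | rfl | h'
    · exact Or.inl h'
    · exact le_rfl
    · have := pMinus.add_lt_add _ _ x h'
      rw [pMinus.add_comm z, pMinus.add_comm y] at this
      exact absurd (lt_of_lt_of_le this h) (lt_irrefl _)
  zero_le_one := Or.inl pMinus.zero_lt_one
  exists_pair_ne := ⟨0, 1, ne_of_lt pMinus.zero_lt_one⟩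
  mul_lt_mul_of_pos_left x h y z h' := by
    rw [mul_comm x, mul_comm x]; exact pMinus.mul_lt_mul _ _ _ h h'
  mul_lt_mul_of_pos_right x h y z h' := pMinus.mul_lt_mul _ _ _ h h'

instance : CanonicallyOrderedAdd M.N where
  exists_add_of_le {x y} h := by
    rcases h with h | rfl
    · obtain ⟨z, hz⟩ := pMinus.exists_sub _ _ h
      exact ⟨z, hz.symm⟩
    · exact ⟨0, (add_zero _).symm⟩
  le_add_self x y := by
    rcases pMinus.zero_le y with h | h
    · left
      have := pMinus.add_lt_add _ _ x h
      rwa [zero_add] at this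
    · right; rw [← h, zero_add]
  le_self_add x y := by
    rcases pMinus.zero_le y with h | h
    · left
      have := pMinus.add_lt_add _ _ x h
      rwa [zero_add, add_comm y] at this
    · right; rw [← h, add_zero]

theorem one_le_of_pos {x : M.N} (h : 0 < x) : 1 ≤ x := by
  rcases pMinus.one_le x h with h | h
  · exact h.le
  · exact h.le

theorem add_one_le_of_lt {x y : M.N} (h : x < y) : x + 1 ≤ y := by
  obtain ⟨z, rfl⟩ := exists_add_of_le h.le
  have : 0 < z := by
    rcases pMinus.zero_le z with h' | h'
    · exact h'
    · rw [← h', add_zero] at h; exact absurd h (lt_irrefl _)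
  gcongr
  exact one_le_of_pos this

theorem lt_add_one_iff {x y : M.N} : x < y + 1 ↔ x ≤ y := by
  constructor
  · intro h
    by_contra h'
    exact absurd (lt_of_lt_of_le h (add_one_le_of_lt (not_le.1 h'))) (lt_irrefl _)
  · intro h
    exact lt_of_le_of_lt h (lt_add_of_pos_right _ pMinus.zero_lt_one)

theorem lt_iff_add_one_le {x y : M.N} : x < y ↔ x + 1 ≤ y :=
  ⟨add_one_le_of_lt, fun h => lt_of_lt_of_le (lt_add_of_pos_right _ pMinus.zero_lt_one) h⟩

theorem eq_zero_or_succ (x : M.N) : x = 0 ∨ ∃ y, x = y + 1 := by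
  rcases pMinus.zero_le x with h | h
  · obtain ⟨z, hz⟩ := exists_add_of_le (one_le_of_pos h)
    exact Or.inr ⟨z, by rw [hz, add_comm]⟩
  · exact Or.inl h.symm

theorem double_ne_double_add_one {x y : M.N} : x + x ≠ y + y + 1 := by
  intro h
  rcases lt_trichotomy x y with h' | h' | h'
  · exact absurd h (lt_of_lt_of_le (add_lt_add h' h') (le_add_of_nonneg_right zero_le)).ne
  · subst h'; exact absurd h (lt_add_of_pos_right _ pMinus.zero_lt_one).ne
  · have h1 := add_one_le_of_lt h'
    refine absurd h (lt_of_lt_of_le ?_ (add_le_add h1 h1)).ne'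
    rw [← add_assoc]
    refine lt_add_of_le_of_pos ?_ pMinus.zero_lt_one
    rw [add_right_comm]

theorem double_inj {x y : M.N} (h : x + x = y + y) : x = y := by
  rcases lt_trichotomy x y with h' | h' | h' <;> grind

/-- The sum `s = a + b` can be recovered, because `s² + a` with `a ≤ s` stays below `(s + 1)²`. -/
theorem natPair_inj {a b c d : M.N} (h : M.natPair a b = M.natPair c d) : a = c ∧ b = d := by
  have key : ∀ {a b c d : M.N}, M.natPair a b = M.natPair c d → ¬ a + b < c + d := by
    intro a b c d h hlt
    obtain ⟨e, he⟩ := exists_add_of_le (add_one_le_of_lt hlt)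
    unfold natPair at h
    rw [he] at h
    have h1 : (a + b + 1 + e) * (a + b + 1 + e) + c
        = (a + b) * (a + b) + a + (a + b + b + 1 + (a + b + 1 + (a + b + 1) + e) * e + c) := by ring
    rw [h1] at h
    have h2 : 0 < a + b + b + 1 + (a + b + 1 + (a + b + 1) + e) * e + c := by
      have : (0 : M.N) < 1 := pMinus.zero_lt_one
      positivity
    have := lt_add_of_pos_right ((a + b) * (a + b) + a) h2
    exact absurd h this.ne
  have hs : a + b = c + d := by
    rcases lt_trichotomy (a + b) (c + d) with h' | h' | h'
    · exact absurd h' (key h)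
    · exact h'
    · exact absurd h' (key h.symm)
  unfold natPair at h
  rw [hs] at h
  have := add_left_cancel h
  subst this
  exact ⟨rfl, add_left_cancel hs⟩

/-! ## Functionals given by formulas -/

noncomputable instance : Inhabited M.R := ⟨hM.nonemptyR.some⟩
noncomputable instance : Inhabited M.F := ⟨hM.nonemptyF.some⟩

variable (M) in
/-- A valuation to which parameters are added. -/
noncomputable def val₀ : M.Val := fun p =>
  match p with
  | (.s0, _) => (0 : M.N)
  | (.s1, _) => (default : M.R)
  | (.s2, _) => (default : M.F)

omit hM in
@[simp] theorem Val.set0_same (v : M.Val) (n : ℕ) (a : M.N) : v.set .s0 n a (.s0, n) = a :=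
  Function.update_self ..

omit hM in
@[simp] theorem Val.set0_ne (v : M.Val) (n : ℕ) (p : L3Sort × ℕ) (a : M.N) (h : p ≠ (.s0, n)) :
    v.set .s0 n a p = v p :=
  Function.update_of_ne h ..

omit hM in
@[simp] theorem Val.set1_same (v : M.Val) (n : ℕ) (a : M.R) : v.set .s1 n a (.s1, n) = a :=
  Function.update_self ..

omit hM in
@[simp] theorem Val.set1_ne (v : M.Val) (n : ℕ) (p : L3Sort × ℕ) (a : M.R) (h : p ≠ (.s1, n)) :
    v.set .s1 n a p = v p :=
  Function.update_of_ne h ..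

omit hM in
@[simp] theorem Val.set2_same (v : M.Val) (n : ℕ) (a : M.F) : v.set .s2 n a (.s2, n) = a :=
  Function.update_self ..

omit hM in
@[simp] theorem Val.set2_ne (v : M.Val) (n : ℕ) (p : L3Sort × ℕ) (a : M.F) (h : p ≠ (.s2, n)) :
    v.set .s2 n a p = v p :=
  Function.update_of_ne h ..

/-- A function from reals to naturals that is given by a functional of `M`. -/
def Fn (g : M.R → M.N) : Prop := ∃ F : M.F, ∀ r, F r = g r

/-- The valuation in which comprehension formulas are evaluated: `x` is the type-1 variable `0`,
`y` the type-0 variable `0` and `z` the type-0 variable `9`. -/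
def Val.io (v : M.Val) (x : M.R) (y z : M.N) : M.Val :=
  ((v.set .s1 0 x).set .s0 0 y).set .s0 9 z

/-- The quantifier over variable `9` is vacuous; it only turns the `Σ⁰₀` formula into a `Σ⁰₁` one,
as comprehension requires. -/
theorem Fn.of_formula {g : M.R → M.N} (θ : L3Formula) (hθ : θ.IsSigma00) (v : M.Val)
    (h : ∀ x y z, M.Sat (v.io x y z) θ ↔ y = g x) : Fn g := by
  have key : ∀ x y, M.Sat ((v.set .s1 0 x).set .s0 0 y) (.ex .s0 9 θ) ↔ y = g x := by
    intro x y
    simp only [Sat]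
    constructor
    · rintro ⟨z, hz⟩; exact (h x y z).1 hz
    · intro e; exact ⟨(0 : M.N), (h x y 0).2 e⟩
  obtain ⟨F, hF⟩ := hM.out.comp2 (.ex .s0 9 θ) ⟨9, θ, hθ, rfl⟩ v 0 0
    (fun x => ⟨g x, (key _ _).2 rfl, fun y hy => (key x y).1 hy⟩)
  exact ⟨F, fun r => (key r _).1 (hF r)⟩

theorem Fn.of_term {g : M.R → M.N} (t : L3Term .s0) (v : M.Val)
    (h : ∀ x y z, M.eval (v.io x y z) t = g x) : Fn g :=
  Fn.of_formula (.eq .s0 (.var .s0 0) t) (.eq _ _) v fun x y z => by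
    simp only [Sat, h]; simp [eval, Val.io]; rfl

theorem Fn.const (c : M.N) : Fn fun _ : M.R => c :=
  .of_term (.var .s0 1) (M.val₀.set .s0 1 c) fun x y z => by simp [eval, Val.io]; rfl

theorem Fn.add {f g : M.R → M.N} (hf : Fn f) (hg : Fn g) : Fn fun r => f r + g r := by
  obtain ⟨F, hF⟩ := hf
  obtain ⟨G, hG⟩ := hg
  refine .of_term (.add (.app1 (.var .s2 0) (.var .s1 0)) (.app1 (.var .s2 1) (.var .s1 0)))
    ((M.val₀.set .s2 0 F).set .s2 1 G) fun x y z => ?_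
  rw [← hF, ← hG]; simp [eval, Val.io]; rfl

theorem Fn.mul {f g : M.R → M.N} (hf : Fn f) (hg : Fn g) : Fn fun r => f r * g r := by
  obtain ⟨F, hF⟩ := hf
  obtain ⟨G, hG⟩ := hg
  refine .of_term (.mul (.app1 (.var .s2 0) (.var .s1 0)) (.app1 (.var .s2 1) (.var .s1 0)))
    ((M.val₀.set .s2 0 F).set .s2 1 G) fun x y z => ?_
  rw [← hF, ← hG]; simp [eval, Val.io]; rfl

theorem Fn.self_app {g : M.R → M.N} (hg : Fn g) : Fn fun r => r (g r) := by
  obtain ⟨G, hG⟩ := hg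
  refine .of_term (.app0 (.var .s1 0) (.app1 (.var .s2 1) (.var .s1 0))) (M.val₀.set .s2 1 G)
    fun x y z => ?_
  rw [← hG]; simp [eval, Val.io]; rfl

theorem Fn.param_app {g : M.R → M.N} (c : M.R) (hg : Fn g) : Fn fun r => c (g r) := by
  obtain ⟨G, hG⟩ := hg
  refine .of_term (.app0 (.var .s1 1) (.app1 (.var .s2 1) (.var .s1 0)))
    ((M.val₀.set .s2 1 G).set .s1 1 c) fun x y z => ?_
  rw [← hG]; simp [eval, Val.io]; rfl

theorem Fn.comp_star {f : M.R → M.N} (hf : Fn f) (G : M.F) : Fn fun r => f (M.star G r) := by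
  obtain ⟨F, hF⟩ := hf
  refine .of_term (.app1 (.var .s2 0) (.star (.var .s2 1) (.var .s1 0)))
    ((M.val₀.set .s2 0 F).set .s2 1 G) fun x y z => ?_
  rw [← hF]; simp [eval, Val.io]; rfl

theorem Fn.push {f g : M.R → M.N} (hf : Fn f) (hg : Fn g) : Fn fun r => f (M.cons (g r) r) := by
  obtain ⟨F, hF⟩ := hf
  obtain ⟨G, hG⟩ := hg
  refine .of_term (.app1 (.var .s2 0) (.cons (.app1 (.var .s2 1) (.var .s1 0)) (.var .s1 0)))
    ((M.val₀.set .s2 0 F).set .s2 1 G) fun x y z => ?_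
  rw [← hF, ← hG]; simp [eval, Val.io]; rfl

theorem Fn.push_star_star {f g : M.R → M.N} (hf : Fn f) (hg : Fn g) (H K : M.F) :
    Fn fun r => f (M.cons (g r) (M.star H (M.star K r))) := by
  obtain ⟨F, hF⟩ := hf
  obtain ⟨G, hG⟩ := hg
  refine .of_term (.app1 (.var .s2 0) (.cons (.app1 (.var .s2 1) (.var .s1 0))
    (.star (.var .s2 2) (.star (.var .s2 3) (.var .s1 0)))))
    ((((M.val₀.set .s2 0 F).set .s2 1 G).set .s2 2 H).set .s2 3 K) fun x y z => ?_
  rw [← hF, ← hG]; simp [eval, Val.io]; rfl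

open Classical in
theorem Fn.ite_lt {f g h k : M.R → M.N} (hf : Fn f) (hg : Fn g) (hh : Fn h) (hk : Fn k) :
    Fn fun r => if f r < g r then h r else k r := by
  obtain ⟨F, hF⟩ := hf
  obtain ⟨G, hG⟩ := hg
  obtain ⟨H, hH⟩ := hh
  obtain ⟨K, hK⟩ := hk
  let A (n : ℕ) : L3Term .s0 := .app1 (.var .s2 n) (.var .s1 0)
  refine .of_formula (.or (.and (.lt (A 0) (A 1)) (.eq .s0 (.var .s0 0) (A 2)))
    (.and (.not (.lt (A 0) (A 1))) (.eq .s0 (.var .s0 0) (A 3))))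
    (.or (.and (.lt _ _) (.eq _ _)) (.and (.not (.lt _ _)) (.eq _ _)))
    ((((M.val₀.set .s2 0 F).set .s2 1 G).set .s2 2 H).set .s2 3 K) fun x y z => ?_
  simp only [← hF, ← hG, ← hH, ← hK]
  simp only [Sat, A, eval, Val.io]
  simp
  change (F x < G x ∧ _ ∨ ¬ F x < G x ∧ _) ↔ _
  split_ifs with hlt <;> simp [hlt] <;> rfl

-- A bound number is put in front of the real argument, so that a real serves as an environment: its
-- head is the innermost number variable and its tail the rest.
open Classical in
theorem Fn.bex {f g : M.R → M.N} (hf : Fn f) (hg : Fn g) :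
    Fn fun r => if ∃ z < g r, f (M.cons z r) = 1 then 1 else 0 := by
  obtain ⟨F, hF⟩ := hf
  obtain ⟨G, hG⟩ := hg
  let B : L3Formula := .ex .s0 1 (.and (.lt (.var .s0 1) (.app1 (.var .s2 1) (.var .s1 0)))
    (.eq .s0 (.app1 (.var .s2 0) (.cons (.var .s0 1) (.var .s1 0))) .one))
  have hB : B.IsSigma00 := .bex 1 _ (by simp [L3Term.HasVar0]) (.eq _ _)
  refine .of_formula (.or (.and B (.eq .s0 (.var .s0 0) .one))
    (.and (.not B) (.eq .s0 (.var .s0 0) .zero)))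
    (.or (.and hB (.eq _ _)) (.and (.not hB) (.eq _ _)))
    ((M.val₀.set .s2 0 F).set .s2 1 G) fun x y z => ?_
  simp only [← hF, ← hG]
  simp only [Sat, B, eval, Val.io]
  simp
  change ((∃ z : M.N, z < G x ∧ F (M.cons z x) = 1) ∧ y = 1 ∨
    (∀ z : M.N, z < G x → ¬ F (M.cons z x) = 1) ∧ y = 0) ↔ _
  split_ifs with hlt
  · simp only [hlt, true_and, or_iff_left_iff_imp, and_imp]
    obtain ⟨z, h1, h2⟩ := hlt
    exact fun h => absurd h2 (h z h1)
  · have : ∀ z : M.N, z < G x → ¬ F (M.cons z x) = 1 := fun z h1 h2 => hlt ⟨z, h1, h2⟩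
    simp only [hlt, false_and, false_or]
    exact ⟨fun h => h.2, fun h => ⟨this, h⟩⟩

theorem Fn.of_graph_functional {g : M.R → M.N} (F : M.F)
    (h : ∀ r k, F (M.cons k r) = 1 ↔ k = g r) : Fn g := by
  refine .of_formula (.eq .s0 (.app1 (.var .s2 0) (.cons (.var .s0 0) (.var .s1 0))) .one)
    (.eq _ _) (M.val₀.set .s2 0 F) fun x y z => ?_
  rw [← h]
  simp only [Sat, eval, Val.io]
  simp
  rfl

theorem induction_functional (F : M.F) (r : M.R) (h0 : F (M.cons 0 r) = 1)
    (hs : ∀ n : M.N, F (M.cons n r) = 1 → F (M.cons (n + 1) r) = 1) (n : M.N) :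
    F (M.cons n r) = 1 := by
  let θ : L3Formula := .eq .s0 (.app1 (.var .s2 0) (.cons (.var .s0 0) (.var .s1 0))) .one
  let v := (M.val₀.set .s2 0 F).set .s1 0 r
  have key : ∀ n : M.N, M.Sat (v.set .s0 0 n) (.ex .s0 9 θ) ↔ F (M.cons n r) = 1 := by
    intro n
    simp only [Sat, θ, eval, v]
    exact ⟨fun ⟨_, h⟩ => h, fun h => ⟨(0 : M.N), h⟩⟩
  exact (key n).1 (hM.out.induction _ ⟨9, θ, .eq _ _, rfl⟩ v 0 ((key 0).2 h0)
    (fun n h => (key _).2 (hs n ((key n).1 h))) n)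

/-! ### Decidable predicates of reals -/

/-- A functional of `M` decides the predicate. -/
def Dec (p : M.R → Prop) : Prop := ∃ f, Fn f ∧ ∀ r, f r = 1 ↔ p r

open Classical in
theorem Fn.ite {p : M.R → Prop} {h k : M.R → M.N} (hp : Dec p) (hh : Fn h) (hk : Fn k) :
    Fn fun r => if p r then h r else k r := by
  obtain ⟨f, hf, hfp⟩ := hp
  have : (fun r => if p r then h r else k r) =
      fun r => if f r < 1 then k r else if 1 < f r then k r else h r := by
    funext r
    rw [← hfp]
    rcases lt_trichotomy (f r) 1 with h' | h' | h'
    · simp [h', h'.ne]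
    · simp [h']
    · simp [h', h'.ne', h'.not_gt]
  rw [this]
  exact .ite_lt hf (.const 1) hk (.ite_lt (.const 1) hf hk hh)

open Classical in
theorem Dec.not {p : M.R → Prop} (hp : Dec p) : Dec fun r => ¬ p r :=
  ⟨_, .ite hp (.const 0) (.const 1), fun r => by split_ifs <;> simp [*]⟩

open Classical in
theorem Dec.and {p q : M.R → Prop} (hp : Dec p) (hq : Dec q) : Dec fun r => p r ∧ q r :=
  ⟨_, .ite hp (.ite hq (.const 1) (.const 0)) (.const 0), fun r => by split_ifs <;> simp [*]⟩

open Classical in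
theorem Dec.lt {f g : M.R → M.N} (hf : Fn f) (hg : Fn g) : Dec fun r => f r < g r :=
  ⟨_, .ite_lt hf hg (.const 1) (.const 0), fun r => by split_ifs <;> simp [*]⟩

theorem Dec.eq {f g : M.R → M.N} (hf : Fn f) (hg : Fn g) : Dec fun r => f r = g r := by
  have := (Dec.lt hf hg).not.and (Dec.lt hg hf).not
  refine (congrArg Dec (funext fun r => ?_)).mp this
  simp only [not_lt, eq_iff_iff]
  exact ⟨fun h => le_antisymm h.2 h.1, fun h => ⟨h.ge, h.le⟩⟩

theorem Dec.bex {p : M.R → Prop} {g : M.R → M.N} (hp : Dec p) (hg : Fn g) :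
    Dec fun r => ∃ z < g r, p (M.cons z r) := by
  obtain ⟨f, hf, hfp⟩ := hp
  simp only [← hfp]
  exact ⟨_, Fn.bex hf hg, fun r => by simp⟩

theorem Dec.induction {p : M.R → Prop} (hp : Dec p) (r : M.R) (h0 : p (M.cons 0 r))
    (hs : ∀ n : M.N, p (M.cons n r) → p (M.cons (n + 1) r)) (n : M.N) : p (M.cons n r) := by
  obtain ⟨f, ⟨F, hF⟩, hfp⟩ := hp
  simp only [← hfp, ← hF] at *
  exact induction_functional F r h0 hs n

theorem cons_zero (k : M.N) (r : M.R) : M.cons k r 0 = k := hM.out.cons_zero k r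
theorem cons_succ (k : M.N) (r : M.R) (n : M.N) : M.cons k r (n + 1) = r n :=
  hM.out.cons_succ k r n
theorem star_app (F : M.F) (r : M.R) (k : M.N) : M.star F r k = F (M.cons k r) :=
  hM.out.star_app F r k
theorem real_ext {f g : M.R} (h : ∀ n : M.N, f n = g n) : f = g := (hM.out.ext1 f g).1 h

end L3Structure

namespace L3Structure
variable {M : L3Structure.{u}} [hM : Model M]

/-! ## Operations on reals -/

/-- An operation on reals that is `r ↦ G * r` for a functional `G` of `M`. -/
def FnR (Φ : M.R → M.R) : Prop := ∃ G : M.F, ∀ r, M.star G r = Φ r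

theorem Fn.comp {f : M.R → M.N} {Φ : M.R → M.R} (hf : Fn f) (hΦ : FnR Φ) : Fn fun r => f (Φ r) := by
  obtain ⟨G, hG⟩ := hΦ
  simpa only [hG] using hf.comp_star G

/-- Since `(G * r)(k) = G(k⌢r)`, evaluating `G * r` at a number computed from `r` amounts to
prefixing that number to `r`. -/
theorem Fn.apply_real {Φ : M.R → M.R} {g : M.R → M.N} (hΦ : FnR Φ) (hg : Fn g) :
    Fn fun r => Φ r (g r) := by
  obtain ⟨G, hG⟩ := hΦ
  simpa only [← hG, star_app] using Fn.push ⟨G, fun _ => rfl⟩ hg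

theorem Fn.head : Fn fun r : M.R => r 0 := .self_app (.const 0)

theorem exists_tail : ∃ G : M.F, ∀ (r : M.R) (n : M.N), M.star G r n = r (n + 1) := by
  -- On `n⌢r` this reads position `n + 2`, which is `r(n + 1)`.
  obtain ⟨G, hG⟩ : Fn fun r : M.R => r (r 0 + 1 + 1) :=
    .self_app (.add (.add .head (.const 1)) (.const 1))
  exact ⟨G, fun r n => by simp only [star_app, hG, cons_zero, cons_succ]⟩

/-- The real `n ↦ r (n + 1)`. -/
noncomputable def tail (r : M.R) : M.R := M.star exists_tail.choose r

@[simp] theorem tail_apply (r : M.R) (n : M.N) : tail r n = r (n + 1) :=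
  exists_tail.choose_spec r n

@[simp] theorem tail_cons (k : M.N) (r : M.R) : tail (M.cons k r) = r :=
  real_ext fun n => by rw [tail_apply, cons_succ]

theorem cons_tail (r : M.R) : M.cons (r 0) (tail r) = r := by
  refine real_ext fun n => ?_
  rcases eq_zero_or_succ n with rfl | ⟨m, rfl⟩
  · rw [cons_zero]
  · rw [cons_succ, tail_apply]

theorem FnR.tail : FnR (tail : M.R → M.R) := ⟨_, fun _ => rfl⟩

/-- Uncurrying, the converse of `Fn.apply_real`: the head of `x` is the argument and the tail is the
real operated on. -/
theorem FnR.of_fn {Φ : M.R → M.R} (h : Fn fun x => Φ (L3Structure.tail x) (x 0)) : FnR Φ := by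
  obtain ⟨G, hG⟩ := h
  refine ⟨G, fun r => real_ext fun n => ?_⟩
  simp only [star_app, hG, tail_cons, cons_zero]

theorem FnR.comp {Φ Ψ : M.R → M.R} (hΦ : FnR Φ) (hΨ : FnR Ψ) : FnR fun r => Φ (Ψ r) := by
  obtain ⟨G, hG⟩ := hΦ
  obtain ⟨H, hH⟩ := hΨ
  obtain ⟨T, hT⟩ := FnR.tail (M := M)
  refine .of_fn ?_
  -- With `T` stripping the head, the composite is `x ↦ G(x(0)⌢(H * (T * x)))`.
  simpa only [← hG, ← hH, ← hT, star_app] using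
    Fn.push_star_star (f := fun x => G x) ⟨G, fun _ => rfl⟩ .head H T

theorem FnR.id : FnR fun r : M.R => r := .of_fn (.apply_real .tail .head)

theorem FnR.const (c : M.R) : FnR fun _ : M.R => c := .of_fn (.param_app c .head)

theorem Dec.comp {p : M.R → Prop} {Φ : M.R → M.R} (hp : Dec p) (hΦ : FnR Φ) :
    Dec fun r => p (Φ r) :=
  let ⟨_, hf, hfp⟩ := hp
  ⟨_, hf.comp hΦ, fun r => hfp (Φ r)⟩

theorem Fn.of_graph {g : M.R → M.N} {p : M.R → Prop} (hp : Dec p)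
    (h : ∀ r k, p (M.cons k r) ↔ k = g r) : Fn g := by
  obtain ⟨f, ⟨F, hF⟩, hfp⟩ := hp
  exact .of_graph_functional F fun r k => by rw [hF, hfp, h]

theorem Fn.tail {f : M.R → M.N} (hf : Fn f) : Fn fun r => f (tail r) := hf.comp .tail

theorem Dec.tail {p : M.R → Prop} (hp : Dec p) : Dec fun r => p (tail r) := hp.comp .tail

omit hM in
theorem Dec.congr {p q : M.R → Prop} (hp : Dec p) (h : ∀ r, p r ↔ q r) : Dec q :=
  let ⟨f, hf, hfp⟩ := hp
  ⟨f, hf, fun r => (hfp r).trans (h r)⟩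

theorem Dec.or {p q : M.R → Prop} (hp : Dec p) (hq : Dec q) : Dec fun r => p r ∨ q r :=
  (hp.not.and hq.not).not.congr fun r => by tauto

theorem Dec.exists_lt {p : M.N → M.R → Prop} {g : M.R → M.N}
    (hp : Dec fun x => p (x 0) (L3Structure.tail x)) (hg : Fn g) : Dec fun r => ∃ z < g r, p z r :=
  (hp.bex hg).congr fun r => by simp only [cons_zero, tail_cons]

theorem Dec.nat_induction {p : M.N → M.R → Prop} (hp : Dec fun x => p (x 0) (L3Structure.tail x))
    (r : M.R) (h0 : p 0 r) (hs : ∀ n, p n r → p (n + 1) r) (n : M.N) : p n r := by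
  have := hp.induction r
  simp only [cons_zero, tail_cons] at this
  exact this h0 hs n

theorem exists_half (n : M.N) : ∃ y, y + y = n ∨ y + y + 1 = n := by
  -- The bound `y < n + 1` keeps the induction predicate decidable.
  have := Dec.nat_induction (M := M) (p := fun n _ => ∃ y < n + 1, y + y = n ∨ y + y + 1 = n)
    (.exists_lt (p := fun y x => y + y = x 0 ∨ y + y + 1 = x 0)
      (.or (.eq (.add .head .head) (.tail .head)) (.eq (.add (.add .head .head) (.const 1))
        (.tail .head))) (.add .head (.const 1))) default
    ⟨0, by rw [zero_add]; exact pMinus.zero_lt_one, Or.inl (add_zero 0)⟩ (by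
      rintro n ⟨y, hy, h | h⟩
      · exact ⟨y, hy.trans (lt_add_of_pos_right _ pMinus.zero_lt_one), Or.inr (by rw [h])⟩
      · exact ⟨y + 1, add_lt_add_left hy 1, Or.inl (by rw [← h]; ring)⟩) n
  obtain ⟨y, _, h⟩ := this
  exact ⟨y, h⟩

/-- Half of `n`, rounded down. -/
noncomputable def half (n : M.N) : M.N := (exists_half n).choose

theorem half_spec (n : M.N) : half n + half n = n ∨ half n + half n + 1 = n :=
  (exists_half n).choose_spec

theorem eq_half_iff {n y : M.N} : y = half n ↔ y + y = n ∨ y + y + 1 = n := by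
  constructor
  · rintro rfl; exact half_spec n
  · rintro (h | h) <;> rcases half_spec n with h' | h'
    · exact double_inj (h.trans h'.symm)
    · exact absurd (h.trans h'.symm) double_ne_double_add_one
    · exact absurd (h'.trans h.symm) double_ne_double_add_one
    · exact double_inj (add_right_cancel (h.trans h'.symm))

@[simp] theorem half_double (n : M.N) : half (n + n) = n := (eq_half_iff.2 (Or.inl rfl)).symm
@[simp] theorem half_double_add_one (n : M.N) : half (n + n + 1) = n :=
  (eq_half_iff.2 (Or.inr rfl)).symm

theorem Fn.half {f : M.R → M.N} (hf : Fn f) : Fn fun r => half (f r) :=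
  .of_graph (p := fun x => x 0 + x 0 = f (L3Structure.tail x) ∨
      x 0 + x 0 + 1 = f (L3Structure.tail x))
    (.or (.eq (.add .head .head) hf.tail) (.eq (.add (.add .head .head) (.const 1)) hf.tail))
    fun r k => by rw [cons_zero, tail_cons, eq_half_iff]

/-- The predecessor, `0` at `0`. -/
noncomputable def pred (n : M.N) : M.N := open Classical in if h : n = 0 then 0 else
  ((eq_zero_or_succ n).resolve_left h).choose

@[simp] theorem pred_zero : pred (0 : M.N) = 0 := dif_pos rfl

@[simp] theorem pred_succ (n : M.N) : pred (n + 1) = n := by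
  have h : n + 1 ≠ 0 := (lt_of_le_of_lt zero_le (lt_add_one_iff.2 le_rfl)).ne'
  rw [pred, dif_neg h]
  exact (add_right_cancel ((eq_zero_or_succ (n + 1)).resolve_left h).choose_spec).symm

theorem Fn.pred {f : M.R → M.N} (hf : Fn f) : Fn fun r => pred (f r) := by
  refine .of_graph (p := fun x => x 0 + 1 = f (L3Structure.tail x) ∨
      f (L3Structure.tail x) = 0 ∧ x 0 = 0)
    (.or (.eq (.add .head (.const 1)) hf.tail) (.and (.eq hf.tail (.const 0))
      (.eq .head (.const 0)))) fun r k => ?_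
  rw [cons_zero, tail_cons]
  rcases eq_zero_or_succ (f r) with h | ⟨m, h⟩
  · rw [h, pred_zero]
    constructor
    · rintro (h | h)
      · exact absurd h (lt_of_le_of_lt zero_le (lt_add_one_iff.2 le_rfl)).ne'
      · exact h.2
    · exact fun h => Or.inr ⟨rfl, h⟩
  · rw [h, pred_succ]
    constructor
    · rintro (h | h)
      · exact add_right_cancel h
      · exact absurd h.1 (lt_of_le_of_lt zero_le (lt_add_one_iff.2 le_rfl)).ne'
    · exact fun h => Or.inl (by rw [h])

theorem FnR.cons {Φ : M.R → M.R} {f : M.R → M.N} (hf : Fn f) (hΦ : FnR Φ) :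
    FnR fun r => M.cons (f r) (Φ r) := by
  classical
  refine .of_fn ?_
  have := Fn.ite (.eq .head (.const 0)) hf.tail (.apply_real (hΦ.comp .tail) (.pred .head))
  refine (congrArg Fn (funext fun r => ?_)).mp this
  rcases eq_zero_or_succ (r 0) with h | ⟨m, h⟩
  · rw [h, if_pos rfl, cons_zero]
  · rw [h, if_neg (lt_of_le_of_lt zero_le (lt_add_one_iff.2 le_rfl)).ne', cons_succ, pred_succ]

/-! ## Pairs -/

theorem exists_evens : ∃ G : M.F, ∀ (r : M.R) (n : M.N), M.star G r n = r (n + n) := by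
  obtain ⟨G, hG⟩ : Fn fun x : M.R => tail x (x 0 + x 0) := .apply_real .tail (.add .head .head)
  exact ⟨G, fun r n => by simp only [star_app, hG, cons_zero, tail_cons]⟩

theorem exists_odds : ∃ G : M.F, ∀ (r : M.R) (n : M.N), M.star G r n = r (n + n + 1) := by
  obtain ⟨G, hG⟩ : Fn fun x : M.R => tail x (x 0 + x 0 + 1) :=
    .apply_real .tail (.add (.add .head .head) (.const 1))
  exact ⟨G, fun r n => by simp only [star_app, hG, cons_zero, tail_cons]⟩

/-- The first component of a pair. -/
noncomputable def evens (r : M.R) : M.R := M.star exists_evens.choose r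
/-- The second component of a pair. -/
noncomputable def odds (r : M.R) : M.R := M.star exists_odds.choose r

@[simp] theorem evens_apply (r : M.R) (n : M.N) : evens r n = r (n + n) :=
  exists_evens.choose_spec r n
@[simp] theorem odds_apply (r : M.R) (n : M.N) : odds r n = r (n + n + 1) :=
  exists_odds.choose_spec r n

theorem FnR.evens : FnR (evens : M.R → M.R) := ⟨_, fun _ => rfl⟩
theorem FnR.odds : FnR (odds : M.R → M.R) := ⟨_, fun _ => rfl⟩

theorem isPair_iff {p x y : M.R} : M.IsPair p x y ↔ x = evens p ∧ y = odds p := by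
  constructor
  · intro h
    exact ⟨real_ext fun n => by rw [evens_apply, (h n).1],
      real_ext fun n => by rw [odds_apply, (h n).2]⟩
  · rintro ⟨rfl, rfl⟩ n
    simp

theorem ext_pair {p q : M.R} (h1 : evens p = evens q) (h2 : odds p = odds q) : p = q := by
  refine real_ext fun n => ?_
  rcases half_spec n with h | h <;> rw [← h]
  · rw [← evens_apply, h1, evens_apply]
  · rw [← odds_apply, h2, odds_apply]

theorem exists_pair {Φ Ψ : M.R → M.R} (hΦ : FnR Φ) (hΨ : FnR Ψ) :
    ∃ G : M.F, ∀ r, evens (M.star G r) = Φ r ∧ odds (M.star G r) = Ψ r := by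
  classical
  obtain ⟨G, hG⟩ := Fn.ite (.eq (.add (.half .head) (.half .head)) .head)
    (.apply_real (hΦ.comp .tail) (.half .head)) (.apply_real (hΨ.comp .tail) (.half .head))
  refine ⟨G, fun r => ⟨real_ext fun n => ?_, real_ext fun n => ?_⟩⟩
  · simp [star_app, hG, cons_zero]
  · simp only [odds_apply, star_app, hG, cons_zero, half_double_add_one, tail_cons]
    exact if_neg (lt_add_one_iff.2 le_rfl).ne

theorem exists_isPair (x y : M.R) : ∃ p, evens p = x ∧ odds p = y :=
  let ⟨G, hG⟩ := exists_pair (.const x) (.const y)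
  ⟨M.star G default, hG default⟩

/-- The pair of two reals. -/
noncomputable def pair (x y : M.R) : M.R := (exists_isPair x y).choose

@[simp] theorem evens_pair (x y : M.R) : evens (pair x y) = x := (exists_isPair x y).choose_spec.1
@[simp] theorem odds_pair (x y : M.R) : odds (pair x y) = y := (exists_isPair x y).choose_spec.2
@[simp] theorem pair_evens_odds (p : M.R) : pair (evens p) (odds p) = p :=
  ext_pair (by simp) (by simp)

theorem isPair_pair (x y : M.R) : M.IsPair (pair x y) x y := isPair_iff.2 (by simp)

theorem IsPair.eq_pair {p x y : M.R} (h : M.IsPair p x y) : p = pair x y := by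
  obtain ⟨rfl, rfl⟩ := isPair_iff.1 h
  simp

theorem pairVal_iff {f : M.F} {x y : M.R} {c : M.N} : M.PairVal f x y c ↔ f (pair x y) = c :=
  ⟨fun ⟨_, h, h'⟩ => h.eq_pair ▸ h', fun h => ⟨_, isPair_pair x y, h⟩⟩

theorem FnR.pair {Φ Ψ : M.R → M.R} (hΦ : FnR Φ) (hΨ : FnR Ψ) : FnR fun r => pair (Φ r) (Ψ r) :=
  let ⟨G, hG⟩ := exists_pair hΦ hΨ
  ⟨G, fun r => ext_pair (by simp [hG r]) (by simp [hG r])⟩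

/-! ## Represented spaces and effective functions -/

/-- A type whose elements are represented by reals of `M`. -/
class Coded (M : L3Structure.{u}) [Model M] (α : Type*) where
  /-- The element represented by a real. -/
  dec : M.R → α
  surj : Function.Surjective dec

noncomputable instance : Coded M M.R := ⟨fun r => r, fun r => ⟨r, rfl⟩⟩
noncomputable instance : Coded M M.N := ⟨fun r => r 0, fun n => ⟨M.cons n default, cons_zero _ _⟩⟩
noncomputable instance : Coded M Prop :=
  ⟨fun r => r 0 = 1, fun p => by
    by_cases h : p
    · exact ⟨M.cons 1 default, by simp [cons_zero, h]⟩
    · exact ⟨M.cons 0 default, by simp [cons_zero, h]⟩⟩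
noncomputable instance {α β : Type*} [Coded M α] [Coded M β] : Coded M (α × β) :=
  ⟨fun r => (Coded.dec (evens r), Coded.dec (odds r)), fun ⟨a, b⟩ => by
    obtain ⟨x, rfl⟩ := Coded.surj (M := M) a
    obtain ⟨y, rfl⟩ := Coded.surj (M := M) b
    exact ⟨pair x y, by simp⟩⟩

variable (M) in
/-- A function between represented types is effective if `M` contains a functional that realizes
it. -/
@[fun_prop]
def Eff {α β : Type*} [Coded M α] [Coded M β] (f : α → β) : Prop :=
  ∃ Φ : M.R → M.R, FnR Φ ∧ ∀ r, Coded.dec (M := M) (Φ r) = f (Coded.dec (M := M) r)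

variable {α β γ δ : Type*} [Coded M α] [Coded M β] [Coded M γ] [Coded M δ]

theorem eff_iff_fn {f : α → M.N} : Eff M f ↔ Fn fun r : M.R => f (Coded.dec r) := by
  constructor
  · rintro ⟨Φ, hΦ, h⟩
    simp only [← h]
    exact Fn.head.comp hΦ
  · intro h
    exact ⟨_, .cons h (.const default), fun r => cons_zero _ _⟩

theorem eff_iff_dec {p : α → Prop} : Eff M p ↔ Dec fun r : M.R => p (Coded.dec r) := by
  classical
  constructor
  · rintro ⟨Φ, hΦ, h⟩
    exact ⟨_, Fn.head.comp hΦ, fun r => (h r).to_iff⟩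
  · intro h
    obtain ⟨f, hf, hfp⟩ := h
    refine ⟨_, .cons hf (.const default), fun r => ?_⟩
    refine Eq.trans ?_ (propext (hfp r))
    exact congrArg (· = 1) (cons_zero _ _)

theorem eff_iff_fnR {f : M.R → M.R} : Eff M f ↔ FnR f := by
  constructor
  · rintro ⟨Φ, hΦ, h⟩
    rwa [show f = Φ from funext fun r => (h r).symm]
  · exact fun h => ⟨f, h, fun r => rfl⟩

@[fun_prop] theorem Eff.id : Eff M fun a : α => a := ⟨_, .id, fun _ => rfl⟩

@[fun_prop] theorem Eff.const (b : β) : Eff M fun _ : α => b :=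
  let ⟨c, hc⟩ := Coded.surj (M := M) b
  ⟨_, .const c, fun _ => hc⟩

@[fun_prop] theorem Eff.comp {f : β → γ} {g : α → β} (hf : Eff M f) (hg : Eff M g) :
    Eff M fun a => f (g a) :=
  let ⟨_, hF, hf⟩ := hf
  let ⟨_, hG, hg⟩ := hg
  ⟨_, hF.comp hG, fun r => by rw [hf, hg]⟩

@[fun_prop] theorem Eff.prodMk {f : α → β} {g : α → γ} (hf : Eff M f) (hg : Eff M g) :
    Eff M fun a => (f a, g a) :=
  let ⟨_, hF, hf⟩ := hf
  let ⟨_, hG, hg⟩ := hg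
  ⟨_, hF.pair hG, fun r => by
    exact Prod.ext ((congrArg Coded.dec (evens_pair _ _)).trans (hf r))
      ((congrArg Coded.dec (odds_pair _ _)).trans (hg r))⟩

@[fun_prop] theorem Eff.fst : Eff M (Prod.fst : α × β → α) := ⟨_, .evens, fun _ => rfl⟩
@[fun_prop] theorem Eff.snd : Eff M (Prod.snd : α × β → β) := ⟨_, .odds, fun _ => rfl⟩

theorem Eff.op₂ {F : β → γ → δ} (hF : Eff M fun p : β × γ => F p.1 p.2) {f : α → β} {g : α → γ}
    (hf : Eff M f) (hg : Eff M g) : Eff M fun a => F (f a) (g a) :=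
  hF.comp (hf.prodMk hg)

/-! ### Closure properties of effective functions -/

@[fun_prop] theorem Eff.add {f g : α → M.N} (hf : Eff M f) (hg : Eff M g) :
    Eff M fun a => f a + g a :=
  eff_iff_fn.2 (.add (eff_iff_fn.1 hf) (eff_iff_fn.1 hg))

@[fun_prop] theorem Eff.mul {f g : α → M.N} (hf : Eff M f) (hg : Eff M g) :
    Eff M fun a => f a * g a :=
  eff_iff_fn.2 (.mul (eff_iff_fn.1 hf) (eff_iff_fn.1 hg))

@[fun_prop] theorem Eff.half {f : α → M.N} (hf : Eff M f) : Eff M fun a => half (f a) :=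
  eff_iff_fn.2 (.half (eff_iff_fn.1 hf))

@[fun_prop] theorem Eff.pred {f : α → M.N} (hf : Eff M f) : Eff M fun a => pred (f a) :=
  eff_iff_fn.2 (.pred (eff_iff_fn.1 hf))

@[fun_prop] theorem Eff.lt {f g : α → M.N} (hf : Eff M f) (hg : Eff M g) :
    Eff M fun a => f a < g a :=
  eff_iff_dec.2 (.lt (eff_iff_fn.1 hf) (eff_iff_fn.1 hg))

@[fun_prop] theorem Eff.nat_eq {f g : α → M.N} (hf : Eff M f) (hg : Eff M g) :
    Eff M fun a => f a = g a :=
  eff_iff_dec.2 (.eq (eff_iff_fn.1 hf) (eff_iff_fn.1 hg))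

@[fun_prop] theorem Eff.not {p : α → Prop} (hp : Eff M p) : Eff M fun a => ¬ p a :=
  eff_iff_dec.2 (.not (eff_iff_dec.1 hp))

@[fun_prop] theorem Eff.and {p q : α → Prop} (hp : Eff M p) (hq : Eff M q) :
    Eff M fun a => p a ∧ q a :=
  eff_iff_dec.2 (.and (eff_iff_dec.1 hp) (eff_iff_dec.1 hq))

@[fun_prop] theorem Eff.or {p q : α → Prop} (hp : Eff M p) (hq : Eff M q) :
    Eff M fun a => p a ∨ q a :=
  eff_iff_dec.2 (.or (eff_iff_dec.1 hp) (eff_iff_dec.1 hq))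

@[fun_prop] theorem Eff.imp {p q : α → Prop} (hp : Eff M p) (hq : Eff M q) :
    Eff M fun a => p a → q a := by
  simpa only [imp_iff_not_or] using hp.not.or hq

@[fun_prop] theorem Eff.le {f g : α → M.N} (hf : Eff M f) (hg : Eff M g) :
    Eff M fun a => f a ≤ g a := by
  simpa only [not_lt] using (hg.lt hf).not

@[fun_prop] theorem Eff.ite_nat {p : α → Prop} [∀ a, Decidable (p a)] {f g : α → M.N}
    (hp : Eff M p) (hf : Eff M f) (hg : Eff M g) : Eff M fun a => if p a then f a else g a := by
  have := Fn.ite (eff_iff_dec.1 hp) (eff_iff_fn.1 hf) (eff_iff_fn.1 hg)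
  refine eff_iff_fn.2 ((congrArg Fn (funext fun r => ?_)).mp this)
  congr

@[fun_prop] theorem Eff.ite_real {p : α → Prop} [∀ a, Decidable (p a)] {f g : α → M.R}
    (hp : Eff M p) (hf : Eff M f) (hg : Eff M g) : Eff M fun a => if p a then f a else g a := by
  obtain ⟨Φ, hΦ, hf⟩ := hf
  obtain ⟨Ψ, hΨ, hg⟩ := hg
  refine ⟨fun r => if p (Coded.dec r) then Φ r else Ψ r, .of_fn ?_, fun r => ?_⟩
  · refine (congrArg Fn (funext fun r => ?_)).mp (Fn.ite (eff_iff_dec.1 hp).tail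
      (.apply_real (hΦ.comp .tail) .head) (.apply_real (hΨ.comp .tail) .head))
    split_ifs <;> rfl
  · beta_reduce
    split_ifs
    · exact hf r
    · exact hg r

@[fun_prop] theorem Eff.app0 {f : α → M.R} {g : α → M.N} (hf : Eff M f) (hg : Eff M g) :
    Eff M fun a => f a (g a) := by
  obtain ⟨Φ, hΦ, hf⟩ := hf
  refine eff_iff_fn.2 ?_
  simp only [← hf]
  exact .apply_real hΦ (eff_iff_fn.1 hg)

@[fun_prop] theorem Eff.app1 (F : M.F) {f : α → M.R} (hf : Eff M f) : Eff M fun a => F (f a) :=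
  .comp (eff_iff_fn.2 ⟨F, fun _ => rfl⟩) hf

@[fun_prop] theorem Eff.star (F : M.F) {f : α → M.R} (hf : Eff M f) :
    Eff M fun a => M.star F (f a) :=
  .comp (f := M.star F) ⟨_, ⟨F, fun _ => rfl⟩, fun _ => rfl⟩ hf

@[fun_prop] theorem Eff.evens {f : α → M.R} (hf : Eff M f) : Eff M fun a => evens (f a) :=
  .comp (f := L3Structure.evens) (eff_iff_fnR.2 .evens) hf

@[fun_prop] theorem Eff.odds {f : α → M.R} (hf : Eff M f) : Eff M fun a => odds (f a) :=
  .comp (f := L3Structure.odds) (eff_iff_fnR.2 .odds) hf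

@[fun_prop] theorem Eff.tail {f : α → M.R} (hf : Eff M f) : Eff M fun a => tail (f a) :=
  .comp (f := L3Structure.tail) (eff_iff_fnR.2 .tail) hf

@[fun_prop] theorem Eff.cons {f : α → M.N} {g : α → M.R} (hf : Eff M f) (hg : Eff M g) :
    Eff M fun a => M.cons (f a) (g a) :=
  .op₂ (F := M.cons) ⟨_, .cons (Fn.head.comp .evens) .odds, fun _ => rfl⟩ hf hg

@[fun_prop] theorem Eff.pair {f g : α → M.R} (hf : Eff M f) (hg : Eff M g) :
    Eff M fun a => pair (f a) (g a) :=
  .op₂ (F := L3Structure.pair) ⟨_, .id, fun r => (pair_evens_odds r).symm⟩ hf hg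

/-! ### Existence of reals and functionals -/

/-- The real with the given values, if it exists. -/
noncomputable def mkR (g : M.N → M.N) : M.R :=
  open Classical in if h : ∃ r : M.R, ∀ n, r n = g n then h.choose else default

theorem mkR_apply {g : M.N → M.N} (hg : Eff M g) (n : M.N) : mkR g n = g n := by
  have h : ∃ r : M.R, ∀ n, r n = g n := by
    obtain ⟨G, hG⟩ := eff_iff_fn.1 hg
    exact ⟨M.star G default, fun n => by rw [star_app, hG]; exact congrArg g (cons_zero _ _)⟩
  rw [mkR, dif_pos h]
  exact h.choose_spec n

theorem mkR_apply₂ {g : α → M.N → M.N} (hg : Eff M fun p : α × M.N => g p.1 p.2) (a : α)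
    (n : M.N) : mkR (g a) n = g a n :=
  mkR_apply (hg.op₂ (.const a) .id) n

@[fun_prop] theorem Eff.real {f : α → M.R} (h : Eff M fun p : α × M.N => f p.1 p.2) : Eff M f := by
  refine ⟨fun r => f (Coded.dec r), .of_fn ?_, fun _ => rfl⟩
  exact (eff_iff_fn.1 (h.op₂ (α := M.R) (F := fun a n => f a n)
    (f := fun x => Coded.dec (L3Structure.tail x)) (g := fun x => x 0)
      ⟨_, .tail, fun _ => rfl⟩ (by fun_prop)))

theorem Eff.mkR {g : α → M.N → M.N} (hg : Eff M fun p : α × M.N => g p.1 p.2) :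
    Eff M fun a => mkR (g a) :=
  .real (by simpa only [mkR_apply₂ hg] using hg)

theorem exists_functional {g : M.R → M.N} (hg : Eff M g) : ∃ F : M.F, ∀ r, F r = g r :=
  eff_iff_fn.1 hg

theorem exists_operation {Φ : M.R → M.R} (h : Eff M Φ) : ∃ G : M.F, ∀ r, M.star G r = Φ r :=
  eff_iff_fnR.1 h

open Classical in
theorem exists_characteristic {p : M.R → Prop} (hp : Eff M p) :
    ∃ F : M.F, ∀ r, F r = if p r then 1 else 0 :=
  exists_functional (.ite_nat hp (.const 1) (.const 0))

theorem nat_induction {p : M.N → Prop} (hp : Eff M p) (h0 : p 0) (hs : ∀ n, p n → p (n + 1))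
    (n : M.N) : p n :=
  Dec.nat_induction (p := fun n _ => p n) (eff_iff_dec.1 hp) default h0 hs n

@[fun_prop] theorem Eff.exists_lt {p : α → M.N → Prop} {g : α → M.N}
    (hp : Eff M fun x : α × M.N => p x.1 x.2) (hg : Eff M g) :
    Eff M fun a => ∃ z < g a, p a z :=
  eff_iff_dec.2 (.exists_lt (p := fun z r => p (Coded.dec r) z)
    (eff_iff_dec.1 (hp.op₂ (α := M.R) (F := p) (f := fun x => Coded.dec (L3Structure.tail x))
      (g := fun x => x 0) ⟨_, .tail, fun _ => rfl⟩ (by fun_prop))) (eff_iff_fn.1 hg))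

theorem Eff.forall_lt {p : α → M.N → Prop} {g : α → M.N}
    (hp : Eff M fun x : α × M.N => p x.1 x.2) (hg : Eff M g) :
    Eff M fun a => ∀ z < g a, p a z := by
  simpa using (Eff.exists_lt (p := fun a z => ¬ p a z) hp.not hg).not

theorem strong_nat_induction {p : M.N → Prop} (hp : Eff M p)
    (hs : ∀ n, (∀ m < n, p m) → p n) (n : M.N) : p n := by
  refine hs n (nat_induction (p := fun n => ∀ m < n, p m)
    (.forall_lt (p := fun _ m => p m) (hp.comp .snd) .id)
    (fun m hm => absurd hm zero_le.not_gt) (fun n ih m hm => ?_) n)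
  rcases (lt_add_one_iff.1 hm).lt_or_eq with h | rfl
  · exact ih m h
  · exact hs m ih

theorem exists_least {p : M.N → Prop} (hp : Eff M p) (h : ∃ n, p n) :
    ∃ n, p n ∧ ∀ m < n, ¬ p m := by
  by_contra! h'
  obtain ⟨n, hn⟩ := h
  refine strong_nat_induction hp.not (fun n ih hpn => ?_) n hn
  obtain ⟨m, hm, hpm⟩ := h' n hpn
  exact ih m hm hpm

theorem Eff.of_nat_graph {f : α → M.N} {p : α → M.N → Prop}
    (hp : Eff M fun x : α × M.N => p x.1 x.2) (h : ∀ a n, p a n ↔ n = f a) : Eff M f :=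
  eff_iff_fn.2 (.of_graph (p := fun x => p (Coded.dec (L3Structure.tail x)) (x 0))
    (eff_iff_dec.1 (hp.op₂ (α := M.R) (F := p) (f := fun x => Coded.dec (L3Structure.tail x))
      (g := fun x => x 0) ⟨_, .tail, fun _ => rfl⟩ (by fun_prop)))
    fun r k => by rw [cons_zero, tail_cons, h])

end L3Structure

namespace L3Structure
variable {M : L3Structure.{u}} [hM : Model M]
variable {α β γ δ : Type*} [Coded M α] [Coded M β] [Coded M γ] [Coded M δ]

/-! ## Sequences of reals -/

@[simp] theorem add_one_ne_zero' (n : M.N) : n + 1 ≠ 0 :=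
  (lt_of_le_of_lt zero_le (lt_add_one_iff.2 le_rfl)).ne'

theorem lt_succ_self' (n : M.N) : n < n + 1 := lt_add_one_iff.2 le_rfl

@[fun_prop] theorem Eff.natPair {f g : α → M.N} (hf : Eff M f) (hg : Eff M g) :
    Eff M fun a => M.natPair (f a) (g a) := by
  unfold L3Structure.natPair; fun_prop

theorem left_le_natPair (m n : M.N) : m ≤ M.natPair m n := le_add_self

theorem right_le_natPair (m n : M.N) : n ≤ M.natPair m n := by
  unfold natPair
  rcases eq_zero_or_succ n with rfl | ⟨k, rfl⟩
  · exact zero_le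
  · have : (m + (k + 1)) * (m + (k + 1)) + m = k + 1 + (m + m + (m + (k + 1)) * (m + k)) := by ring
    rw [this]
    exact le_self_add

/-- `n` codes a pair of naturals. -/
def IsCode (n : M.N) : Prop := ∃ i < n + 1, ∃ j < n + 1, M.natPair i j = n

theorem isCode_iff {n : M.N} : IsCode n ↔ ∃ i j, M.natPair i j = n := by
  constructor
  · rintro ⟨i, _, j, _, h⟩; exact ⟨i, j, h⟩
  · rintro ⟨i, j, rfl⟩
    exact ⟨i, lt_add_one_iff.2 (left_le_natPair i j), j, lt_add_one_iff.2 (right_le_natPair i j),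
      rfl⟩

theorem isCode_natPair (i j : M.N) : IsCode (M.natPair i j) := isCode_iff.2 ⟨i, j, rfl⟩

@[fun_prop] theorem Eff.isCode {f : α → M.N} (hf : Eff M f) : Eff M fun a => IsCode (f a) := by
  unfold IsCode; fun_prop

open Classical in
/-- The first component of a coded pair of naturals. -/
noncomputable def left (n : M.N) : M.N := if h : IsCode n then (isCode_iff.1 h).choose else 0

open Classical in
/-- The second component of a coded pair of naturals. -/
noncomputable def right (n : M.N) : M.N :=
  if h : IsCode n then (isCode_iff.1 h).choose_spec.choose else 0

theorem natPair_left_right {n : M.N} (h : IsCode n) : M.natPair (left n) (right n) = n := by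
  rw [left, right, dif_pos h, dif_pos h]
  exact (isCode_iff.1 h).choose_spec.choose_spec

@[simp] theorem left_natPair (i j : M.N) : left (M.natPair i j) = i :=
  (natPair_inj (natPair_left_right (isCode_natPair i j))).1

@[simp] theorem right_natPair (i j : M.N) : right (M.natPair i j) = j :=
  (natPair_inj (natPair_left_right (isCode_natPair i j))).2

@[fun_prop] theorem Eff.left {f : α → M.N} (hf : Eff M f) : Eff M fun a => left (f a) := by
  refine .comp (f := L3Structure.left) (.of_nat_graph (p := fun n i =>
    (∃ j < n + 1, M.natPair i j = n) ∨ ¬ IsCode n ∧ i = 0) (by fun_prop) fun n i => ?_) hf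
  constructor
  · rintro (⟨j, _, rfl⟩ | ⟨h, rfl⟩)
    · simp
    · rw [L3Structure.left, dif_neg h]
  · rintro rfl
    by_cases h : IsCode n
    · obtain ⟨i, j, rfl⟩ := isCode_iff.1 h
      exact .inl ⟨j, lt_add_one_iff.2 (right_le_natPair i j), by simp⟩
    · exact .inr ⟨h, by rw [L3Structure.left, dif_neg h]⟩

@[fun_prop] theorem Eff.right {f : α → M.N} (hf : Eff M f) : Eff M fun a => right (f a) := by
  refine .comp (f := L3Structure.right) (.of_nat_graph (p := fun n j =>
    (∃ i < n + 1, M.natPair i j = n) ∨ ¬ IsCode n ∧ j = 0) (by fun_prop) fun n i => ?_) hf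
  constructor
  · rintro (⟨j, _, rfl⟩ | ⟨h, rfl⟩)
    · simp
    · rw [L3Structure.right, dif_neg h]
  · rintro rfl
    by_cases h : IsCode n
    · obtain ⟨i, j, rfl⟩ := isCode_iff.1 h
      exact .inl ⟨i, lt_add_one_iff.2 (left_le_natPair i j), by simp⟩
    · exact .inr ⟨h, by rw [L3Structure.right, dif_neg h]⟩

/-- The `i`th row of a real. -/
noncomputable def row (f : M.R) (i : M.N) : M.R := mkR fun n => f (M.natPair i n)

@[simp] theorem row_apply (f : M.R) (i n : M.N) : row f i n = f (M.natPair i n) :=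
  mkR_apply (by fun_prop) n

@[fun_prop] theorem Eff.row {f : α → M.R} {g : α → M.N} (hf : Eff M f) (hg : Eff M g) :
    Eff M fun a => row (f a) (g a) :=
  .real (by simp only [row_apply]; fun_prop)

theorem isRow_iff {r f : M.R} {i : M.N} : M.IsRow r f i ↔ r = row f i :=
  ⟨fun h => real_ext fun n => by rw [h, row_apply], fun h => h ▸ fun n => row_apply f i n⟩

/-- The real with the given rows. -/
noncomputable def ofRows (g : M.N → M.R) : M.R := mkR fun n => g (left n) (right n)

theorem row_ofRows₂ {g : α → M.N → M.R} (hg : Eff M fun p : α × M.N => g p.1 p.2) (a : α)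
    (i : M.N) : row (ofRows (g a)) i = g a i := by
  refine real_ext fun n => ?_
  rw [row_apply, ofRows, mkR_apply₂ (g := fun a n => g a (left n) (right n))]
  · simp
  · exact .app0 (hg.op₂ (by fun_prop) (by fun_prop)) (by fun_prop)

theorem row_ofRows {g : M.N → M.R} (hg : Eff M g) (i : M.N) : row (ofRows g) i = g i :=
  row_ofRows₂ (α := M.N) (g := fun _ i => g i) (hg.comp .snd) 0 i

theorem Eff.ofRows {g : α → M.N → M.R} (hg : Eff M fun p : α × M.N => g p.1 p.2) :
    Eff M fun a => ofRows (g a) :=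
  .mkR (.app0 (hg.op₂ (by fun_prop) (by fun_prop)) (by fun_prop))

open Classical in
/-- The code of the finite sequence of the first `k` rows of `f`. -/
noncomputable def restr (f : M.R) (k : M.N) : M.R :=
  M.cons k (mkR fun n => if IsCode n ∧ left n < k then f n else 0)

open Classical in
theorem restr_succ (f : M.R) (k n : M.N) :
    restr f k (n + 1) = if IsCode n ∧ left n < k then f n else 0 := by
  rw [restr, cons_succ, mkR_apply (by fun_prop)]

@[simp] theorem len_restr (f : M.R) (k : M.N) : M.len (restr f k) = k := cons_zero _ _

@[fun_prop] theorem Eff.restr {f : α → M.R} {g : α → M.N} (hf : Eff M f) (hg : Eff M g) :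
    Eff M fun a => restr (f a) (g a) := by
  unfold L3Structure.restr
  refine .cons hg (.mkR ?_)
  fun_prop

@[fun_prop] theorem Eff.len {f : α → M.R} (hf : Eff M f) : Eff M fun a => M.len (f a) :=
  hf.app0 (.const 0)

theorem entry_restr {f : M.R} {k i : M.N} (h : i < k) (n : M.N) :
    M.entry (restr f k) i n = row f i n := by
  rw [entry, restr_succ, if_pos ⟨isCode_natPair i n, by simpa using h⟩, row_apply]

/-- Dropping the length from a code leaves a real whose rows are the entries. -/
theorem entry_eq_row_tail (s : M.R) (i n : M.N) : M.entry s i n = row (tail s) i n := by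
  simp [entry]

theorem row_tail_restr {f : M.R} {k i : M.N} (h : i < k) : row (tail (restr f k)) i = row f i :=
  real_ext fun n => by rw [← entry_eq_row_tail, entry_restr h]

theorem isSeq_restr (f : M.R) (k : M.N) : M.IsSeq (restr f k) := by
  intro m
  rw [restr_succ, show M.app0 (restr f k) 0 = k from len_restr f k]
  by_cases h : IsCode m ∧ left m < k
  · exact .inr ⟨left m, right m, h.2, (natPair_left_right h.1).symm⟩
  · exact .inl (if_neg h)

theorem IsSeq.ext {s t : M.R} (hs : M.IsSeq s) (ht : M.IsSeq t) (hl : M.len s = M.len t)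
    (h : ∀ i < M.len s, row (tail s) i = row (tail t) i) : s = t := by
  refine real_ext fun n => ?_
  rcases eq_zero_or_succ n with rfl | ⟨m, rfl⟩
  · exact hl
  · by_cases hm : IsCode m ∧ left m < M.len s
    · have := congrArg (fun r => M.app0 r (right m)) (h _ hm.2)
      simpa [natPair_left_right hm.1] using this
    · have key : ∀ t, M.IsSeq t → M.len s = M.len t → t (m + 1) = 0 := by
        intro t ht hl
        rcases ht m with h' | ⟨i, j, hi, rfl⟩
        · exact h'
        · refine absurd ⟨isCode_natPair i j, ?_⟩ hm
          rw [left_natPair, hl]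
          exact hi
      rw [key s hs rfl, key t ht hl]

theorem restr_eq_iff {f g : M.R} {k : M.N} : restr f k = restr g k ↔ ∀ i < k, row f i = row g i := by
  constructor
  · intro h i hi
    rw [← row_tail_restr hi, h, row_tail_restr hi]
  · intro h
    refine (isSeq_restr f k).ext (isSeq_restr g k) (by simp) fun i hi => ?_
    rw [len_restr] at hi
    rw [row_tail_restr hi, row_tail_restr hi, h i hi]

theorem IsSeq.restr_tail {s : M.R} (hs : M.IsSeq s) : restr (tail s) (M.len s) = s :=
  (isSeq_restr _ _).ext hs (by simp) fun i hi => by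
    rw [len_restr] at hi
    rw [row_tail_restr hi]

theorem restr_tail_restr {f : M.R} {k l : M.N} (h : k ≤ l) :
    restr (tail (restr f l)) k = restr f k :=
  restr_eq_iff.2 fun _ hi => row_tail_restr (hi.trans_le h)

theorem restr_congr_le {f g : M.R} {k l : M.N} (h : restr f l = restr g l) (hk : k ≤ l) :
    restr f k = restr g k :=
  restr_eq_iff.2 fun i hi => restr_eq_iff.1 h i (hi.trans_le hk)

/-- This lets statements about codes be rephrased in terms of an infinite sequence `f` and a length
`k`, the form in which trees and plays are treated from here on. -/
theorem isSeq_iff {s : M.R} : M.IsSeq s ↔ ∃ f k, s = restr f k :=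
  ⟨fun h => ⟨_, _, h.restr_tail.symm⟩, fun ⟨f, k, h⟩ => h ▸ isSeq_restr f k⟩

theorem isRestr_iff {s f : M.R} {k : M.N} : M.IsRestr s f k ↔ s = restr f k := by
  constructor
  · rintro ⟨hs, rfl, h⟩
    rw [← hs.restr_tail, len_restr, restr_eq_iff]
    exact fun i hi => real_ext fun n => by rw [← entry_eq_row_tail, h i hi, row_apply]
  · rintro rfl
    exact ⟨isSeq_restr f k, len_restr f k, fun i hi n => by rw [entry_restr hi, row_apply]⟩

theorem agreeBelow_iff {s t : M.R} {k : M.N} :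
    M.AgreeBelow s t k ↔ restr (tail s) k = restr (tail t) k := by
  rw [restr_eq_iff]
  refine forall₂_congr fun i _ => ?_
  simp only [entry_eq_row_tail]
  exact ⟨real_ext, fun h n => by rw [h]⟩

theorem isInit_iff {s f : M.R} {l : M.N} :
    M.IsInit s (restr f l) ↔ ∃ k ≤ l, s = restr f k := by
  constructor
  · rintro ⟨hs, -, hl, ha⟩
    rw [len_restr] at hl
    refine ⟨M.len s, hl, ?_⟩
    rw [← hs.restr_tail, len_restr, agreeBelow_iff.1 ha]
    exact restr_tail_restr hl
  · rintro ⟨k, hk, rfl⟩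
    refine ⟨isSeq_restr _ _, isSeq_restr _ _, by rw [len_restr, len_restr]; exact hk, ?_⟩
    rw [agreeBelow_iff, len_restr, restr_tail_restr hk, restr_tail_restr le_rfl]

theorem isSnoc_iff {s t a : M.R} :
    M.IsSnoc t s a ↔ ∃ f k, s = restr f k ∧ t = restr f (k + 1) ∧ row f k = a := by
  constructor
  · rintro ⟨hs, ht, hl, ha, he⟩
    refine ⟨tail t, M.len s, ?_, ?_, real_ext fun n => ?_⟩
    · rw [agreeBelow_iff.1 ha, hs.restr_tail]
    · rw [← hl, ht.restr_tail]
    · rw [← entry_eq_row_tail, he]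
  · rintro ⟨f, k, rfl, rfl, rfl⟩
    refine ⟨isSeq_restr _ _, isSeq_restr _ _, by simp, ?_, fun n => ?_⟩
    · rw [agreeBelow_iff, len_restr, restr_tail_restr (lt_succ_self' k).le,
        restr_tail_restr le_rfl]
    · rw [len_restr, entry_restr (lt_succ_self' k)]

open Classical in
/-- The infinite sequence that starts with the first `k` rows of `f` and is constantly `a` then. -/
noncomputable def extend (f : M.R) (k : M.N) (a : M.R) : M.R :=
  ofRows fun i => if i < k then row f i else a

open Classical in
theorem row_extend (f : M.R) (k : M.N) (a : M.R) (i : M.N) :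
    row (extend f k a) i = if i < k then row f i else a :=
  row_ofRows (g := fun i => if i < k then row f i else a) (by fun_prop) i

@[fun_prop] theorem Eff.extend {f g : α → M.R} {k : α → M.N} (hf : Eff M f) (hk : Eff M k)
    (hg : Eff M g) : Eff M fun a => extend (f a) (k a) (g a) :=
  .ofRows (by fun_prop)

@[simp] theorem restr_extend (f : M.R) (k : M.N) (a : M.R) : restr (extend f k a) k = restr f k :=
  restr_eq_iff.2 fun i hi => by rw [row_extend, if_pos hi]

@[simp] theorem row_extend_self (f : M.R) (k : M.N) (a : M.R) : row (extend f k a) k = a := by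
  rw [row_extend, if_neg (lt_irrefl _)]

/-- The sequence `s` extended by `a`. -/
noncomputable def snoc (s a : M.R) : M.R := restr (extend (tail s) (M.len s) a) (M.len s + 1)

@[fun_prop] theorem Eff.snoc {f g : α → M.R} (hf : Eff M f) (hg : Eff M g) :
    Eff M fun a => snoc (f a) (g a) := by
  unfold L3Structure.snoc; fun_prop

theorem snoc_restr (f : M.R) (k : M.N) : snoc (restr f k) (row f k) = restr f (k + 1) := by
  rw [snoc, len_restr, restr_eq_iff]
  intro i hi
  rw [row_extend]
  split_ifs with h
  · exact row_tail_restr h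
  · rw [le_antisymm (lt_add_one_iff.1 hi) (not_lt.1 h)]

theorem isSnoc_iff_eq {s t a : M.R} : M.IsSnoc t s a ↔ M.IsSeq s ∧ t = snoc s a := by
  rw [isSnoc_iff]
  constructor
  · rintro ⟨f, k, rfl, rfl, rfl⟩
    exact ⟨isSeq_restr f k, (snoc_restr f k).symm⟩
  · rintro ⟨hs, rfl⟩
    refine ⟨extend (tail s) (M.len s) a, M.len s, ?_, rfl, row_extend_self _ _ _⟩
    rw [restr_extend, hs.restr_tail]

theorem mem_restr {f : M.R} {k : M.N} {T : M.F} : M.Mem (restr f k) T ↔ T (restr f k) = 1 :=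
  ⟨fun h => h.2, fun h => ⟨isSeq_restr f k, h⟩⟩

theorem restr_zero_eq (f g : M.R) : restr f 0 = restr g 0 :=
  restr_eq_iff.2 fun _ hi => absurd hi zero_le.not_gt

theorem isTree_iff {T : M.F} : M.IsTree T ↔ M.Mem (restr default 0) T ∧
    ∀ f k l, k ≤ l → M.Mem (restr f l) T → M.Mem (restr f k) T := by
  constructor
  · rintro ⟨⟨e, he, hm⟩, h⟩
    refine ⟨?_, fun f k l hkl => h _ _ (isInit_iff.2 ⟨k, hkl, rfl⟩)⟩
    have := hm.1.restr_tail
    rw [he] at this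
    rw [restr_zero_eq _ (tail e), this]
    exact hm
  · rintro ⟨h0, h⟩
    refine ⟨⟨_, len_restr _ _, h0⟩, fun s t hst ht => ?_⟩
    obtain ⟨f, l, rfl⟩ := isSeq_iff.1 ht.1
    obtain ⟨k, hk, rfl⟩ := isInit_iff.1 hst
    exact h f k l hk ht

theorem isWFTree_iff {T : M.F} : M.IsWFTree T ↔ ∀ f, ∃ k, ¬ M.Mem (restr f k) T := by
  simp only [IsWFTree, isRestr_iff]
  refine forall_congr' fun f => exists_congr fun k => ?_
  exact ⟨fun ⟨_, h, h'⟩ => h ▸ h', fun h => ⟨_, rfl, h⟩⟩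

/-- The play of length `k` is the sequence of the first `k` rows of `f`. -/
theorem isPlay_restr_iff {S P : M.F} {f : M.R} {l k : M.N} :
    M.IsPlay S P k (restr f l) ↔ l = k ∧
      (∀ j, j + j < k → row f (j + j) = M.star S (restr f (j + j))) ∧
      (∀ j, j + j + 1 < k → row f (j + j + 1) = M.star P (restr f (j + j + 1))) := by
  have key : ∀ (Q : M.F) (i : M.N), i < k → l = k →
      ((∃ t, M.IsInit t (restr f l) ∧ M.len t = i ∧
        ∀ n, M.entry (restr f l) i n = M.star Q t n) ↔ row f i = M.star Q (restr f i)) := by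
    rintro Q i hi rfl
    simp only [entry_restr hi, isInit_iff]
    constructor
    · rintro ⟨_, ⟨k, hk, rfl⟩, hl, h⟩
      rw [len_restr] at hl
      subst hl
      exact real_ext h
    · intro h
      exact ⟨_, ⟨i, hi.le, rfl⟩, len_restr _ _, fun n => by rw [h]⟩
  simp only [IsPlay, isSeq_restr, len_restr, true_and]
  refine and_congr_right fun hl => and_congr ?_ ?_
  · exact forall₂_congr fun j hj => key S _ hj hl
  · exact forall₂_congr fun j hj => key P _ hj hl

theorem playIn_iff {S P T : M.F} {k : M.N} : M.PlayIn S P k T ↔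
    ∃ f, M.Mem (restr f k) T ∧ (∀ j, j + j < k → row f (j + j) = M.star S (restr f (j + j))) ∧
      (∀ j, j + j + 1 < k → row f (j + j + 1) = M.star P (restr f (j + j + 1))) := by
  constructor
  · rintro ⟨s, hp, hm⟩
    obtain ⟨f, l, rfl⟩ := isSeq_iff.1 hm.1
    obtain ⟨rfl, h⟩ := isPlay_restr_iff.1 hp
    exact ⟨f, hm, h⟩
  · rintro ⟨f, hm, h⟩
    exact ⟨_, isPlay_restr_iff.2 ⟨rfl, h⟩, hm⟩

theorem playOut_iff {S P T : M.F} {k : M.N} : M.PlayOut S P k T ↔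
    ∃ f, ¬ M.Mem (restr f k) T ∧ (∀ j, j + j < k → row f (j + j) = M.star S (restr f (j + j))) ∧
      (∀ j, j + j + 1 < k → row f (j + j + 1) = M.star P (restr f (j + j + 1))) := by
  constructor
  · rintro ⟨s, hp, hm⟩
    obtain ⟨f, l, rfl⟩ := isSeq_iff.1 hp.1
    obtain ⟨rfl, h⟩ := isPlay_restr_iff.1 hp
    exact ⟨f, hm, h⟩
  · rintro ⟨f, hm, h⟩
    exact ⟨_, isPlay_restr_iff.2 ⟨rfl, h⟩, hm⟩

end L3Structure

namespace L3Structure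
variable {M : L3Structure.{u}} [hM : Model M]
variable {α β γ δ : Type*} [Coded M α] [Coded M β] [Coded M γ] [Coded M δ]

/-! ## Quantification over reals -/

variable (M) in
/-- Predicates of `M` are closed under quantification over reals. -/
class RealQuant : Prop where
  exists_projection : ∀ f : M.F, ∃ g : M.F, ∀ r, g r = 1 ↔ ∃ s, f (pair r s) = 1

section RealQuant
variable [RealQuant M]

@[fun_prop] theorem Eff.exists {p : α → β → Prop} (hp : Eff M fun x : α × β => p x.1 x.2) :
    Eff M fun a => ∃ b, p a b := by
  obtain ⟨f, ⟨F, hF⟩, hfp⟩ := eff_iff_dec.1 hp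
  obtain ⟨g, hg⟩ := RealQuant.exists_projection F
  refine eff_iff_dec.2 ⟨_, ⟨g, fun _ => rfl⟩, fun r => ?_⟩
  rw [hg]
  simp only [hF, hfp]
  constructor
  · rintro ⟨s, hs⟩
    exact ⟨Coded.dec s, by simpa [Coded.dec] using hs⟩
  · rintro ⟨b, hb⟩
    obtain ⟨s, rfl⟩ := Coded.surj (M := M) b
    exact ⟨s, by simpa [Coded.dec] using hb⟩

@[fun_prop] theorem Eff.forall {p : α → β → Prop} (hp : Eff M fun x : α × β => p x.1 x.2) :
    Eff M fun a => ∀ b, p a b := by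
  simpa using (Eff.exists (p := fun a b => ¬ p a b) hp.not).not

@[fun_prop] theorem Eff.real_eq {f g : α → M.R} (hf : Eff M f) (hg : Eff M g) :
    Eff M fun a => f a = g a := by
  have : Eff M fun a => ∀ n, f a n = g a n := by fun_prop
  refine (congrArg (Eff M) (funext fun a => ?_)).mp this
  exact propext (hM.out.ext1 _ _)

theorem Eff.of_real_graph {f : α → M.R} {p : α → M.R → Prop}
    (hp : Eff M fun x : α × M.R => p x.1 x.2) (h : ∀ a r, p a r ↔ r = f a) : Eff M f := by
  refine .real (.of_nat_graph (p := fun x m => ∃ r, p x.1 r ∧ r x.2 = m) ?_ fun x m => ?_)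
  · fun_prop
  · simp only [h, exists_eq_left]
    exact eq_comm

@[fun_prop] theorem Eff.isSeq {f : α → M.R} (hf : Eff M f) : Eff M fun a => M.IsSeq (f a) := by
  unfold L3Structure.IsSeq; fun_prop

@[fun_prop] theorem Eff.mem (T : M.F) {f : α → M.R} (hf : Eff M f) :
    Eff M fun a => M.Mem (f a) T := by
  unfold L3Structure.Mem; fun_prop

/-! ### Recursion along the naturals -/

theorem rows_unique {Φ : M.R → M.R} {d e : M.R} {n : M.N}
    (hd : ∀ i < n, row d i = Φ (restr d i)) (he : ∀ i < n, row e i = Φ (restr e i)) :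
    ∀ i < n, row d i = row e i := by
  refine strong_nat_induction (by fun_prop) fun i ih hi => ?_
  rw [hd i hi, he i hi, restr_eq_iff.2 fun j hj => ih j hj (hj.trans hi)]

/-- Course-of-values recursion. -/
theorem exists_rows {Φ : M.R → M.R} (hΦ : Eff M Φ) : ∃ d, ∀ n, row d n = Φ (restr d n) := by
  have hex : ∀ n : M.N, ∃ d, ∀ i < n, row d i = Φ (restr d i) := by
    refine nat_induction (by fun_prop) ⟨default, fun i hi => absurd hi zero_le.not_gt⟩ ?_
    rintro n ⟨d, hd⟩
    refine ⟨extend d n (Φ (restr d n)), fun i hi => ?_⟩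
    have h1 : ∀ i ≤ n, restr (extend d n (Φ (restr d n))) i = restr d i := fun i hi =>
      restr_congr_le (restr_extend _ _ _) hi
    rw [h1 i (lt_add_one_iff.1 hi), row_extend]
    split_ifs with h
    · exact hd i h
    · rw [le_antisymm (lt_add_one_iff.1 hi) (not_lt.1 h)]
  choose c hc using fun n : M.N => hex (n + 1)
  -- The choice of `c` is made outside the model and need not be effective, but the row `row (c n)
  -- n` does not depend on it, so its graph is definable with a quantifier over reals.
  have hrow : Eff M fun n => row (c n) n := by
    refine .of_real_graph (p := fun n r => ∃ d, (∀ i < n + 1, row d i = Φ (restr d i)) ∧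
      row d n = r) (by fun_prop) fun n r => ?_
    constructor
    · rintro ⟨d, hd, rfl⟩
      exact rows_unique hd (hc n) n (lt_succ_self' n)
    · rintro rfl
      exact ⟨_, hc n, rfl⟩
  refine ⟨ofRows fun n => row (c n) n, fun n => ?_⟩
  rw [row_ofRows hrow, hc n n (lt_succ_self' n)]
  refine congrArg Φ (restr_eq_iff.2 fun i hi => ?_)
  rw [row_ofRows hrow]
  exact (rows_unique (fun j hj => hc i j hj)
    (fun j hj => hc n j (hj.trans (add_lt_add_left hi 1))) i (lt_succ_self' i)).symm

theorem exists_iterates {Φ : M.R → M.R} (hΦ : Eff M Φ) (a : M.R) :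
    ∃ d, row d 0 = a ∧ ∀ n, row d (n + 1) = Φ (row d n) := by
  classical
  obtain ⟨d, hd⟩ := exists_rows (Φ := fun s => if M.len s = 0 then a else
    Φ (row (tail s) (pred (M.len s)))) (by fun_prop)
  refine ⟨d, by simp [hd], fun n => ?_⟩
  rw [hd, len_restr, if_neg (add_one_ne_zero' n), pred_succ, row_tail_restr (lt_succ_self' n)]

/-! ### Selection -/

omit [RealQuant M] in
theorem SF.select (hSF : M.SF) {p : M.R → M.R → Prop} (hp : Eff M fun x : M.R × M.R => p x.1 x.2)
    (h : ∀ r, ∃ s, p r s) : ∃ g : M.F, ∀ r, p r (M.star g r) := by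
  classical
  obtain ⟨F, hF⟩ := exists_characteristic (p := fun x => p (evens x) (odds x))
    (hp.op₂ (by fun_prop) (by fun_prop))
  have key : ∀ r s, M.PairVal F r s 1 ↔ p r s := fun r s => by simp [pairVal_iff, hF]
  obtain ⟨g, hg⟩ := hSF F fun r => (h r).imp fun s hs => (key r s).2 hs
  exact ⟨g, fun r => (key _ _).1 (hg r)⟩

omit [RealQuant M] in
theorem SF.select_nat (hSF : M.SF) {p : M.N → M.R → Prop}
    (hp : Eff M fun x : M.N × M.R => p x.1 x.2) (h : ∀ n, ∃ s, p n s) :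
    ∃ q, ∀ n, p n (row q n) := by
  obtain ⟨g, hg⟩ := hSF.select (p := fun r s => p (r 0) s) (hp.op₂ (by fun_prop) (by fun_prop))
    fun r => h _
  refine ⟨ofRows fun n => M.star g (M.cons n default), fun n => ?_⟩
  rw [row_ofRows (by fun_prop)]
  simpa only [cons_zero] using hg (M.cons n default)

/-- Dependent choice. -/
theorem SF.exists_chain (hSF : M.SF) {D : M.R → Prop} {p : M.R → M.R → Prop} (hD : Eff M D)
    (hp : Eff M fun x : M.R × M.R => p x.1 x.2) (h : ∀ r, D r → ∃ s, D s ∧ p r s) {a : M.R}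
    (ha : D a) : ∃ f, ∀ n, D (row f n) ∧ p (row f n) (row f (n + 1)) := by
  -- Selection applies to total relations only, so nothing is asked of reals outside `D`.
  obtain ⟨g, hg⟩ := hSF.select (p := fun r s => D r → D s ∧ p r s) (by fun_prop) fun r => by
    by_cases hr : D r
    · exact (h r hr).imp fun s hs _ => hs
    · exact ⟨r, fun h => absurd h hr⟩
  obtain ⟨f, h0, hs⟩ := exists_iterates (Φ := M.star g) (by fun_prop) a
  have hf : ∀ n, D (row f n) := by
    refine nat_induction (by fun_prop) (h0 ▸ ha) fun n hn => ?_
    rw [hs]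
    exact (hg _ hn).1
  exact ⟨f, fun n => ⟨hf n, hs n ▸ (hg _ (hf n)).2⟩⟩

/-! ### Plays -/

omit [RealQuant M] in
theorem exists_eq_double_or (n : M.N) : ∃ j, n = j + j ∨ n = j + j + 1 :=
  ⟨half n, (half_spec n).imp Eq.symm Eq.symm⟩

theorem exists_play (S P : M.F) : ∃ f, (∀ j, row f (j + j) = M.star S (restr f (j + j))) ∧
    ∀ j, row f (j + j + 1) = M.star P (restr f (j + j + 1)) := by
  classical
  obtain ⟨f, hf⟩ := exists_rows (Φ := fun s => if half (M.len s) + half (M.len s) = M.len s then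
    M.star S s else M.star P s) (by fun_prop)
  refine ⟨f, fun j => ?_, fun j => ?_⟩
  · rw [hf, len_restr, half_double, if_pos rfl]
  · rw [hf, len_restr, half_double_add_one, if_neg (lt_succ_self' _).ne]

theorem play_unique {S P : M.F} {f g : M.R} {k : M.N}
    (hf : ∀ j, j + j < k → row f (j + j) = M.star S (restr f (j + j)))
    (hf' : ∀ j, j + j + 1 < k → row f (j + j + 1) = M.star P (restr f (j + j + 1)))
    (hg : ∀ j, j + j < k → row g (j + j) = M.star S (restr g (j + j)))
    (hg' : ∀ j, j + j + 1 < k → row g (j + j + 1) = M.star P (restr g (j + j + 1))) :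
    restr f k = restr g k := by
  refine restr_eq_iff.2 (strong_nat_induction (by fun_prop) fun i ih hi => ?_)
  have : restr f i = restr g i := restr_eq_iff.2 fun j hj => ih j hj (hj.trans hi)
  obtain ⟨j, rfl | rfl⟩ := exists_eq_double_or i
  · rw [hf j hi, hg j hi, this]
  · rw [hf' j hi, hg' j hi, this]

omit [RealQuant M] in
/-- A functional whose strategy plays the rows of `f`. -/
theorem exists_following (f : M.R) : ∃ P : M.F, ∀ k, M.star P (restr f k) = row f k := by
  obtain ⟨P, hP⟩ := exists_operation (M := M) (Φ := fun s => row f (M.len s)) (by fun_prop)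
  exact ⟨P, fun k => by rw [hP, len_restr]⟩

/-- Opposing functionals may be replaced by sequences consistent with `S`: an opponent can simply
play the rows of `f`, and conversely recursion produces the play of any two strategies. The second
half is where `RealQuant` enters. -/
theorem winI_iff {T : M.F} : M.WinI T ↔ ∃ S : M.F, ∀ f,
    (∀ j, row f (j + j) = M.star S (restr f (j + j))) →
      ∃ k, M.Mem (restr f (k + k + 1)) T ∧ ¬ M.Mem (restr f (k + k + 1 + 1)) T := by
  constructor
  · rintro ⟨S, hS⟩
    refine ⟨S, fun f hf => ?_⟩
    obtain ⟨P, hP⟩ := exists_following f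
    obtain ⟨k, h1, h2⟩ := hS P
    obtain ⟨g, hg, h3, h4⟩ := playIn_iff.1 h1
    obtain ⟨g', hg', h3', h4'⟩ := playOut_iff.1 h2
    refine ⟨k, ?_, ?_⟩
    · rwa [play_unique (fun j _ => hf j) (fun j _ => (hP _).symm) h3 h4]
    · rwa [play_unique (fun j _ => hf j) (fun j _ => (hP _).symm) h3' h4']
  · rintro ⟨S, hS⟩
    refine ⟨S, fun P => ?_⟩
    obtain ⟨f, hf, hf'⟩ := exists_play S P
    obtain ⟨k, h1, h2⟩ := hS f hf
    exact ⟨k, playIn_iff.2 ⟨f, h1, fun j _ => hf j, fun j _ => hf' j⟩,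
      playOut_iff.2 ⟨f, h2, fun j _ => hf j, fun j _ => hf' j⟩⟩

theorem winII_iff {T : M.F} : M.WinII T ↔ ∃ P : M.F, ∀ f,
    (∀ j, row f (j + j + 1) = M.star P (restr f (j + j + 1))) →
      ∃ k, M.Mem (restr f (k + k)) T ∧ ¬ M.Mem (restr f (k + k + 1)) T := by
  constructor
  · rintro ⟨P, hP⟩
    refine ⟨P, fun f hf => ?_⟩
    obtain ⟨S, hS⟩ := exists_following f
    obtain ⟨k, h1, h2⟩ := hP S
    obtain ⟨g, hg, h3, h4⟩ := playIn_iff.1 h1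
    obtain ⟨g', hg', h3', h4'⟩ := playOut_iff.1 h2
    refine ⟨k, ?_, ?_⟩
    · rwa [play_unique (fun j _ => (hS _).symm) (fun j _ => hf j) h3 h4]
    · rwa [play_unique (fun j _ => (hS _).symm) (fun j _ => hf j) h3' h4']
  · rintro ⟨P, hP⟩
    refine ⟨P, fun S => ?_⟩
    obtain ⟨f, hf, hf'⟩ := exists_play S P
    obtain ⟨k, h1, h2⟩ := hP f hf'
    exact ⟨k, playIn_iff.2 ⟨f, h1, fun j _ => hf j, fun j _ => hf' j⟩,
      playOut_iff.2 ⟨f, h2, fun j _ => hf j, fun j _ => hf' j⟩⟩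

end RealQuant

end L3Structure

namespace L3Structure
variable {M : L3Structure.{u}} [hM : Model M]

/-! ## Trees given by effective predicates -/

/-- By `hc` the predicate depends on the first `k` rows only, so it can be tested on the tail of the
code. -/
theorem exists_set_of_seqs {p : M.R → M.N → Prop} (hp : Eff M fun x : M.R × M.N => p x.1 x.2)
    (hc : ∀ e e' k, (∀ i < k, row e i = row e' i) → p e k → p e' k) :
    ∃ T : M.F, ∀ e k, M.Mem (restr e k) T ↔ p e k := by
  classical
  obtain ⟨T, hT⟩ := exists_characteristic (p := fun s => p (tail s) (M.len s))
    (hp.op₂ (by fun_prop) (by fun_prop))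
  refine ⟨T, fun e k => ?_⟩
  rw [mem_restr, hT, len_restr]
  have : p (tail (restr e k)) k ↔ p e k :=
    ⟨hc _ _ _ fun i hi => row_tail_restr hi, hc _ _ _ fun i hi => (row_tail_restr hi).symm⟩
  simp [this]

theorem isTree_of {T : M.F} {p : M.R → M.N → Prop} (hT : ∀ e k, M.Mem (restr e k) T ↔ p e k)
    (h0 : ∀ e, p e 0) (hs : ∀ e k l, k ≤ l → p e l → p e k) : M.IsTree T :=
  isTree_iff.2 ⟨(hT _ _).2 (h0 _), fun f k l hkl h => (hT _ _).2 (hs f k l hkl ((hT _ _).1 h))⟩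

/-- The sequence of length one with entry `r`. -/
noncomputable def single (r : M.R) : M.R := restr (extend default 0 r) 1

theorem restr_one_eq_single {e r : M.R} (h : row e 0 = r) : restr e 1 = single r := by
  refine restr_eq_iff.2 fun i hi => ?_
  rw [← zero_add (1 : M.N), lt_add_one_iff] at hi
  obtain rfl := le_antisymm hi zero_le
  rw [row_extend_self, h]

@[fun_prop] theorem Eff.single {α : Type*} [Coded M α] {f : α → M.R} (hf : Eff M f) :
    Eff M fun a => single (f a) := by
  unfold L3Structure.single; fun_prop

/-- The tree of the sequences `⟨⟩`, `⟨r⟩`, and `⟨r, s⟩` with `f(⟨r, s⟩) = 1`. -/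
theorem exists_selection_tree (f : M.F) : ∃ T : M.F, M.IsTree T ∧ M.IsWFTree T ∧
    (∀ e, M.Mem (restr e 0) T) ∧ (∀ e, M.Mem (restr e 1) T) ∧
    (∀ e, M.Mem (restr e (1 + 1)) T ↔ f (pair (row e 0) (row e 1)) = 1) ∧
    ∀ e k, ¬ M.Mem (restr e (k + 1 + 1 + 1)) T := by
  have h01 : (0 : M.N) ≠ 1 := zero_ne_one
  have h1 : ∀ k : M.N, ¬ k + 1 + 1 + 1 ≤ 1 + 1 := fun k h => by
    have := lt_iff_add_one_le.2 h
    simp [add_assoc] at this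
  obtain ⟨T, hT⟩ := exists_set_of_seqs (M := M)
    (p := fun e k => k ≤ 1 + 1 ∧ (k = 1 + 1 → f (pair (row e 0) (row e 1)) = 1)) (by fun_prop) (by
      rintro e e' k he ⟨h1, h2⟩
      refine ⟨h1, ?_⟩
      rintro rfl
      rw [← he 0 (lt_of_le_of_lt zero_le (lt_succ_self' _)), ← he 1 (lt_succ_self' _)]
      exact h2 rfl)
  refine ⟨T, isTree_of hT ?_ ?_, isWFTree_iff.2 fun e => ⟨0 + 1 + 1 + 1, fun h => ?_⟩,
    fun e => (hT _ _).2 ⟨zero_le, fun h => absurd h.symm (add_one_ne_zero' 1)⟩,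
    fun e => (hT _ _).2 ⟨(lt_succ_self' _).le, fun h => absurd h (lt_succ_self' _).ne⟩,
    fun e => (hT _ _).trans ⟨fun h => h.2 rfl, fun h => ⟨le_rfl, fun _ => h⟩⟩,
    fun e k h => h1 k ((hT _ _).1 h).1⟩
  · exact fun e => ⟨zero_le, fun h => absurd h.symm (add_one_ne_zero' 1)⟩
  · rintro e k l hkl ⟨h1, h2⟩
    refine ⟨hkl.trans h1, ?_⟩
    rintro rfl
    exact h2 (le_antisymm h1 hkl)
  · exact h1 0 ((hT _ _).1 h).1

/-! ## Bar recursion gives quantification over reals -/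

variable (M) in
/-- `h` is defined by bar recursion on `T`. -/
def IsBarRec (T h : M.F) : Prop :=
  (∀ x, h x = 0 ∨ h x = 1) ∧ ∀ f k, M.Mem (restr f k) T → (h (restr f k) = 0 ↔
    ∀ g, restr g k = restr f k → M.Mem (restr g (k + 1)) T → h (restr g (k + 1)) = 1)

theorem isBarRec_iff {T h : M.F} : M.IsBarRec T h ↔ (∀ x, h x = 0 ∨ h x = 1) ∧
    ∀ s, M.Mem s T → (h s = 0 ↔ ∀ a t, M.IsSnoc t s a → M.Mem t T → h t = 1) := by
  have key : ∀ f k, (∀ g, restr g k = restr f k → M.Mem (restr g (k + 1)) T →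
      h (restr g (k + 1)) = 1) ↔
      ∀ a t, M.IsSnoc t (restr f k) a → M.Mem t T → h t = 1 := by
    intro f k
    constructor
    · intro h a t hs
      obtain ⟨g, l, h1, rfl, rfl⟩ := isSnoc_iff.1 hs
      obtain rfl : k = l := by simpa using congrArg M.len h1
      exact h g h1.symm
    · intro h g hg
      exact h _ _ (isSnoc_iff.2 ⟨g, k, hg.symm, rfl, rfl⟩)
  simp only [IsBarRec, key]
  refine and_congr_right fun _ => ⟨fun h s hs => ?_, fun h f k hm => h _ hm⟩
  obtain ⟨f, k, rfl⟩ := isSeq_iff.1 hs.1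
  exact h f k hs

theorem BR1.exists_isBarRec (hBR : M.BR1) {T : M.F} (hT : M.IsTree T) (hW : M.IsWFTree T) :
    ∃ h, M.IsBarRec T h := by
  simpa only [isBarRec_iff] using hBR T hT hW

/-- In the selection tree the nodes `⟨r, s⟩` are leaves and get label 0. Hence `⟨r⟩` gets label 1
exactly if it has a child, that is, if some `s` satisfies `f(⟨r, s⟩) = 1`. -/
theorem BR1.realQuant (hBR : M.BR1) : M.RealQuant := ⟨fun f => by
  obtain ⟨T, hT, hW, -, h1, h2, h3⟩ := exists_selection_tree f
  obtain ⟨h, hh, hr⟩ := hBR.exists_isBarRec hT hW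
  obtain ⟨g, hg⟩ := exists_functional (M := M) (g := fun r => h (single r)) (by fun_prop)
  refine ⟨g, fun r => ?_⟩
  obtain ⟨e, he⟩ : ∃ e, row e 0 = r := ⟨_, row_extend_self default 0 r⟩
  rw [hg, ← restr_one_eq_single he]
  have hchild : ∀ g, M.Mem (restr g (1 + 1)) T → h (restr g (1 + 1)) = 0 := fun g hg =>
    (hr _ _ hg).2 fun g' _ hg' => absurd hg' (by simpa using h3 g' 0)
  constructor
  · intro h1'
    by_contra! hne
    have : h (restr e 1) = 0 := (hr _ _ (h1 e)).2 fun g hge hg => by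
      have := (h2 g).1 hg
      rw [restr_eq_iff.1 hge 0 pMinus.zero_lt_one, he] at this
      exact absurd this (hne _)
    rw [h1'] at this
    exact absurd this one_ne_zero
  · rintro ⟨s, hs⟩
    refine (hh _).resolve_left fun h0 => ?_
    have hg : M.Mem (restr (extend e 1 s) (1 + 1)) T := (h2 _).2 (by
      rw [row_extend_self, row_extend, if_pos pMinus.zero_lt_one, he, hs])
    have := (hr _ _ (h1 e)).1 h0 _ (restr_extend e 1 s) hg
    rw [hchild _ hg] at this
    exact absurd this zero_ne_one⟩

/-! ## Transfinite recursion and a well-ordering of the reals give quantification over reals -/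

/-- The only instance of the scheme that is needed to derive determinacy. Equality of the reals `B *
z` and `b` is written out as equality of all values, which keeps the matrix arithmetical. -/
theorem TR1.exists_recursive (hTR : M.TR1) {W : M.F} (hW : M.IsWOCode W) (A B C : M.F) :
    ∃ X : M.F, ∀ a, M.Dom W a → ∃ Y : M.F, M.IsBelow Y X W a ∧ ∀ b,
      ((∃ z, M.star B z = b ∧ A z = 1 ∧ Y (M.star C z) = 0) → X (pair a b) = 1) ∧
      ((¬ ∃ z, M.star B z = b ∧ A z = 1 ∧ Y (M.star C z) = 0) → X (pair a b) = 0) := by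
  let θ : L3Formula :=
    .and (.all .s0 0 (.eq .s0 (.app0 (.star (.var .s2 1) (.var .s1 1)) (.var .s0 0))
      (.app0 (.var .s1 0) (.var .s0 0))))
    (.and (.eq .s0 (.app1 (.var .s2 2) (.var .s1 1)) .one)
      (.eq .s0 (.app1 (.var .s2 0) (.star (.var .s2 3) (.var .s1 1))) .zero))
  have hθ : θ.IsArith := .and (.all _ (.eq _ _)) (.and (.eq _ _) (.eq _ _))
  let v : M.Val := ((M.val₀.set .s2 1 B).set .s2 2 A).set .s2 3 C
  obtain ⟨X, hX⟩ := hTR W hW (.ex .s1 1 θ) ⟨1, θ, hθ, rfl⟩ v 0 0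
  refine ⟨X, fun a ha => ?_⟩
  obtain ⟨Y, hY, hb⟩ := hX a ha
  refine ⟨Y, hY, fun b => ?_⟩
  have key : M.Sat ((v.set .s1 0 b).set .s2 0 Y) (.ex .s1 1 θ) ↔
      ∃ z, M.star B z = b ∧ A z = 1 ∧ Y (M.star C z) = 0 := by
    change (∃ z : M.R, (∀ n : M.N, M.star B z n = b n) ∧ A z = 1 ∧ Y (M.star C z) = 0) ↔ _
    simp only [hM.out.ext1]
  rw [← key, ← pairVal_iff, ← pairVal_iff]
  exact hb b

/-- Recursion along a one-point order is plain `Σ¹₁` comprehension. The well-ordering of the reals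
makes that order available: being equal to `default` is decidable as incomparability with `default`.
-/
theorem realQuant_of_wo_of_tr1 (hWO : M.WO) (hTR : M.TR1) : M.RealQuant := ⟨fun f => by
  classical
  obtain ⟨L, hirr, -, htot, -⟩ := hWO
  simp only [pairVal_iff, forall_true_left] at hirr htot
  have heq : ∀ r : M.R, ¬ L (pair r default) = 1 ∧ ¬ L (pair default r) = 1 ↔ r = default := by
    intro r
    constructor
    · rintro ⟨h1, h2⟩
      rcases htot r default with h | h | h
      · exact absurd h h1
      · exact h
      · exact absurd h h2
    · rintro rfl
      exact ⟨hirr _, hirr _⟩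
  have heff : Eff M fun r : M.R => r = default := by
    refine (congrArg (Eff M) (funext fun r => propext (heq r))).mp ?_
    fun_prop
  obtain ⟨W, hW⟩ := exists_functional (M := M)
    (g := fun r => if evens r = default ∧ odds r = default then 1 else 1 + 1)
    (.ite_nat (.and (heff.comp (by fun_prop)) (heff.comp (by fun_prop))) (by fun_prop)
      (by fun_prop))
  have h2 : ∀ a b, M.PairVal W a b (1 + 1) ↔ ¬ (a = default ∧ b = default) := by
    intro a b
    rw [pairVal_iff, hW, evens_pair, odds_pair]
    split_ifs with h
    · simp [h]
    · simp [h]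
  have hdom : ∀ a, M.Dom W a ↔ a = default := fun a => by simp [Dom, h2]
  have hless : ∀ a b, ¬ M.Less W a b := by
    intro a b h
    rw [Less, pairVal_iff, hW] at h
    split_ifs at h
    · exact one_ne_zero h
    · exact add_one_ne_zero' 1 h
  have hcode : M.IsWOCode W := by
    refine ⟨fun x => .inr ?_, fun a b => by rw [h2, hdom, hdom], fun a _ => hless a a,
      fun a b c _ _ _ h => absurd h (hless a b), fun a b ha hb => ?_, ?_⟩
    · rw [hW]
      split_ifs
      · exact .inl rfl
      · exact .inr rfl
    · exact .inr (.inl (((hdom a).1 ha).trans ((hdom b).1 hb).symm))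
    · rintro ⟨g, hg⟩
      obtain ⟨a, b, -, -, -, -, h⟩ := hg 0
      exact hless _ _ h
  obtain ⟨B, hB⟩ := exists_operation (M := M) (Φ := evens) (by fun_prop)
  obtain ⟨X, hX⟩ := hTR.exists_recursive hcode f B B
  obtain ⟨Y, hY, hXY⟩ := hX default ((hdom _).2 rfl)
  -- Nothing precedes the only point, so the conjunct about `Y` is always true.
  have hY0 : ∀ p, Y p = 0 := fun p =>
    (hY _ p _ (isPair_iff.2 ⟨rfl, rfl⟩)).2 (hless _ _)
  obtain ⟨g, hg⟩ := exists_functional (M := M) (g := fun r => X (pair default r)) (by fun_prop)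
  refine ⟨g, fun r => ?_⟩
  rw [hg]
  simp only [hY0, hB, and_true] at hXY
  have hiff : (∃ z, evens z = r ∧ f z = 1) ↔ ∃ s, f (pair r s) = 1 := by
    constructor
    · rintro ⟨z, rfl, hz⟩
      exact ⟨odds z, by simpa using hz⟩
    · rintro ⟨s, hs⟩
      exact ⟨_, evens_pair _ _, hs⟩
  rw [← hiff]
  constructor
  · intro h
    by_contra h'
    rw [(hXY r).2 h'] at h
    exact zero_ne_one h
  · exact (hXY r).1⟩

/-! ## Determinacy from bar recursion and selection -/

section
variable [RealQuant M]

/-- Label 1 means that some child has label 0; selection picks the last entry of such a child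
uniformly in the position. -/
theorem IsBarRec.exists_strategy {T h : M.F} (hh : M.IsBarRec T h) (hSF : M.SF) :
    ∃ g : M.F, ∀ f k, M.Mem (restr f k) T → h (restr f k) = 1 →
      row f k = M.star g (restr f k) →
        M.Mem (restr f (k + 1)) T ∧ h (restr f (k + 1)) = 0 := by
  obtain ⟨g, hg⟩ := hSF.select (p := fun r s => M.Mem r T → h r = 1 →
    M.Mem (snoc r s) T ∧ h (snoc r s) = 0) (by fun_prop) fun r => by
      by_cases hr : M.Mem r T ∧ h r = 1
      · obtain ⟨hm, h1⟩ := hr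
        obtain ⟨f, k, rfl⟩ := isSeq_iff.1 hm.1
        have := (hh.2 f k hm).not.1 (by rw [h1]; exact one_ne_zero)
        push Not at this
        obtain ⟨e, he, hm', hne⟩ := this
        refine ⟨row e k, fun _ _ => ?_⟩
        rw [← he, snoc_restr]
        exact ⟨hm', (hh.1 _).resolve_right hne⟩
      · exact ⟨default, fun h1 h2 => absurd ⟨h1, h2⟩ hr⟩
  refine ⟨g, fun f k hm h1 hrow => ?_⟩
  rw [← snoc_restr, hrow]
  exact hg _ hm h1

/-- The offset `o` is the number of moves made before the owner of the strategy first moves: 0 for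
player I, 1 for player II. If the opponent never left `T`, the labels 1 would recur at every turn of
the owner, and `f` would be an infinite path. -/
theorem IsBarRec.exists_exit {T h : M.F} (hh : M.IsBarRec T h) (hT : M.IsTree T)
    (hW : M.IsWFTree T) {f : M.R} {o : M.N} (hm : M.Mem (restr f o) T) (h1 : h (restr f o) = 1)
    (hf : ∀ j, M.Mem (restr f (o + (j + j))) T → h (restr f (o + (j + j))) = 1 →
      M.Mem (restr f (o + (j + j) + 1)) T ∧ h (restr f (o + (j + j) + 1)) = 0) :
    ∃ j, M.Mem (restr f (o + (j + j) + 1)) T ∧ ¬ M.Mem (restr f (o + (j + j) + 1 + 1)) T := by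
  by_contra! hcon
  have key : ∀ j, M.Mem (restr f (o + (j + j))) T ∧ h (restr f (o + (j + j))) = 1 := by
    refine nat_induction (by fun_prop) (by simpa using ⟨hm, h1⟩) fun j ⟨hm, h1⟩ => ?_
    obtain ⟨hm', h0⟩ := hf j hm h1
    have hm2 := hcon j hm'
    rw [show o + (j + 1 + (j + 1)) = o + (j + j) + 1 + 1 by ring]
    exact ⟨hm2, (hh.2 f _ hm').1 h0 f rfl hm2⟩
  obtain ⟨k, hk⟩ := isWFTree_iff.1 hW f
  refine hk ((isTree_iff.1 hT).2 f k _ ?_ (key k).1)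
  exact le_add_self.trans le_add_self

theorem clopenDet_of_br1 (hBR : M.BR1) (hSF : M.SF) : M.ClopenDet := by
  intro T hT hW
  obtain ⟨h, hh⟩ := hBR.exists_isBarRec hT hW
  obtain ⟨g, hg⟩ := hh.exists_strategy hSF
  have hroot : ∀ f, M.Mem (restr f 0) T := fun f =>
    restr_zero_eq default f ▸ (isTree_iff.1 hT).1
  rcases hh.1 (restr default 0) with h0 | h1
  · refine .inr (winII_iff.2 ⟨g, fun f hf => ?_⟩)
    -- Label 0 at the root: either the first move of I leaves `T` at once, or it leads to label 1
    -- and II uses `g` from there.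
    rw [restr_zero_eq _ f] at h0
    by_cases hm : M.Mem (restr f 1) T
    · have h1 := (hh.2 f 0 (hroot f)).1 h0 f rfl
      rw [zero_add] at h1
      obtain ⟨j, hj⟩ := hh.exists_exit hT hW hm (h1 hm) fun j hm h1 =>
        hg f _ hm h1 (by rw [add_comm 1]; exact hf j)
      refine ⟨j + 1, ?_⟩
      rwa [show j + 1 + (j + 1) = 1 + (j + j) + 1 by ring]
    · exact ⟨0, by simpa using ⟨hroot f, hm⟩⟩
  · refine .inl (winI_iff.2 ⟨g, fun f hf => ?_⟩)
    rw [restr_zero_eq _ f] at h1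
    obtain ⟨j, hj⟩ := hh.exists_exit hT hW (hroot f) h1 fun j hm h1 =>
      hg f _ hm h1 (by rw [zero_add]; exact hf j)
    exact ⟨j, by simpa using hj⟩

end

end L3Structure

namespace L3Structure
variable {M : L3Structure.{u}} [hM : Model M]

/-! ## Determinacy gives quantification over reals and selection -/

theorem add_add_one_le_three {m : M.N} (h : m + 1 + (m + 1) ≤ 1 + 1 + 1) : m = 0 := by
  rcases eq_zero_or_succ m with h' | ⟨n, rfl⟩
  · exact h'
  · have h1 : n + 1 + 1 + (n + 1 + 1) = 1 + 1 + 1 + (n + n + 1) := by ring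
    rw [h1] at h
    exact absurd (lt_of_lt_of_le (lt_add_of_pos_right _
      (lt_of_le_of_lt zero_le (lt_succ_self' _))) h) (lt_irrefl _)

theorem one_lt_two' : (1 : M.N) < 1 + 1 := lt_succ_self' 1
theorem zero_lt_one' : (0 : M.N) < 1 := pMinus.zero_lt_one

theorem zero_add_one_lt_double (i : M.N) : 0 + 1 < i + 1 + (i + 1) := by
  rw [show i + 1 + (i + 1) = i + i + 1 + 1 by ring]
  exact add_lt_add_left (lt_of_le_of_lt zero_le (lt_succ_self' _)) 1

/-- The game in which I plays `r`, II answers with `1⌢s` for some `s` with `f(⟨r, s⟩) = 1` or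
claims, by an answer that begins with `0`, that there is none, in which case I has to refute the
claim. -/
theorem exists_projection_tree (f : M.F) : ∃ T : M.F, M.IsTree T ∧ M.IsWFTree T ∧
    ∀ e k, M.Mem (restr e k) T ↔ k ≤ 1 + 1 + 1 ∧
      (1 + 1 ≤ k → row e 1 0 = 0 ∨ f (pair (row e 0) (tail (row e 1))) = 1) ∧
      (k = 1 + 1 + 1 → row e 1 0 = 0 ∧ f (pair (row e 0) (row e (1 + 1))) = 1) := by
  obtain ⟨T, hT⟩ := exists_set_of_seqs (M := M) (p := fun e k => k ≤ 1 + 1 + 1 ∧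
      (1 + 1 ≤ k → row e 1 0 = 0 ∨ f (pair (row e 0) (tail (row e 1))) = 1) ∧
      (k = 1 + 1 + 1 → row e 1 0 = 0 ∧ f (pair (row e 0) (row e (1 + 1))) = 1)) (by fun_prop) (by
    rintro e e' k he ⟨h1, h2, h3⟩
    refine ⟨h1, fun hk => ?_, ?_⟩
    · have hk' := lt_iff_add_one_le.2 hk
      rw [← he 0 (zero_lt_one'.trans hk'), ← he 1 hk']
      exact h2 hk
    · rintro rfl
      rw [← he 0 (zero_lt_one'.trans (one_lt_two'.trans (lt_succ_self' _))),
        ← he 1 (one_lt_two'.trans (lt_succ_self' _)), ← he (1 + 1) (lt_succ_self' _)]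
      exact h3 rfl)
  refine ⟨T, isTree_of hT (fun e => ⟨zero_le, fun h => ?_, fun h => ?_⟩) ?_,
    isWFTree_iff.2 fun e => ⟨1 + 1 + 1 + 1, fun h => ?_⟩, hT⟩
  · exact absurd h (lt_of_lt_of_le zero_lt_one' one_lt_two'.le).not_ge
  · exact absurd h.symm (add_one_ne_zero' _)
  · rintro e k l hkl ⟨h1, h2, h3⟩
    refine ⟨hkl.trans h1, fun hk => h2 (hk.trans hkl), ?_⟩
    rintro rfl
    exact h3 (le_antisymm h1 hkl)
  · exact absurd ((hT _ _).1 h).1 (lt_succ_self' _).not_ge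

/-- Player I cannot have a winning strategy, because its fixed first move can be answered
truthfully. A winning strategy of II answers truthfully for every `r`, so the first digit of its
answer decides the existential statement. The plays have at most three moves and are handled
directly, since the construction of arbitrary plays already uses `RealQuant`. -/
theorem ClopenDet.realQuant (hdet : M.ClopenDet) : M.RealQuant := ⟨fun f => by
  classical
  obtain ⟨T, hT, hW, hm⟩ := exists_projection_tree f
  have hm1 : ∀ e, M.Mem (restr e (0 + 0 + 1)) T := fun e => by
    rw [zero_add, zero_add, hm]
    exact ⟨(one_lt_two'.trans (lt_succ_self' _)).le, fun h => absurd h one_lt_two'.not_ge,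
      fun h => absurd h (one_lt_two'.trans (lt_succ_self' _)).ne⟩
  rcases hdet T hT hW with ⟨S, hS⟩ | ⟨P, hP⟩
  · exfalso
    set r := M.star S (restr default 0) with hr
    have hr' : ∀ e, (0 : M.N) + 0 < 1 + 1 →
      (∀ j, j + j < 1 + 1 → row e (j + j) = M.star S (restr e (j + j))) → row e 0 = r := by
      intro e h0 he
      have := he 0 h0
      rw [add_zero] at this
      rw [this, restr_zero_eq e default]
    -- The truthful answer to `r`.
    obtain ⟨p, hp⟩ : ∃ p : M.R, (p 0 = 0 ∧ ¬ ∃ u, f (pair r u) = 1) ∨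
        (p 0 = 1 ∧ f (pair r (tail p)) = 1) := by
      by_cases h : ∃ u, f (pair r u) = 1
      · obtain ⟨u, hu⟩ := h
        exact ⟨M.cons 1 u, .inr ⟨cons_zero _ _, by rwa [tail_cons]⟩⟩
      · exact ⟨M.cons 0 default, .inl ⟨cons_zero _ _, h⟩⟩
    obtain ⟨P, hP⟩ := exists_operation (M := M) (Φ := fun _ => p) (by fun_prop)
    obtain ⟨k, h1, h2⟩ := hS P
    rcases eq_zero_or_succ k with rfl | ⟨m, rfl⟩
    · obtain ⟨e, he, hS', hP'⟩ := playOut_iff.1 h2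
      simp only [zero_add] at he hS' hP'
      have he0 := hr' e (by rw [add_zero]; exact zero_lt_one'.trans one_lt_two') hS'
      have he1 := hP' 0 (by simp)
      rw [add_zero, zero_add, hP] at he1
      refine he ((hm _ _).2 ⟨(lt_succ_self' _).le, fun _ => ?_,
        fun h => absurd h (lt_succ_self' _).ne⟩)
      rw [he0, he1]
      rcases hp with hp | hp
      · exact .inl hp.1
      · exact .inr hp.2
    · obtain ⟨e, he, hS', hP'⟩ := playIn_iff.1 h1
      rw [hm] at he
      have hm0 : m = 0 := add_add_one_le_three ((lt_succ_self' _).le.trans he.1)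
      subst hm0
      simp only [zero_add] at he hS' hP'
      have hlt : (1 : M.N) + 1 < 1 + 1 + 1 := lt_succ_self' _
      have he0 := hr' e (by rw [add_zero]; exact zero_lt_one'.trans one_lt_two')
        fun j hj => hS' j (hj.trans hlt)
      have he1 := hP' 0 (by simp)
      rw [add_zero, zero_add, hP] at he1
      obtain ⟨h3, h4⟩ := he.2.2 trivial
      rw [he1] at h3
      rw [he0] at h4
      rcases hp with hp | hp
      · exact hp.2 ⟨_, h4⟩
      · rw [hp.1] at h3
        exact one_ne_zero h3
  · obtain ⟨g, hg⟩ := exists_functional (M := M)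
      (g := fun r => if M.star P (single r) 0 = 0 then 0 else 1) (by fun_prop)
    refine ⟨g, fun r => ?_⟩
    have key : ∀ u : M.R, (M.star P (single r) 0 = 0 ∨
        f (pair r (tail (M.star P (single r)))) = 1) ∧
        (M.star P (single r) 0 = 0 → ¬ f (pair r u) = 1) := by
      intro u
      -- I opens with `r` and offers `u` as a refutation. As II wins, a claim that there is no
      -- witness survives every `u`.
      obtain ⟨S, hS⟩ := exists_operation (M := M) (Φ := fun s => if M.len s = 0 then r else u)
        (by fun_prop)
      obtain ⟨k, h1, h2⟩ := hP S
      rcases eq_zero_or_succ k with rfl | ⟨m, rfl⟩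
      · obtain ⟨e, he, -⟩ := playOut_iff.1 h2
        exact absurd (hm1 e) he
      · obtain ⟨e, he, hS', hP'⟩ := playIn_iff.1 h1
        obtain rfl : m = 0 := add_add_one_le_three ((hm _ _).1 he).1
        simp only [zero_add] at he hS' hP'
        have he0 := hS' 0 (by rw [add_zero]; exact zero_lt_one'.trans one_lt_two')
        rw [add_zero, hS, len_restr, if_pos rfl] at he0
        have he1 := hP' 0 (by simp)
        rw [add_zero, zero_add, restr_one_eq_single he0] at he1
        refine ⟨?_, fun hp hu => ?_⟩
        · have := ((hm _ _).1 he).2.1 le_rfl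
          rwa [he0, he1] at this
        · obtain ⟨e, he, hS', hP'⟩ := playOut_iff.1 h2
          simp only [zero_add] at he hS' hP'
          have hlt : (1 : M.N) + 1 < 1 + 1 + 1 := lt_succ_self' _
          have he0 := hS' 0 (by rw [add_zero]; exact zero_lt_one'.trans (one_lt_two'.trans hlt))
          rw [add_zero, hS, len_restr, if_pos rfl] at he0
          have he1 := hP' 0 (by simp)
          rw [add_zero, zero_add, restr_one_eq_single he0] at he1
          have he2 := hS' 1 hlt
          rw [hS, len_restr, if_neg (add_one_ne_zero' 1)] at he2
          refine he ((hm _ _).2 ⟨le_rfl, fun _ => .inl ?_, fun _ => ⟨?_, ?_⟩⟩)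
          · rw [he1, hp]
          · rw [he1, hp]
          · rw [he0, he2, hu]
    rw [hg]
    split_ifs with h
    · exact ⟨fun h' => absurd h' zero_ne_one, fun ⟨u, hu⟩ => absurd hu ((key u).2 h)⟩
    · exact ⟨fun _ => ⟨_, (key default).1.resolve_left h⟩, fun _ => rfl⟩⟩

section
variable [RealQuant M]

/-- In the selection tree II only has to answer `r` by a suitable `s`. By hypothesis the opening of
any strategy of I can be answered, so II wins, and the winning answers form the selector. -/
theorem ClopenDet.sf (hdet : M.ClopenDet) : M.SF := by
  intro f hf
  simp only [pairVal_iff] at hf ⊢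
  obtain ⟨T, hT, hW, -, h1, h2, h3⟩ := exists_selection_tree f
  rcases hdet T hT hW with hI | hII
  · exfalso
    obtain ⟨S, hS⟩ := winI_iff.1 hI
    obtain ⟨s, hs⟩ := hf (M.star S (restr default 0))
    obtain ⟨P, hP⟩ := exists_operation (M := M) (Φ := fun _ => s) (by fun_prop)
    obtain ⟨e, he, he'⟩ := exists_play S P
    obtain ⟨k, hk, hk'⟩ := hS e he
    rcases eq_zero_or_succ k with rfl | ⟨m, rfl⟩
    · refine hk' ?_
      have he0 := he 0
      have he1 := he' 0
      rw [add_zero, restr_zero_eq e default] at he0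
      rw [add_zero, zero_add, hP] at he1
      rw [add_zero, zero_add, h2, he0, he1, hs]
    · exact h3 e (m + m) (by rwa [show m + m + 1 + 1 + 1 = m + 1 + (m + 1) + 1 by ring])
  · obtain ⟨P, hP⟩ := winII_iff.1 hII
    obtain ⟨g, hg⟩ := exists_operation (M := M) (Φ := fun r => M.star P (single r)) (by fun_prop)
    refine ⟨g, fun r => ?_⟩
    obtain ⟨S, hS⟩ := exists_operation (M := M) (Φ := fun _ => r) (by fun_prop)
    obtain ⟨e, he, he'⟩ := exists_play S P
    have he0 := he 0
    rw [add_zero, hS] at he0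
    have he1 := he' 0
    rw [add_zero, zero_add, restr_one_eq_single he0, ← hg] at he1
    obtain ⟨k, hk, hk'⟩ := hP e he'
    rcases eq_zero_or_succ k with rfl | ⟨m, rfl⟩
    · exact absurd (h1 e) (by simpa using hk')
    · have := (isTree_iff.1 hT).2 e (1 + 1) _ (by
        rw [show m + 1 + (m + 1) = 1 + 1 + (m + m) by ring]; exact le_self_add) hk
      rwa [h2, he0, he1] at this

/-! ## Recursion on well-founded relations -/

variable (M) in
/-- `h` is defined by recursion on the relation `E`. -/
def IsGraphRec (E : M.R → M.R → Prop) (h : M.F) : Prop :=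
  (∀ x, h x = 0 ∨ h x = 1) ∧ ∀ x, h x = 0 ↔ ∀ y, E x y → h y = 1

open Classical in
/-- The sequence `f` with `a` put in front. -/
noncomputable def consRow (a f : M.R) : M.R :=
  ofRows fun i => if i = 0 then a else row f (pred i)

omit [RealQuant M] in
theorem row_consRow (a f : M.R) (i : M.N) :
    row (consRow a f) i = open Classical in if i = 0 then a else row f (pred i) := by
  classical
  exact row_ofRows (g := fun i => if i = 0 then a else row f (pred i)) (by fun_prop) i

omit [RealQuant M] in
@[simp] theorem row_consRow_zero (a f : M.R) : row (consRow a f) 0 = a := by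
  rw [row_consRow, if_pos rfl]

omit [RealQuant M] in
@[simp] theorem row_consRow_succ (a f : M.R) (i : M.N) : row (consRow a f) (i + 1) = row f i := by
  rw [row_consRow, if_neg (add_one_ne_zero' i), pred_succ]

omit [RealQuant M] in
@[fun_prop] theorem Eff.consRow {α : Type*} [Coded M α] {f g : α → M.R} (hf : Eff M f)
    (hg : Eff M g) : Eff M fun a => consRow (f a) (g a) :=
  .ofRows (by fun_prop)

/-- The finite sequence `s` with `a` put in front. -/
noncomputable def consSeq (a s : M.R) : M.R := restr (consRow a (tail s)) (M.len s + 1)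

omit [RealQuant M] in
@[fun_prop] theorem Eff.consSeq {α : Type*} [Coded M α] {f g : α → M.R} (hf : Eff M f)
    (hg : Eff M g) : Eff M fun a => consSeq (f a) (g a) := by
  unfold L3Structure.consSeq; fun_prop

omit [RealQuant M] in
@[simp] theorem consSeq_restr (a f : M.R) (k : M.N) :
    consSeq a (restr f k) = restr (consRow a f) (k + 1) := by
  rw [consSeq, len_restr, restr_eq_iff]
  intro i hi
  rcases eq_zero_or_succ i with rfl | ⟨j, rfl⟩
  · simp
  · rw [row_consRow_succ, row_consRow_succ, row_tail_restr (lt_of_add_lt_add_right hi)]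

/-- One sequence whose later entries are supplied alternately by two strategies. Behind different
prefixes it is part of two runs of one game in which the roles of the players are exchanged. -/
theorem exists_joint_play (a : M.R) {Φ Ψ : M.R → M.R} (hΦ : Eff M Φ) (hΨ : Eff M Ψ) :
    ∃ c, row c 0 = a ∧ (∀ j, row c (j + j + 1) = Φ (restr c (j + j + 1))) ∧
      ∀ j, row c (j + 1 + (j + 1)) = Ψ (restr c (j + 1 + (j + 1))) := by
  classical
  obtain ⟨c, hc⟩ := exists_rows (M := M) (Φ := fun s => if M.len s = 0 then a else
    if half (M.len s) + half (M.len s) = M.len s then Ψ s else Φ s) (by fun_prop)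
  refine ⟨c, by simp [hc], fun j => ?_, fun j => ?_⟩
  · rw [hc, len_restr, if_neg (add_one_ne_zero' _), half_double_add_one,
      if_neg (lt_succ_self' _).ne]
  · rw [hc, len_restr, ← add_assoc, if_neg (add_one_ne_zero' _), add_assoc, half_double,
      if_pos rfl]

-- A downward closed set of lengths is left only once, and the two exits have different parities.
omit [RealQuant M] in
theorem not_two_exits {q : M.N → Prop} (hq : ∀ m n, m ≤ n → q n → q m) {k l : M.N}
    (h1 : q (k + k)) (h2 : ¬ q (k + k + 1)) (h3 : q (l + l + 1)) (h4 : ¬ q (l + l + 1 + 1)) :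
    False := by
  rcases lt_or_ge l k with h | h
  · refine h4 (hq _ _ ?_ h1)
    have := add_one_le_of_lt h
    rw [show l + l + 1 + 1 = l + 1 + (l + 1) by ring]
    exact add_le_add this this
  · exact h2 (hq _ _ (by gcongr) h3)

/-- The game is that of naming `x`, passing or moving, and then moving along `E`. A winning strategy
`P` of II should pass at `x` exactly if the player to move at `x` loses, so `h` records whether `P`
passes. Each violation of the recursion yields two runs that share a tail `c`, both won by the owner
of the strategy, although the first illegal step in `c` falls to the owner in one of them. -/
theorem ClopenDet.exists_isGraphRec (hdet : M.ClopenDet) {E : M.R → M.R → Prop}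
    (hE : Eff M fun x : M.R × M.R => E x.1 x.2)
    (hwf : ∀ f, ∃ n, ¬ E (row f n) (row f (n + 1))) : ∃ h, M.IsGraphRec E h := by
  classical
  have hE' : ∀ {α : Type u} [Coded M α] {f g : α → M.R}, Eff M f → Eff M g →
    Eff M fun a => E (f a) (g a) := fun hf hg => hE.op₂ hf hg
  have hirr : ∀ x, ¬ E x x := fun x hx => by
    obtain ⟨n, hn⟩ := hwf (ofRows fun _ => x)
    simp only [row_ofRows (g := fun _ => x) (by fun_prop)] at hn
    exact hn hx
  -- `p` describes legal plays, where the second move may repeat the first; `q` describes plain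
  -- `E`-paths. Since `E` is irreflexive, a pass cannot be mistaken for a move.
  let p (e : M.R) (k : M.N) : Prop :=
    ∀ i, i + 1 < k → E (row e i) (row e (i + 1)) ∨ i = 0 ∧ row e 0 = row e 1
  let q (c : M.R) (k : M.N) : Prop := ∀ i, i + 1 < k → E (row c i) (row c (i + 1))
  have hq : ∀ c m n, m ≤ n → q c n → q c m := fun c m n hmn h i hi => h i (hi.trans_le hmn)
  obtain ⟨T, hm⟩ := exists_set_of_seqs (M := M) (p := p)
    (.forall (.imp (by fun_prop) (.or (hE' (by fun_prop) (by fun_prop)) (by fun_prop)))) (by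
      intro e e' k he h i hi
      rw [← he i ((lt_succ_self' i).trans hi), ← he _ hi]
      refine (h i hi).imp_right ?_
      rintro ⟨rfl, h⟩
      refine ⟨rfl, ?_⟩
      rw [zero_add] at hi
      rw [← he 0 (zero_lt_one'.trans hi), ← he 1 hi, h])
  have hT : M.IsTree T := isTree_of hm (fun e i hi => absurd hi zero_le.not_gt)
    fun e k l hkl h i hi => h i (hi.trans_le hkl)
  have hW : M.IsWFTree T := isWFTree_iff.2 fun e => by
    by_contra! hcon
    -- The first entry is dropped because a pass can occur only there.
    obtain ⟨n, hn⟩ := hwf (ofRows fun i => row e (i + 1))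
    rw [row_ofRows (by fun_prop), row_ofRows (by fun_prop)] at hn
    rcases (hm e _).1 (hcon _) (n + 1) (lt_succ_self' _) with h | h
    · exact hn h
    · exact add_one_ne_zero' _ h.1
  have hp1 : ∀ e, p e 1 := fun e i hi => by
    exact absurd (lt_of_add_lt_add_right (show i + 1 < 0 + 1 by rwa [zero_add])) zero_le.not_gt
  have hpcons : ∀ x c n, (E x (row c 0) ∨ x = row c 0) →
      (p (consRow x c) (n + 1) ↔ q c n) := by
    intro x c n hx
    constructor
    · intro h i hi
      have := h (i + 1) (add_lt_add_left hi 1)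
      simpa using this
    · intro h i hi
      rcases eq_zero_or_succ i with rfl | ⟨j, rfl⟩
      · have h1 : row (consRow x c) 1 = row c 0 := by
          rw [← zero_add (1 : M.N), row_consRow_succ]
        refine hx.imp (fun h => ?_) fun h => ⟨rfl, ?_⟩
        · rwa [row_consRow_zero, row_consRow_succ]
        · rwa [row_consRow_zero, h1]
      · rw [row_consRow_succ, row_consRow_succ]
        exact .inl (h j (lt_of_add_lt_add_right hi))
  have hpq : ∀ c n, row c 0 ≠ row c 1 → (p c n ↔ q c n) := fun c n hc =>
    ⟨fun h i hi => (h i hi).resolve_right fun h' => hc h'.2, fun h i hi => .inl (h i hi)⟩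
  have hpass : ∀ x c n, E x (row c 0) → (p (consRow x (consRow x c)) (n + 1 + 1) ↔ q c n) := by
    intro x c n hx
    rw [hpcons x _ _ (.inr (row_consRow_zero x c).symm)]
    constructor
    · intro h i hi
      have := h (i + 1) (add_lt_add_left hi 1)
      simpa using this
    · intro h i hi
      rcases eq_zero_or_succ i with rfl | ⟨j, rfl⟩
      · rwa [row_consRow_zero, row_consRow_succ]
      · rw [row_consRow_succ, row_consRow_succ]
        exact h j (lt_of_add_lt_add_right hi)
  rcases hdet T hT hW with hI | hII
  · exfalso
    obtain ⟨S, hS⟩ := winI_iff.1 hI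
    simp only [hm] at hS
    set x := M.star S (restr default 0) with hx
    -- Strategy stealing: in one run II passes at `x` and the reply of I is `c₁`; in the other run
    -- II plays `c₁` as its own move and I replies with `c₂`.
    obtain ⟨c, hc0, hc1, hc2⟩ := exists_joint_play x (Φ := fun s => M.star S (consSeq x s))
      (Ψ := M.star S) (by fun_prop) (by fun_prop)
    simp only [consSeq_restr] at hc1
    obtain ⟨k, hk, hk'⟩ := hS (consRow x c) fun j => by
      rcases eq_zero_or_succ j with rfl | ⟨i, rfl⟩
      · rw [add_zero, row_consRow_zero, restr_zero_eq _ default]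
      · rw [show i + 1 + (i + 1) = i + i + 1 + 1 by ring, row_consRow_succ, hc1]
    obtain ⟨l, hl, hl'⟩ := hS c fun j => by
      rcases eq_zero_or_succ j with rfl | ⟨i, rfl⟩
      · rw [add_zero, hc0, restr_zero_eq _ default]
      · exact hc2 i
    rw [hpcons x c _ (.inr hc0.symm)] at hk hk'
    have hne : row c 0 ≠ row c 1 := by
      intro h
      rcases eq_zero_or_succ k with rfl | ⟨i, rfl⟩
      · refine hk' fun i hi => ?_
        rw [zero_add] at hi
        exact absurd (lt_of_add_lt_add_right hi) zero_le.not_gt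
      · have := hk 0 (zero_add_one_lt_double i)
        rw [zero_add, ← h] at this
        exact hirr _ this
    rw [hpq c _ hne] at hl hl'
    exact not_two_exits (hq c) hk hk' hl hl'
  · obtain ⟨P, hP⟩ := winII_iff.1 hII
    simp only [hm] at hP
    have hfirst : ∀ x, E x (M.star P (single x)) ∨ x = M.star P (single x) := by
      intro x
      obtain ⟨S, hS⟩ := exists_operation (M := M) (Φ := fun _ => x) (by fun_prop)
      obtain ⟨e, he, he'⟩ := exists_play S P
      have he0 := he 0
      rw [add_zero, hS] at he0
      have he1 := he' 0
      rw [add_zero, zero_add, restr_one_eq_single he0] at he1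
      obtain ⟨k, hk, hk'⟩ := hP e he'
      rcases eq_zero_or_succ k with rfl | ⟨i, rfl⟩
      · exact absurd (hp1 e) (by simpa using hk')
      · rw [← he1]
        rcases hk 0 (zero_add_one_lt_double i) with h | h
        · rw [he0, zero_add] at h
          exact .inl h
        · exact .inr (he0.symm.trans h.2)
    have hsing : ∀ e, M.star P (restr e 1) = M.star P (single (row e 0)) := fun e => by
      rw [restr_one_eq_single rfl]
    have hpassed : ∀ x y, M.star P (single x) = x → E x y → M.star P (single y) ≠ y := by
      intro x y hx hxy hy
      -- The runs are `x, x, y, c₁, c₂, …` and `y, y, c₁, c₂, …`. The strategy `P` supplies `c₁` in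
      -- the former and `c₂` in the latter, so the shared path would have two different ends.
      obtain ⟨c, hc0, hc1, hc2⟩ := exists_joint_play y
        (Φ := fun s => M.star P (consSeq x (consSeq x s)))
        (Ψ := fun s => M.star P (consSeq y s)) (by fun_prop) (by fun_prop)
      simp only [consSeq_restr] at hc1 hc2
      obtain ⟨k, hk, hk'⟩ := hP (consRow x (consRow x c)) fun j => by
        rw [row_consRow_succ]
        rcases eq_zero_or_succ j with rfl | ⟨i, rfl⟩
        · rw [add_zero, row_consRow_zero, zero_add, hsing, row_consRow_zero, hx]
        · rw [show i + 1 + (i + 1) = i + i + 1 + 1 by ring, row_consRow_succ, hc1]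
      obtain ⟨l, hl, hl'⟩ := hP (consRow y c) fun j => by
        rw [row_consRow_succ]
        rcases eq_zero_or_succ j with rfl | ⟨i, rfl⟩
        · rw [add_zero, hc0, zero_add, hsing, row_consRow_zero, hy]
        · exact hc2 i
      rcases eq_zero_or_succ k with rfl | ⟨k, rfl⟩
      · exact absurd (hp1 _) (by simpa using hk')
      rcases eq_zero_or_succ l with rfl | ⟨l, rfl⟩
      · exact absurd (hp1 _) (by simpa using hl')
      rw [show k + 1 + (k + 1) = k + k + 1 + 1 by ring] at hk
      rw [show k + 1 + (k + 1) + 1 = k + k + 1 + 1 + 1 by ring] at hk'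
      rw [show l + 1 + (l + 1) = l + l + 1 + 1 by ring] at hl
      rw [show l + 1 + (l + 1) + 1 = l + l + 1 + 1 + 1 by ring] at hl'
      rw [hpass x c _ (by rwa [hc0])] at hk hk'
      rw [hpcons y c _ (.inr hc0.symm)] at hl hl'
      exact not_two_exits (hq c) hk hk' hl hl'
    have hmoved : ∀ x, M.star P (single x) ≠ x →
        M.star P (single (M.star P (single x))) = M.star P (single x) := by
      intro x hx
      by_contra hy
      have hxy := (hfirst x).resolve_right (Ne.symm hx)
      set y := M.star P (single x) with hy'
      -- Here the runs are `y, c₁, c₂, …`, where II does not pass, and `x, y, c₁, c₂, …`.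
      obtain ⟨c, hc0, hc1, hc2⟩ := exists_joint_play y (Φ := M.star P)
        (Ψ := fun s => M.star P (consSeq x s)) (by fun_prop) (by fun_prop)
      simp only [consSeq_restr] at hc2
      obtain ⟨k, hk, hk'⟩ := hP c hc1
      obtain ⟨l, hl, hl'⟩ := hP (consRow x c) fun j => by
        rw [row_consRow_succ]
        rcases eq_zero_or_succ j with rfl | ⟨i, rfl⟩
        · rw [add_zero, hc0, zero_add, hsing, row_consRow_zero]
        · exact hc2 i
      rcases eq_zero_or_succ l with rfl | ⟨l, rfl⟩
      · exact absurd (hp1 _) (by simpa using hl')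
      rw [show l + 1 + (l + 1) = l + l + 1 + 1 by ring] at hl
      rw [show l + 1 + (l + 1) + 1 = l + l + 1 + 1 + 1 by ring] at hl'
      have hne : row c 0 ≠ row c 1 := by
        have := hc1 0
        rw [add_zero, zero_add, hsing, hc0] at this
        rw [hc0, this]
        exact Ne.symm hy
      rw [hpq c _ hne] at hk hk'
      rw [hpcons x c _ (.inl (by rwa [hc0]))] at hl hl'
      exact not_two_exits (hq c) hk hk' hl hl'
    obtain ⟨h, hh⟩ := exists_functional (M := M)
      (g := fun x => if M.star P (single x) = x then 0 else 1) (by fun_prop)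
    have h0 : ∀ x, h x = 0 ↔ M.star P (single x) = x := fun x => by
      rw [hh]; split_ifs with hx <;> simp [hx]
    have h1 : ∀ x, h x = 1 ↔ M.star P (single x) ≠ x := fun x => by
      rw [hh]; split_ifs with hx <;> simp [hx]
    refine ⟨h, fun x => ?_, fun x => ?_⟩
    · rw [h0, h1]; exact em _
    · simp only [h0, h1]
      refine ⟨fun hx y hxy => hpassed x y hx hxy, fun hall => ?_⟩
      by_contra hx
      exact hall _ ((hfirst x).resolve_right (Ne.symm hx)) (hmoved x hx)

end

end L3Structure

namespace L3Structure
variable {M : L3Structure.{u}} [hM : Model M] [RealQuant M]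

/-! ## Bar recursion from recursion on well-founded relations -/

/-- Successive one-point extensions cohere, so a chain of them would glue to an infinite path of
`T`. This is well-foundedness of the child relation. -/
theorem IsWFTree.exists_not_snoc {T : M.F} (hW : M.IsWFTree T) (hT : M.IsTree T) (f : M.R) :
    ∃ n, ¬ (M.Mem (row f n) T ∧ M.Mem (row f (n + 1)) T ∧
      ∃ a, row f (n + 1) = snoc (row f n) a) := by
  by_contra! hcon
  have hlen : ∀ n, M.len (row f n) = M.len (row f 0) + n := by
    refine nat_induction (by fun_prop) (by simp) fun n ih => ?_
    obtain ⟨a, ha⟩ := (hcon n).2.2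
    rw [ha, snoc, len_restr, ih, add_assoc]
  have hcoh : ∀ n d i, i < M.len (row f n) →
      row (tail (row f (n + d))) i = row (tail (row f n)) i := by
    intro n
    refine nat_induction (by fun_prop) (by simp) fun d ih i hi => ?_
    obtain ⟨a, ha⟩ := (hcon (n + d)).2.2
    have hi' : i < M.len (row f (n + d)) := by
      rw [hlen] at hi ⊢
      exact lt_of_lt_of_le hi (by gcongr; exact le_self_add)
    rw [← add_assoc, ha, snoc, row_tail_restr (hi'.trans (lt_succ_self' _)), row_extend,
      if_pos hi', ih i hi]
  have hcoh' : ∀ n m i, i < M.len (row f n) → i < M.len (row f m) →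
      row (tail (row f m)) i = row (tail (row f n)) i := by
    intro n m i hn hm
    rcases le_total n m with h | h
    · obtain ⟨d, rfl⟩ := exists_add_of_le h
      exact hcoh n d i hn
    · obtain ⟨d, rfl⟩ := exists_add_of_le h
      exact (hcoh m d i hm).symm
  -- Entry `i` of the path is read from the sequence `row f (i + 1)`, which has length at least `i +
  -- 1`.
  obtain ⟨k, hk⟩ := isWFTree_iff.1 hW (ofRows fun i => row (tail (row f (i + 1))) i)
  refine hk ((isTree_iff.1 hT).2 _ k (M.len (row f 0) + k) le_add_self ?_)
  have : restr (ofRows fun i => row (tail (row f (i + 1))) i) (M.len (row f 0) + k) =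
      row f k := by
    refine Eq.trans ?_ (hcon k).1.1.restr_tail
    rw [hlen k, restr_eq_iff]
    intro i hi
    rw [row_ofRows (by fun_prop), hcoh' k (i + 1) i (by rwa [hlen k]) (by
      rw [hlen]; exact lt_of_lt_of_le (lt_succ_self' i) le_add_self)]
  rw [this]
  exact (hcon k).1

theorem ClopenDet.br1 (hdet : M.ClopenDet) : M.BR1 := by
  intro T hT hW
  obtain ⟨h, hh, hr⟩ := hdet.exists_isGraphRec
    (E := fun s t => M.Mem s T ∧ M.Mem t T ∧ ∃ a, t = snoc s a) (by fun_prop)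
    (hW.exists_not_snoc hT)
  refine ⟨h, hh, fun s hs => (hr s).trans ?_⟩
  constructor
  · intro h a t hst ht
    exact h t ⟨hs, ht, a, (isSnoc_iff_eq.1 hst).2⟩
  · rintro h t ⟨-, ht, a, rfl⟩
    exact h a _ (isSnoc_iff_eq.2 ⟨hs.1, rfl⟩) ht

/-! ## A normal form for predicates of a functional -/

variable {α β : Type u} [Coded M α] [Coded M β]

/-- The predicate `p` of functionals is equivalent to the existence of a real that answers
countably many queries to the functional correctly and passes an effective test. -/
def IsQuery (p : α → M.F → Prop) : Prop :=
  ∃ (A : α → M.R → Prop) (Q : α → M.R → M.N → M.R) (C : α → M.R → M.N → M.N),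
    Eff M (fun x : α × M.R => A x.1 x.2) ∧
    Eff M (fun x : (α × M.R) × M.N => Q x.1.1 x.1.2 x.2) ∧
    Eff M (fun x : (α × M.R) × M.N => C x.1.1 x.1.2 x.2) ∧
    ∀ a Y, p a Y ↔ ∃ u, A a u ∧ ∀ i, Y (Q a u i) = C a u i

namespace IsQuery

omit [RealQuant M] in
theorem of_eff {p : α → Prop} (hp : Eff M p) : IsQuery (M := M) fun a _ => p a := by
  -- The definition demands some query, so `Y(default)` is asked, and `u(0)` may be any predicted
  -- value.
  refine ⟨fun a _ => p a, fun _ _ _ => default, fun _ u _ => u 0, by fun_prop, by fun_prop,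
    by fun_prop, fun a Y => ⟨fun h => ⟨M.cons (Y default) default, h, fun _ => (cons_zero _ _).symm⟩,
      fun ⟨_, h, _⟩ => h⟩⟩

omit [RealQuant M] in
theorem apply {f : α → M.R} {m : α → M.N} (hf : Eff M f) (hm : Eff M m) :
    IsQuery fun a (Y : M.F) => Y (f a) = m a :=
  ⟨fun _ _ => True, fun a _ _ => f a, fun a _ _ => m a, by fun_prop, by fun_prop, by fun_prop,
    fun a Y => ⟨fun h => ⟨default, trivial, fun _ => h⟩, fun ⟨_, _, h⟩ => h 0⟩⟩

omit [RealQuant M] in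
theorem comp {p : α → M.F → Prop} (hp : IsQuery p) {g : β → α} (hg : Eff M g) :
    IsQuery fun b Y => p (g b) Y := by
  obtain ⟨A, Q, C, hA, hQ, hC, h⟩ := hp
  refine ⟨fun b u => A (g b) u, fun b u i => Q (g b) u i, fun b u i => C (g b) u i,
    ?_, ?_, ?_, fun b Y => h (g b) Y⟩
  · exact hA.op₂ (F := A) (by fun_prop) (by fun_prop)
  · exact hQ.comp (g := fun x : (β × M.R) × M.N => ((g x.1.1, x.1.2), x.2)) (by fun_prop)
  · exact hC.comp (g := fun x : (β × M.R) × M.N => ((g x.1.1, x.1.2), x.2)) (by fun_prop)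

omit [RealQuant M] in
theorem congr {p q : α → M.F → Prop} (hp : IsQuery p) (h : ∀ a Y, p a Y ↔ q a Y) : IsQuery q :=
  (congrArg IsQuery (funext fun a => funext fun Y => propext (h a Y))).mp hp

omit [RealQuant M] in
theorem and {p q : α → M.F → Prop} (hp : IsQuery p) (hq : IsQuery q) :
    IsQuery fun a Y => p a Y ∧ q a Y := by
  classical
  obtain ⟨A, Q, C, hA, hQ, hC, h⟩ := hp
  obtain ⟨A', Q', C', hA', hQ', hC', h'⟩ := hq
  refine ⟨fun a u => A a (evens u) ∧ A' a (odds u),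
    fun a u i => if half i + half i = i then Q a (evens u) (half i) else Q' a (odds u) (half i),
    fun a u i => if half i + half i = i then C a (evens u) (half i) else C' a (odds u) (half i),
    .and (hA.op₂ (F := A) (by fun_prop) (by fun_prop))
      (hA'.op₂ (F := A') (by fun_prop) (by fun_prop)), ?_, ?_, fun a Y => ?_⟩
  · exact .ite_real (by fun_prop)
      (hQ.comp (g := fun x : (α × M.R) × M.N => ((x.1.1, evens x.1.2), half x.2)) (by fun_prop))
      (hQ'.comp (g := fun x : (α × M.R) × M.N => ((x.1.1, odds x.1.2), half x.2)) (by fun_prop))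
  · exact .ite_nat (by fun_prop)
      (hC.comp (g := fun x : (α × M.R) × M.N => ((x.1.1, evens x.1.2), half x.2)) (by fun_prop))
      (hC'.comp (g := fun x : (α × M.R) × M.N => ((x.1.1, odds x.1.2), half x.2)) (by fun_prop))
  · beta_reduce
    rw [h, h']
    constructor
    · rintro ⟨⟨u, hu, hi⟩, u', hu', hi'⟩
      refine ⟨pair u u', by simpa using ⟨hu, hu'⟩, fun i => ?_⟩
      split_ifs
      · simpa using hi _
      · simpa using hi' _
    · rintro ⟨u, ⟨hu, hu'⟩, hi⟩
      refine ⟨⟨_, hu, fun i => ?_⟩, _, hu', fun i => ?_⟩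
      · simpa using hi (i + i)
      · have := hi (i + i + 1)
        rwa [half_double_add_one, if_neg (lt_succ_self' _).ne,
          if_neg (lt_succ_self' _).ne] at this

omit [RealQuant M] in
theorem or {p q : α → M.F → Prop} (hp : IsQuery p) (hq : IsQuery q) :
    IsQuery fun a Y => p a Y ∨ q a Y := by
  classical
  obtain ⟨A, Q, C, hA, hQ, hC, h⟩ := hp
  obtain ⟨A', Q', C', hA', hQ', hC', h'⟩ := hq
  -- The head of `u` announces which disjunct is being witnessed.
  refine ⟨fun a u => u 0 = 0 ∧ A a (tail u) ∨ ¬ u 0 = 0 ∧ A' a (tail u),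
    fun a u i => if u 0 = 0 then Q a (tail u) i else Q' a (tail u) i,
    fun a u i => if u 0 = 0 then C a (tail u) i else C' a (tail u) i,
    .or (.and (by fun_prop) (hA.op₂ (F := A) (by fun_prop) (by fun_prop)))
      (.and (by fun_prop) (hA'.op₂ (F := A') (by fun_prop) (by fun_prop))), ?_, ?_, fun a Y => ?_⟩
  · exact .ite_real (by fun_prop)
      (hQ.comp (g := fun x : (α × M.R) × M.N => ((x.1.1, tail x.1.2), x.2)) (by fun_prop))
      (hQ'.comp (g := fun x : (α × M.R) × M.N => ((x.1.1, tail x.1.2), x.2)) (by fun_prop))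
  · exact .ite_nat (by fun_prop)
      (hC.comp (g := fun x : (α × M.R) × M.N => ((x.1.1, tail x.1.2), x.2)) (by fun_prop))
      (hC'.comp (g := fun x : (α × M.R) × M.N => ((x.1.1, tail x.1.2), x.2)) (by fun_prop))
  · beta_reduce
    rw [h, h']
    constructor
    · rintro (⟨u, hu, hi⟩ | ⟨u, hu, hi⟩)
      · refine ⟨M.cons 0 u, ?_, fun i => ?_⟩
        · simpa [cons_zero] using hu
        · simpa [cons_zero] using hi i
      · refine ⟨M.cons 1 u, ?_, fun i => ?_⟩
        · simpa [cons_zero] using hu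
        · simpa [cons_zero] using hi i
    · rintro ⟨u, ⟨h0, hu⟩ | ⟨h0, hu⟩, hi⟩
      · simp only [if_pos h0] at hi
        exact .inl ⟨_, hu, hi⟩
      · simp only [if_neg h0] at hi
        exact .inr ⟨_, hu, hi⟩

omit [RealQuant M] in
theorem ex {p : α × β → M.F → Prop} (hp : IsQuery p) : IsQuery fun a Y => ∃ b, p (a, b) Y := by
  obtain ⟨A, Q, C, hA, hQ, hC, h⟩ := hp
  have hd : Eff M (Coded.dec : M.R → β) := ⟨_, .id, fun _ => rfl⟩
  refine ⟨fun a u => A (a, Coded.dec (evens u)) (odds u),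
    fun a u i => Q (a, Coded.dec (evens u)) (odds u) i,
    fun a u i => C (a, Coded.dec (evens u)) (odds u) i,
    hA.comp (g := fun x : α × M.R => ((x.1, Coded.dec (evens x.2)), odds x.2)) ?_,
    hQ.comp (g := fun x : (α × M.R) × M.N =>
      (((x.1.1, Coded.dec (evens x.1.2)), odds x.1.2), x.2)) ?_,
    hC.comp (g := fun x : (α × M.R) × M.N =>
      (((x.1.1, Coded.dec (evens x.1.2)), odds x.1.2), x.2)) ?_, fun a Y => ?_⟩
  · fun_prop
  · fun_prop
  · fun_prop
  · constructor
    · rintro ⟨b, hb⟩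
      obtain ⟨u, hu⟩ := (h (a, b) Y).1 hb
      obtain ⟨r, rfl⟩ := Coded.surj (M := M) b
      exact ⟨pair r u, by simpa using hu⟩
    · rintro ⟨u, hu⟩
      exact ⟨_, (h (a, Coded.dec (evens u)) Y).2 ⟨_, hu⟩⟩

/-- Countable choice collects the witnesses for all `n` as the rows of one real; pairs of naturals
index the queries. -/
theorem all_nat (hSF : M.SF) {p : α × M.N → M.F → Prop} (hp : IsQuery p) :
    IsQuery fun a Y => ∀ n, p (a, n) Y := by
  obtain ⟨A, Q, C, hA, hQ, hC, h⟩ := hp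
  refine ⟨fun a u => ∀ n, A (a, n) (row u n),
    fun a u i => Q (a, left i) (row u (left i)) (right i),
    fun a u i => C (a, left i) (row u (left i)) (right i),
    .forall (hA.comp (g := fun x : (α × M.R) × M.N => ((x.1.1, x.2), row x.1.2 x.2)) ?_),
    hQ.comp (g := fun x : (α × M.R) × M.N =>
      (((x.1.1, left x.2), row x.1.2 (left x.2)), right x.2)) ?_,
    hC.comp (g := fun x : (α × M.R) × M.N =>
      (((x.1.1, left x.2), row x.1.2 (left x.2)), right x.2)) ?_, fun a Y => ?_⟩
  · fun_prop
  · fun_prop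
  · fun_prop
  · constructor
    · intro hn
      obtain ⟨q, hq⟩ := hSF.select_nat
        (p := fun n u => A (a, n) u ∧ ∀ i, Y (Q (a, n) u i) = C (a, n) u i)
        (.and (hA.comp (g := fun x : M.N × M.R => ((a, x.1), x.2)) (by fun_prop))
          (.forall (.nat_eq
            (.app1 Y (hQ.comp (g := fun x : (M.N × M.R) × M.N => (((a, x.1.1), x.1.2), x.2))
              (by fun_prop)))
            (hC.comp (g := fun x : (M.N × M.R) × M.N => (((a, x.1.1), x.1.2), x.2))
              (by fun_prop)))))
        fun n => (h (a, n) Y).1 (hn n)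
      exact ⟨q, fun n => (hq n).1, fun i => (hq _).2 _⟩
    · rintro ⟨u, hu, hi⟩ n
      refine (h (a, n) Y).2 ⟨row u n, hu n, fun i => ?_⟩
      simpa using hi (M.natPair n i)

end IsQuery

/-- The valuation with the given values, except that the type-2 variable `j` has the value `Y`. -/
def valOf (e₀ : ℕ → α → M.N) (e₁ : ℕ → α → M.R) (e₂ : ℕ → M.F) (j : ℕ) (a : α) (Y : M.F) : M.Val :=
  fun p => match p with
  | (.s0, n) => e₀ n a
  | (.s1, n) => e₁ n a
  | (.s2, n) => if n = j then Y else e₂ n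

omit hM [RealQuant M] [Coded M α] in
theorem valOf_set0 (e₀ : ℕ → α → M.N) (e₁ : ℕ → α → M.R) (e₂ : ℕ → M.F) (j n : ℕ) (a : α)
    (Y : M.F) (x : M.N) : (valOf e₀ e₁ e₂ j a Y).set .s0 n x =
      valOf (fun m p => if m = n then p.2 else e₀ m p.1) (fun m (p : α × M.N) => e₁ m p.1) e₂ j
        (a, x) Y := by
  funext p
  obtain ⟨_ | _ | _, m⟩ := p
  · by_cases h : m = n
    · subst h
      simp [valOf]
      rfl
    · rw [Val.set0_ne _ _ _ _ (by simpa using h)]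
      simp [valOf, h]
      rfl
  · rw [Val.set0_ne _ _ _ _ (by simp)]
    rfl
  · rw [Val.set0_ne _ _ _ _ (by simp)]
    rfl

/-- The graph of the term is a query. -/
def TermIsQuery (e₀ : ℕ → α → M.N) (e₁ : ℕ → α → M.R) (e₂ : ℕ → M.F) (j : ℕ) :
    (s : L3Sort) → L3Term s → Prop
  | .s0, t => IsQuery fun (x : α × M.N) Y => (M.eval (valOf e₀ e₁ e₂ j x.1 Y) t : M.N) = x.2
  | .s1, t => IsQuery fun (x : α × M.R) Y => (M.eval (valOf e₀ e₁ e₂ j x.1 Y) t : M.R) = x.2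
  | .s2, t => IsQuery fun (x : α × M.R × M.N) Y =>
      M.app1 (M.eval (valOf e₀ e₁ e₂ j x.1 Y) t) x.2.1 = x.2.2

section
variable {e₀ : ℕ → α → M.N} {e₁ : ℕ → α → M.R} {e₂ : ℕ → M.F} {j : ℕ}

/-- The values of subterms are guessed existentially. For `F * r` the guess is a real whose
countably many values must all be right, which brings in `IsQuery.all_nat`. -/
theorem termIsQuery (hSF : M.SF) (h₀ : ∀ n, Eff M (e₀ n)) (h₁ : ∀ n, Eff M (e₁ n)) {s : L3Sort}
    (t : L3Term s) : TermIsQuery e₀ e₁ e₂ j s t := by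
  induction t with
  | var s n =>
    cases s with
    | s0 => exact .of_eff (.nat_eq ((h₀ n).comp .fst) .snd)
    | s1 => exact .of_eff (.real_eq ((h₁ n).comp .fst) .snd)
    | s2 =>
      by_cases hn : n = j
      · refine (IsQuery.apply (α := α × M.R × M.N) (f := fun x => x.2.1) (m := fun x => x.2.2)
          (by fun_prop) (by fun_prop)).congr fun x Y => ?_
        simp [eval, valOf, hn]
      · refine (IsQuery.of_eff (M := M) (p := fun x : α × M.R × M.N => e₂ n x.2.1 = x.2.2)
          (by fun_prop)).congr fun x Y => ?_
        simp [eval, valOf, hn]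
  | zero => exact .of_eff (.nat_eq (.const 0) .snd)
  | one => exact .of_eff (.nat_eq (.const 1) .snd)
  | add t u iht ihu =>
    have h1 := iht.comp (g := fun x : ((α × M.N) × M.N) × M.N => (x.1.1.1, x.1.2)) (by fun_prop)
    have h2 := ihu.comp (g := fun x : ((α × M.N) × M.N) × M.N => (x.1.1.1, x.2)) (by fun_prop)
    have h3 := IsQuery.of_eff (M := M) (p := fun x : ((α × M.N) × M.N) × M.N =>
      x.1.2 + x.2 = x.1.1.2) (by fun_prop)
    exact (((h1.and h2).and h3).ex.ex).congr fun x Y =>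
      ⟨fun ⟨_, _, ⟨h₁, h₂⟩, h⟩ => by
        dsimp only at h₁ h₂
        subst h₁ h₂
        exact h, fun h => ⟨_, _, ⟨rfl, rfl⟩, h⟩⟩
  | mul t u iht ihu =>
    have h1 := iht.comp (g := fun x : ((α × M.N) × M.N) × M.N => (x.1.1.1, x.1.2)) (by fun_prop)
    have h2 := ihu.comp (g := fun x : ((α × M.N) × M.N) × M.N => (x.1.1.1, x.2)) (by fun_prop)
    have h3 := IsQuery.of_eff (M := M) (p := fun x : ((α × M.N) × M.N) × M.N =>
      x.1.2 * x.2 = x.1.1.2) (by fun_prop)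
    exact (((h1.and h2).and h3).ex.ex).congr fun x Y =>
      ⟨fun ⟨_, _, ⟨h₁, h₂⟩, h⟩ => by
        dsimp only at h₁ h₂
        subst h₁ h₂
        exact h, fun h => ⟨_, _, ⟨rfl, rfl⟩, h⟩⟩
  | app0 r t ihr iht =>
    have h1 := ihr.comp (g := fun x : ((α × M.N) × M.R) × M.N => (x.1.1.1, x.1.2)) (by fun_prop)
    have h2 := iht.comp (g := fun x : ((α × M.N) × M.R) × M.N => (x.1.1.1, x.2)) (by fun_prop)
    have h3 := IsQuery.of_eff (M := M) (p := fun x : ((α × M.N) × M.R) × M.N =>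
      x.1.2 x.2 = x.1.1.2) (by fun_prop)
    exact (((h1.and h2).and h3).ex.ex).congr fun x Y =>
      ⟨fun ⟨_, _, ⟨h₁, h₂⟩, h⟩ => by
        dsimp only at h₁ h₂
        subst h₁ h₂
        exact h, fun h => ⟨_, _, ⟨rfl, rfl⟩, h⟩⟩
  | app1 F r ihF ihr =>
    have h1 := ihr.comp (g := fun x : (α × M.N) × M.R => (x.1.1, x.2)) (by fun_prop)
    have h2 := ihF.comp (g := fun x : (α × M.N) × M.R => (x.1.1, x.2, x.1.2)) (by fun_prop)
    exact ((h1.and h2).ex).congr fun x Y =>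
      ⟨fun ⟨_, h₁, h⟩ => by
        dsimp only at h₁
        subst h₁
        exact h, fun h => ⟨_, rfl, h⟩⟩
  | star F r ihF ihr =>
    have h1 := ihr.comp (g := fun x : (α × M.R) × M.R => (x.1.1, x.2)) (by fun_prop)
    have h2 := (ihF.comp (g := fun x : ((α × M.R) × M.R) × M.N =>
      (x.1.1.1, M.cons x.2 x.1.2, x.1.1.2 x.2)) (by fun_prop)).all_nat hSF
    refine ((h1.and h2).ex).congr fun x Y => ⟨?_, ?_⟩
    · rintro ⟨_, h₁, h⟩
      dsimp only at h₁
      subst h₁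
      exact real_ext fun n => (star_app ..).trans (h n)
    · intro h
      refine ⟨M.eval (valOf e₀ e₁ e₂ j x.1 Y) r, rfl, fun n => ?_⟩
      exact (star_app ..).symm.trans (congrArg (fun z : M.R => z n) h)
  | cons t r iht ihr =>
    have h1 := iht.comp (g := fun x : α × M.R => (x.1, x.2 0)) (by fun_prop)
    have h2 := ihr.comp (g := fun x : α × M.R => (x.1, tail x.2)) (by fun_prop)
    refine (h1.and h2).congr fun x Y => ?_
    simp only [eval]
    constructor
    · rintro ⟨h, h'⟩
      rw [h, h', cons_tail]
    · intro h
      rw [← h]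
      exact ⟨(cons_zero _ _).symm, (tail_cons _ _).symm⟩

end

/-- Queries are not evidently closed under negation, so a formula and its negation are treated
together. The parameter space varies because each quantifier adds a coordinate. -/
theorem arithIsQuery (hSF : M.SF) {θ : L3Formula} (hθ : θ.IsArith) : ∀ {α : Type u} [Coded M α]
    {e₀ : ℕ → α → M.N} {e₁ : ℕ → α → M.R} (e₂ : ℕ → M.F) (j : ℕ),
    (∀ n, Eff M (e₀ n)) → (∀ n, Eff M (e₁ n)) →
    IsQuery (fun a Y => M.Sat (valOf e₀ e₁ e₂ j a Y) θ) ∧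
      IsQuery fun a Y => ¬ M.Sat (valOf e₀ e₁ e₂ j a Y) θ := by
  induction hθ with
  | eq t u =>
    intro α _ e₀ e₁ e₂ j h₀ h₁
    have h1 := (termIsQuery (e₂ := e₂) (j := j) hSF h₀ h₁ t).comp
      (g := fun x : (α × M.N) × M.N => (x.1.1, x.1.2)) (by fun_prop)
    have h2 := (termIsQuery (e₂ := e₂) (j := j) hSF h₀ h₁ u).comp
      (g := fun x : (α × M.N) × M.N => (x.1.1, x.2)) (by fun_prop)
    have h3 := IsQuery.of_eff (M := M) (p := fun x : (α × M.N) × M.N => x.1.2 = x.2)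
      (by fun_prop)
    have h4 := IsQuery.of_eff (M := M) (p := fun x : (α × M.N) × M.N => ¬ x.1.2 = x.2)
      (by fun_prop)
    exact ⟨(((h1.and h2).and h3).ex.ex).congr fun x Y =>
      ⟨fun ⟨_, _, ⟨h₁, h₂⟩, h⟩ => by
        dsimp only at h₁ h₂
        subst h₁ h₂
        exact h, fun h => ⟨_, _, ⟨rfl, rfl⟩, h⟩⟩,
      (((h1.and h2).and h4).ex.ex).congr fun x Y =>
      ⟨fun ⟨_, _, ⟨h₁, h₂⟩, h⟩ => by
        dsimp only at h₁ h₂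
        subst h₁ h₂
        exact h, fun h => ⟨_, _, ⟨rfl, rfl⟩, h⟩⟩⟩
  | lt t u =>
    intro α _ e₀ e₁ e₂ j h₀ h₁
    have h1 := (termIsQuery (e₂ := e₂) (j := j) hSF h₀ h₁ t).comp
      (g := fun x : (α × M.N) × M.N => (x.1.1, x.1.2)) (by fun_prop)
    have h2 := (termIsQuery (e₂ := e₂) (j := j) hSF h₀ h₁ u).comp
      (g := fun x : (α × M.N) × M.N => (x.1.1, x.2)) (by fun_prop)
    have h3 := IsQuery.of_eff (M := M) (p := fun x : (α × M.N) × M.N => x.1.2 < x.2)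
      (by fun_prop)
    have h4 := IsQuery.of_eff (M := M) (p := fun x : (α × M.N) × M.N => ¬ x.1.2 < x.2)
      (by fun_prop)
    exact ⟨(((h1.and h2).and h3).ex.ex).congr fun x Y =>
      ⟨fun ⟨_, _, ⟨h₁, h₂⟩, h⟩ => by
        dsimp only at h₁ h₂
        subst h₁ h₂
        exact h, fun h => ⟨_, _, ⟨rfl, rfl⟩, h⟩⟩,
      (((h1.and h2).and h4).ex.ex).congr fun x Y =>
      ⟨fun ⟨_, _, ⟨h₁, h₂⟩, h⟩ => by
        dsimp only at h₁ h₂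
        subst h₁ h₂
        exact h, fun h => ⟨_, _, ⟨rfl, rfl⟩, h⟩⟩⟩
  | not _ ih =>
    intro α _ e₀ e₁ e₂ j h₀ h₁
    obtain ⟨h1, h2⟩ := ih e₂ j h₀ h₁
    exact ⟨h2, h1.congr fun x Y => not_not.symm⟩
  | and _ _ ih ih' =>
    intro α _ e₀ e₁ e₂ j h₀ h₁
    obtain ⟨h1, h2⟩ := ih e₂ j h₀ h₁
    obtain ⟨h3, h4⟩ := ih' e₂ j h₀ h₁
    exact ⟨h1.and h3, (h2.or h4).congr fun x Y => not_and_or.symm⟩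
  | or _ _ ih ih' =>
    intro α _ e₀ e₁ e₂ j h₀ h₁
    obtain ⟨h1, h2⟩ := ih e₂ j h₀ h₁
    obtain ⟨h3, h4⟩ := ih' e₂ j h₀ h₁
    exact ⟨h1.or h3, (h2.and h4).congr fun x Y => not_or.symm⟩
  | imp _ _ ih ih' =>
    intro α _ e₀ e₁ e₂ j h₀ h₁
    obtain ⟨h1, h2⟩ := ih e₂ j h₀ h₁
    obtain ⟨h3, h4⟩ := ih' e₂ j h₀ h₁
    exact ⟨(h2.or h3).congr fun x Y => imp_iff_not_or.symm,
      (h1.and h4).congr fun x Y => Classical.not_imp.symm⟩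
  | @all φ n _ ih =>
    intro α _ e₀ e₁ e₂ j h₀ h₁
    obtain ⟨h1, h2⟩ := ih (α := α × M.N) (e₀ := fun m p => if m = n then p.2 else e₀ m p.1)
      (e₁ := fun m p => e₁ m p.1) e₂ j (fun m => by split_ifs <;> fun_prop)
      (fun m => by fun_prop)
    exact ⟨(h1.all_nat hSF).congr fun x Y => forall_congr' fun m => by rw [← valOf_set0],
      h2.ex.congr fun x Y => by simp only [← valOf_set0]; exact not_forall.symm⟩
  | @ex φ n _ ih =>
    intro α _ e₀ e₁ e₂ j h₀ h₁
    obtain ⟨h1, h2⟩ := ih (α := α × M.N) (e₀ := fun m p => if m = n then p.2 else e₀ m p.1)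
      (e₁ := fun m p => e₁ m p.1) e₂ j (fun m => by split_ifs <;> fun_prop)
      (fun m => by fun_prop)
    exact ⟨h1.ex.congr fun x Y => exists_congr fun m => by rw [← valOf_set0],
      (h2.all_nat hSF).congr fun x Y => by simp only [← valOf_set0]; exact not_exists.symm⟩

theorem sigma11_isQuery (hSF : M.SF) {φ : L3Formula} (hφ : φ.IsSigma11) (v : M.Val) (i j : ℕ) :
    IsQuery fun (b : M.R) Y => M.Sat ((v.set .s1 i b).set .s2 j Y) φ := by
  obtain ⟨n, θ, hθ, rfl⟩ := hφ
  have h := (arithIsQuery hSF hθ (α := M.R × M.R) (e₀ := fun m _ => v (.s0, m))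
    -- The test for the bound variable `n` comes first, so that it shadows `i` if the two coincide.
    (e₁ := fun m x => if m = n then x.2 else if m = i then x.1 else v (.s1, m))
    (fun m => v (.s2, m)) j (fun m => by fun_prop)
    (fun m => by split_ifs <;> fun_prop)).1
  refine (h.ex).congr fun b Y => ?_
  refine exists_congr fun z => ?_
  have : valOf (fun m (_ : M.R × M.R) => (v (.s0, m) : M.N))
      (fun m x => if m = n then x.2 else if m = i then x.1 else v (.s1, m))
      (fun m => v (.s2, m)) j (b, z) Y = ((v.set .s1 i b).set .s2 j Y).set .s1 n z := by
    funext p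
    obtain ⟨_ | _ | _, m⟩ := p
    · rw [Val.set1_ne _ _ _ _ (by simp), Val.set2_ne _ _ _ _ (by simp),
        Val.set1_ne _ _ _ _ (by simp)]
      rfl
    · by_cases hn : m = n
      · subst hn
        rw [Val.set1_same]
        simp [valOf]
        rfl
      · rw [Val.set1_ne _ _ _ _ (by simpa using hn), Val.set2_ne _ _ _ _ (by simp)]
        by_cases h' : m = i
        · subst h'
          rw [Val.set1_same]
          simp [valOf, hn]
          rfl
        · rw [Val.set1_ne _ _ _ _ (by simpa using h')]
          simp [valOf, hn, h']
    · rw [Val.set1_ne _ _ _ _ (by simp)]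
      by_cases hn : m = j
      · subst hn
        rw [Val.set2_same]
        simp [valOf]
        rfl
      · rw [Val.set2_ne _ _ _ _ (by simpa using hn), Val.set1_ne _ _ _ _ (by simp)]
        simp [valOf, hn]
  rw [this]

end L3Structure

namespace L3Structure
variable {M : L3Structure.{u}} [hM : Model M]

/-! ## Transfinite recursion from clopen determinacy -/

theorem less_iff {W : M.F} {a b : M.R} : M.Less W a b ↔ W (pair a b) = 0 := pairVal_iff

@[fun_prop] theorem Eff.less {α : Type*} [Coded M α] (W : M.F) {f g : α → M.R} (hf : Eff M f)
    (hg : Eff M g) : Eff M fun a => M.Less W (f a) (g a) := by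
  simp only [less_iff]; fun_prop

theorem IsWOCode.dom_of_less {W : M.F} (hW : M.IsWOCode W) {a b : M.R} (h : M.Less W a b) :
    M.Dom W a ∧ M.Dom W b := by
  by_contra hd
  have h2 := pairVal_iff.1 ((hW.2.1 a b).2 hd)
  rw [less_iff.1 h] at h2
  exact add_one_ne_zero' _ h2.symm

theorem IsWOCode.trans {W : M.F} (hW : M.IsWOCode W) {a b c : M.R} (h : M.Less W a b)
    (h' : M.Less W b c) : M.Less W a c :=
  hW.2.2.2.1 a b c (hW.dom_of_less h).1 (hW.dom_of_less h).2 (hW.dom_of_less h').2 h h'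

theorem IsWOCode.exists_not_less {W : M.F} (hW : M.IsWOCode W) {g : M.N → M.R} (hg : Eff M g) :
    ∃ n, ¬ M.Less W (g (n + 1)) (g n) := by
  by_contra! h
  exact hW.2.2.2.2.2 ⟨ofRows g, fun n => ⟨g n, g (n + 1), isRow_iff.2 (row_ofRows hg n).symm,
    isRow_iff.2 (row_ofRows hg _).symm, (hW.dom_of_less (h n)).2, (hW.dom_of_less (h n)).1, h n⟩⟩

theorem cons_inj {k l : M.N} {r s : M.R} (h : M.cons k r = M.cons l s) : k = l ∧ r = s :=
  ⟨by rw [← cons_zero k r, h, cons_zero], by rw [← tail_cons k r, h, tail_cons]⟩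

theorem pair_inj {a b c d : M.R} (h : pair a b = pair c d) : a = c ∧ b = d :=
  ⟨by rw [← evens_pair a b, h, evens_pair], by rw [← odds_pair a b, h, odds_pair]⟩

variable [RealQuant M]

/-- A state `0⌢q` with `q = ⟨a, b⟩` asks for a defence of the claim that `X(q) = 1`; a state `1⌢⟨q,
u⟩` asks for an attack on the witness `u`. With `h` from recursion on the debate, `X(q)` is
`h(0⌢q)`: it is 1 if some admissible witness cannot be attacked successfully. -/
theorem ClopenDet.tr1 (hdet : M.ClopenDet) : M.TR1 := by
  classical
  intro W hW φ hφ v i j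
  obtain ⟨A, Q, C, hA, hQ, hC, hφ⟩ := sigma11_isQuery hdet.sf hφ v i j
  let q' (q u : M.R) (i : M.N) : M.R := Q (odds q) u i
  let c' (q u : M.R) (i : M.N) : M.N := C (odds q) u i
  have hq' : ∀ {α : Type u} [Coded M α] {f g : α → M.R} {k : α → M.N}, Eff M f → Eff M g →
      Eff M k → Eff M fun a => q' (f a) (g a) (k a) := fun {α} _ {f g k} hf hg hk =>
    hQ.comp (g := fun a => ((odds (f a), g a), k a)) (by fun_prop)
  have hc' : ∀ {α : Type u} [Coded M α] {f g : α → M.R} {k : α → M.N}, Eff M f → Eff M g →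
      Eff M k → Eff M fun a => c' (f a) (g a) (k a) := fun {α} _ {f g k} hf hg hk =>
    hC.comp (g := fun a => ((odds (f a), g a), k a)) (by fun_prop)
  -- Admissible witnesses predict 0 or 1 at earlier columns and 0 elsewhere, as `X^{[<a]}` does;
  -- only the earlier columns remain to be debated.
  let Wit (q u : M.R) : Prop := A (odds q) u ∧ ∀ i,
    (M.Less W (evens (q' q u i)) (evens q) → c' q u i = 0 ∨ c' q u i = 1) ∧
    (¬ M.Less W (evens (q' q u i)) (evens q) → c' q u i = 0)
  have hWit : ∀ {α : Type u} [Coded M α] {f g : α → M.R}, Eff M f → Eff M g →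
      Eff M fun a => Wit (f a) (g a) := fun {α} _ {f g} hf hg => by
    have hA' := hA.op₂ (F := A) (f := fun a => odds (f a)) (g := g) (by fun_prop) hg
    have h1 := hq' (α := α × M.N) (f := fun x => f x.1) (g := fun x => g x.1)
      (k := fun x => x.2) (by fun_prop) (by fun_prop) (by fun_prop)
    have h2 := hc' (α := α × M.N) (f := fun x => f x.1) (g := fun x => g x.1)
      (k := fun x => x.2) (by fun_prop) (by fun_prop) (by fun_prop)
    exact hA'.and (.forall (by fun_prop))
  -- A predicted value 1 is attacked by demanding its defence. A predicted value 0 is attacked by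
  -- exhibiting a witness for 1, which the other side must then attack.
  let E (x y : M.R) : Prop :=
    (∃ q u, x = M.cons 0 q ∧ y = M.cons 1 (pair q u) ∧ Wit q u) ∨
    ∃ q u i, x = M.cons 1 (pair q u) ∧ M.Less W (evens (q' q u i)) (evens q) ∧
      (c' q u i = 1 ∧ y = M.cons 0 (q' q u i) ∨
        c' q u i = 0 ∧ ∃ w, y = M.cons 1 (pair (q' q u i) w) ∧ Wit (q' q u i) w)
  have hE : Eff M fun x : M.R × M.R => E x.1 x.2 := by
    have h1 := hWit (α := ((M.R × M.R) × M.R) × M.R) (f := fun x => x.1.2) (g := fun x => x.2)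
      (by fun_prop) (by fun_prop)
    have h2 := hq' (α := (((M.R × M.R) × M.R) × M.R) × M.N) (f := fun x => x.1.1.2)
      (g := fun x => x.1.2) (k := fun x => x.2) (by fun_prop) (by fun_prop) (by fun_prop)
    have h3 := hc' (α := (((M.R × M.R) × M.R) × M.R) × M.N) (f := fun x => x.1.1.2)
      (g := fun x => x.1.2) (k := fun x => x.2) (by fun_prop) (by fun_prop) (by fun_prop)
    have h4 := h2.comp (g := fun x : ((((M.R × M.R) × M.R) × M.R) × M.N) × M.R => x.1)
      (by fun_prop)
    have h5 := hWit (α := ((((M.R × M.R) × M.R) × M.R) × M.N) × M.R)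
      (f := fun x => q' x.1.1.1.2 x.1.1.2 x.1.2) (g := fun x => x.2) h4 (by fun_prop)
    exact .or (.exists (.exists (by fun_prop))) (.exists (.exists (.exists (by fun_prop))))
  -- The column under debate. It drops at every attack and stays the same when a witness is offered,
  -- so any two consecutive moves lower it.
  let ca (x : M.R) : M.R := evens (if x 0 = 0 then tail x else evens (tail x))
  have h01 : (1 : M.N) ≠ 0 := zero_lt_one'.ne'
  have ca0 : ∀ q, ca (M.cons 0 q) = evens q := fun q => by simp [ca, cons_zero]
  have ca1 : ∀ q u, ca (M.cons 1 (pair q u)) = evens q := fun q u => by simp [ca, cons_zero, h01]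
  have step : ∀ x y, E x y → M.Less W (ca y) (ca x) ∨ x 0 = 0 ∧ y 0 = 1 ∧ ca y = ca x := by
    rintro x y (⟨q, u, rfl, rfl, -⟩ | ⟨q, u, i, rfl, hl, ⟨-, rfl⟩ | ⟨-, w, rfl, -⟩⟩)
    · exact .inr ⟨cons_zero _ _, cons_zero _ _, by rw [ca0, ca1]⟩
    · exact .inl (by rwa [ca0, ca1])
    · exact .inl (by rwa [ca1, ca1])
  obtain ⟨h, hh, hr⟩ := hdet.exists_isGraphRec hE fun f => by
    by_contra! hcon
    obtain ⟨n, hn⟩ := hW.exists_not_less (g := fun n => ca (row f (n + n))) (by fun_prop)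
    refine hn ?_
    rw [show n + 1 + (n + 1) = n + n + 1 + 1 by ring]
    rcases step _ _ (hcon (n + n)) with h1 | ⟨-, h1, h1'⟩ <;>
      rcases step _ _ (hcon (n + n + 1)) with h2 | ⟨h2, -, h2'⟩
    · exact hW.trans h2 h1
    · rwa [h2']
    · rwa [← h1']
    · exact absurd (h1.symm.trans h2) h01
  have hP : ∀ q, h (M.cons 0 q) = 0 ↔ ∀ u, Wit q u → h (M.cons 1 (pair q u)) = 1 := by
    intro q
    rw [hr]
    constructor
    · exact fun hq u hu => hq _ (.inl ⟨q, u, rfl, rfl, hu⟩)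
    · rintro hq y (⟨q₁, u, hx, rfl, hu⟩ | ⟨q₁, u, i, hx, -⟩)
      · obtain ⟨-, rfl⟩ := cons_inj hx
        exact hq u hu
      · exact absurd (cons_inj hx).1.symm h01
  have hB : ∀ q u, h (M.cons 1 (pair q u)) = 0 ↔ ∀ i, M.Less W (evens (q' q u i)) (evens q) →
      (c' q u i = 1 → h (M.cons 0 (q' q u i)) = 1) ∧
      (c' q u i = 0 → h (M.cons 0 (q' q u i)) = 0) := by
    intro q u
    rw [hr]
    constructor
    · intro hq i hi
      exact ⟨fun hc => hq _ (.inr ⟨q, u, i, rfl, hi, .inl ⟨hc, rfl⟩⟩), fun hc => (hP _).2 fun w hw =>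
        hq _ (.inr ⟨q, u, i, rfl, hi, .inr ⟨hc, w, rfl, hw⟩⟩)⟩
    · rintro hq y (⟨q₁, u₁, hx, -⟩ | ⟨q₁, u₁, i, hx, hl, ho⟩)
      · exact absurd (cons_inj hx).1 h01
      · obtain ⟨rfl, rfl⟩ := pair_inj (cons_inj hx).2
        rcases ho with ⟨hc, rfl⟩ | ⟨hc, w, rfl, hw⟩
        · exact (hq i hl).1 hc
        · exact (hP _).1 ((hq i hl).2 hc) w hw
  obtain ⟨X, hX⟩ := exists_functional (M := M) (g := fun p => h (M.cons 0 p)) (by fun_prop)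
  refine ⟨X, fun a _ => ?_⟩
  obtain ⟨Y, hY⟩ := exists_functional (M := M)
    (g := fun p => if M.Less W (evens p) a then X p else 0) (by fun_prop)
  refine ⟨Y, fun c p b hp => ?_, fun b => ?_⟩
  · obtain ⟨rfl, rfl⟩ := isPair_iff.1 hp
    exact ⟨fun hl => by rw [hY, if_pos hl], fun hl => by rw [hY, if_neg hl]⟩
  have hsat : M.Sat ((v.set .s1 i b).set .s2 j Y) φ ↔
      ∃ u, Wit (pair a b) u ∧ h (M.cons 1 (pair (pair a b) u)) = 0 := by
    refine (hφ b Y).trans (exists_congr fun u => ?_)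
    simp only [hB, Wit, q', c', evens_pair, odds_pair, hY, and_assoc]
    refine and_congr_right fun _ => ?_
    rw [← forall_and]
    refine forall_congr' fun i => ?_
    by_cases hl : M.Less W (evens (Q b u i)) a
    · simp only [hl, if_true, true_imp_iff, not_true, false_imp_iff, and_true, hX]
      rcases hh (M.cons 0 (Q b u i)) with h' | h' <;> rw [h'] <;> constructor
      · intro hc
        exact ⟨.inl hc.symm, fun h1 => absurd (h1.symm.trans hc.symm) h01, fun _ => rfl⟩
      · rintro ⟨hc | hc, h1, -⟩
        · exact hc.symm
        · exact absurd (h1 hc) h01.symm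
      · intro hc
        exact ⟨.inr hc.symm, fun _ => rfl, fun h0 => absurd (hc.trans h0) h01⟩
      · rintro ⟨hc | hc, -, h0⟩
        · exact absurd (h0 hc) h01
        · exact hc.symm
    · simp only [hl, if_false, false_imp_iff, not_false_eq_true, true_imp_iff, true_and, and_true]
      exact eq_comm
  simp only [hsat, pairVal_iff, hX]
  constructor
  · rintro ⟨u, hu, h0⟩
    refine (hh _).resolve_left fun h' => ?_
    exact h01 (((hP _).1 h' u hu).symm.trans h0)
  · intro hn
    push Not at hn
    exact (hP _).2 fun u hu => (hh _).resolve_left (hn u hu)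

end L3Structure

namespace L3Structure
variable {M : L3Structure.{u}} [hM : Model M]

/-! ## Bar recursion from transfinite recursion along the Kleene–Brouwer order -/

/-- The Kleene–Brouwer order on finite sequences of reals given by an order of the reals. -/
def KB (lt : M.R → M.R → Prop) (s t : M.R) : Prop :=
  (M.len t < M.len s ∧ ∀ i < M.len t, row (tail s) i = row (tail t) i) ∨
    ∃ i, i < M.len s ∧ i < M.len t ∧ (∀ j < i, row (tail s) j = row (tail t) j) ∧
      lt (row (tail s) i) (row (tail t) i)

theorem len_snoc (s a : M.R) : M.len (snoc s a) = M.len s + 1 := len_restr _ _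

theorem row_tail_snoc (s a : M.R) {i : M.N} (hi : i < M.len s) :
    row (tail (snoc s a)) i = row (tail s) i := by
  rw [snoc, row_tail_restr (hi.trans (lt_succ_self' _)), row_extend, if_pos hi]

theorem row_tail_snoc_self (s a : M.R) : row (tail (snoc s a)) (M.len s) = a := by
  rw [snoc, row_tail_restr (lt_succ_self' _), row_extend_self]

section
variable {lt : M.R → M.R → Prop}

theorem kb_snoc (s a : M.R) : KB lt (snoc s a) s :=
  .inl ⟨by rw [len_snoc]; exact lt_succ_self' _, fun _ hi => row_tail_snoc s a hi⟩

theorem KB.irrefl (hirr : ∀ a, ¬ lt a a) (s : M.R) : ¬ KB lt s s := by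
  rintro (⟨h, -⟩ | ⟨i, -, -, -, h⟩)
  · exact lt_irrefl _ h
  · exact hirr _ h

theorem KB.trans (htr : ∀ a b c, lt a b → lt b c → lt a c) {s t r : M.R} (h : KB lt s t)
    (h' : KB lt t r) : KB lt s r := by
  rcases h with ⟨hl, he⟩ | ⟨i, his, hit, he, hi⟩ <;>
    rcases h' with ⟨hl', he'⟩ | ⟨j, hjt, hjr, he', hj⟩
  · exact .inl ⟨hl'.trans hl, fun i hi => (he i (hi.trans hl')).trans (he' i hi)⟩
  · exact .inr ⟨j, hjt.trans hl, hjr, fun k hk => (he k (hk.trans hjt)).trans (he' k hk),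
      by rwa [he j hjt]⟩
  · rcases lt_or_ge i (M.len r) with hir | hir
    · exact .inr ⟨i, his, hir, fun k hk => (he k hk).trans (he' k (hk.trans hir)),
        by rwa [← he' i hir]⟩
    · exact .inl ⟨hir.trans_lt his, fun k hk => (he k (hk.trans_le hir)).trans (he' k hk)⟩
  · rcases lt_trichotomy i j with hij | rfl | hij
    · exact .inr ⟨i, his, hij.trans hjr, fun k hk => (he k hk).trans (he' k (hk.trans hij)),
        by rwa [← he' i hij]⟩
    · exact .inr ⟨i, his, hjr, fun k hk => (he k hk).trans (he' k hk), htr _ _ _ hi hj⟩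
    · exact .inr ⟨j, hij.trans his, hjr, fun k hk => (he k (hk.trans hij)).trans (he' k hk),
        by rwa [he j hij]⟩

/-- If `s` agrees with `t` below `k`, it precedes `t` by being longer or by a smaller entry at an
index not below `k`; both make it longer than `k`. -/
theorem KB.lt_len {s t : M.R} (h : KB lt s t) (hirr : ∀ a, ¬ lt a a) {k : M.N} (hk : k ≤ M.len t)
    (he : ∀ i < k, row (tail s) i = row (tail t) i) : k < M.len s := by
  rcases h with ⟨h, -⟩ | ⟨i, his, -, -, hi⟩
  · exact hk.trans_lt h
  · refine lt_of_le_of_lt (not_lt.1 fun hik => ?_) his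
    rw [he i hik] at hi
    exact hirr _ hi

theorem KB.row_le {s t : M.R} (h : KB lt s t) (hirr : ∀ a, ¬ lt a a) {k : M.N} (hk : k < M.len t)
    (he : ∀ i < k, row (tail s) i = row (tail t) i) :
    row (tail s) k = row (tail t) k ∨ lt (row (tail s) k) (row (tail t) k) := by
  rcases h with ⟨-, h⟩ | ⟨i, -, -, he', hi⟩
  · exact .inl (h k hk)
  · rcases lt_trichotomy i k with hik | rfl | hik
    · rw [he i hik] at hi
      exact absurd hi (hirr _)
    · exact .inr hi
    · exact .inl (he' k hik)

variable [RealQuant M]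

theorem KB.total (htot : ∀ a b, lt a b ∨ a = b ∨ lt b a) {s t : M.R} (hs : M.IsSeq s)
    (ht : M.IsSeq t) : KB lt s t ∨ s = t ∨ KB lt t s := by
  by_cases hd : ∃ i, i < M.len s ∧ i < M.len t ∧ row (tail s) i ≠ row (tail t) i
  · obtain ⟨i, ⟨his, hit, hi⟩, hm⟩ := exists_least (by fun_prop) hd
    have he : ∀ j < i, row (tail s) j = row (tail t) j := fun j hj => by
      by_contra hne
      exact hm j hj ⟨hj.trans his, hj.trans hit, hne⟩
    rcases htot (row (tail s) i) (row (tail t) i) with h | h | h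
    · exact .inl (.inr ⟨i, his, hit, he, h⟩)
    · exact absurd h hi
    · exact .inr (.inr (.inr ⟨i, hit, his, fun j hj => (he j hj).symm, h⟩))
  · push Not at hd
    rcases lt_trichotomy (M.len s) (M.len t) with h | h | h
    · exact .inr (.inr (.inl ⟨h, fun i hi => (hd i hi (hi.trans h)).symm⟩))
    · exact .inr (.inl (hs.ext ht h fun i hi => hd i hi (h ▸ hi)))
    · exact .inl (.inl ⟨h, fun i hi => hd i (hi.trans h) hi⟩)

/-- Without a minimal element, dependent choice would build a descending sequence. -/
theorem SF.exists_minimal (hSF : M.SF) (hlt : Eff M fun x : M.R × M.R => lt x.1 x.2)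
    (hwf : ∀ f, ∃ n, ¬ lt (row f (n + 1)) (row f n)) {p : M.R → Prop} (hp : Eff M p)
    (h : ∃ a, p a) : ∃ a, p a ∧ ∀ b, p b → ¬ lt b a := by
  by_contra! hcon
  obtain ⟨a, ha⟩ := h
  obtain ⟨f, hf⟩ := hSF.exists_chain (p := fun r s => lt s r) hp
    (hlt.comp (g := fun x : M.R × M.R => (x.2, x.1)) (by fun_prop)) hcon ha
  obtain ⟨n, hn⟩ := hwf f
  exact hn (hf n).2

/-- A nonincreasing sequence is constant from the first place where a minimal element of its range
occurs. -/
theorem SF.eventually_const (hSF : M.SF) (hlt : Eff M fun x : M.R × M.R => lt x.1 x.2)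
    (hwf : ∀ f, ∃ n, ¬ lt (row f (n + 1)) (row f n))
    (htr : ∀ a b c, lt a b → lt b c → lt a c) {g : M.N → M.R} (hg : Eff M g)
    (h : ∀ n, g (n + 1) = g n ∨ lt (g (n + 1)) (g n)) : ∃ m, ∀ n, g (m + n) = g m := by
  obtain ⟨_, ⟨m, rfl⟩, hm⟩ := hSF.exists_minimal hlt hwf (p := fun a => ∃ m, g m = a)
    (.exists (by fun_prop)) ⟨_, 0, rfl⟩
  have hl : ∀ n, g (m + n) = g m ∨ lt (g (m + n)) (g m) := by
    refine nat_induction (.or (by fun_prop)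
      (hlt.comp (g := fun n => (g (m + n), g m)) (by fun_prop))) (.inl (by simp)) fun n ih => ?_
    rw [← add_assoc]
    rcases h (m + n) with h1 | h1 <;> rcases ih with h2 | h2
    · exact .inl (h1.trans h2)
    · exact .inr (by rwa [h1])
    · exact .inr (by rwa [← h2])
    · exact .inr (htr _ _ _ h1 h2)
  exact ⟨m, fun n => (hl n).resolve_right (hm _ ⟨_, rfl⟩)⟩

/-- Along a descending sequence in `T` the entries at each index stabilize one after the other. The
stable initial segments belong to `T` and each extends by one more entry, so dependent choice yields
an infinite path. -/
theorem SF.kb_wellFounded (hSF : M.SF) (hlt : Eff M fun x : M.R × M.R => lt x.1 x.2)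
    (hwf : ∀ f, ∃ n, ¬ lt (row f (n + 1)) (row f n)) (hirr : ∀ a, ¬ lt a a)
    (htr : ∀ a b c, lt a b → lt b c → lt a c) {T : M.F} (hT : M.IsTree T) (hW : M.IsWFTree T)
    {f : M.R} (hm : ∀ n, M.Mem (row f n) T) : ∃ n, ¬ KB lt (row f (n + 1)) (row f n) := by
  by_contra! hcon
  -- `s` is a proper initial segment of all rows from some place on; properness guarantees that
  -- there is a next entry to stabilize.
  let P (s : M.R) : Prop := M.IsSeq s ∧ ∃ n, ∀ m, M.len s < M.len (row f (n + m)) ∧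
    ∀ i < M.len s, row (tail (row f (n + m))) i = row (tail s) i
  have hmem : ∀ s, P s → M.Mem s T := by
    rintro s ⟨hs, n, hn⟩
    obtain ⟨hl, he⟩ := hn 0
    rw [← hs.restr_tail, ← restr_eq_iff.2 he]
    refine (isTree_iff.1 hT).2 _ _ _ hl.le ?_
    rw [(hm _).1.restr_tail]
    exact hm _
  have hstep : ∀ s, P s → ∃ t, P t ∧ ∃ a, t = snoc s a := by
    rintro s ⟨hs, n, hn⟩
    obtain ⟨m, hm'⟩ := hSF.eventually_const hlt hwf htr
      (g := fun m => row (tail (row f (n + m))) (M.len s)) (by fun_prop) fun m => by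
        rw [← add_assoc]
        refine (hcon (n + m)).row_le hirr (hn m).1 fun i hi => ?_
        rw [(hn m).2 i hi, add_assoc, (hn (m + 1)).2 i hi]
    have he : ∀ l, ∀ i < M.len s + 1, row (tail (row f (n + m + l))) i =
        row (tail (snoc s (row (tail (row f (n + m))) (M.len s)))) i := by
      intro l i hi
      rcases (lt_add_one_iff.1 hi).lt_or_eq with h | rfl
      · rw [row_tail_snoc _ _ h, add_assoc, (hn _).2 i h]
      · rw [row_tail_snoc_self, add_assoc, hm']
    refine ⟨snoc s (row (tail (row f (n + m))) (M.len s)), ⟨isSeq_restr _ _, n + m + 1, fun l => ?_⟩,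
      _, rfl⟩
    -- One further step down gives properness again: a row below one that agrees with it on the
    -- stable part must be longer. Hence the threshold `n + m + 1`.
    have hc := hcon (n + m + l)
    rw [add_assoc (n + m) l 1, add_comm l 1, ← add_assoc] at hc
    rw [len_snoc]
    constructor
    · refine hc.lt_len hirr ?_ fun i hi => ?_
      · rw [add_assoc]
        exact add_one_le_of_lt (hn _).1
      · rw [he l i hi, add_assoc, he _ i hi]
    · intro i hi
      rw [add_assoc, he _ i hi]
  obtain ⟨F, hF⟩ := hSF.exists_chain (D := P) (p := fun s t => ∃ a, t = snoc s a)
    (a := restr default 0) (by fun_prop) (by fun_prop) hstep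
    -- The row at index 0 may be empty; every later row lies below another one and so is nonempty.
    ⟨isSeq_restr _ _, 1, fun m => ⟨by
      rw [len_restr, add_comm]
      exact (hcon m).lt_len hirr zero_le fun i hi => absurd hi zero_le.not_gt, fun i hi => by
      rw [len_restr] at hi
      exact absurd hi zero_le.not_gt⟩⟩
  obtain ⟨n, hn⟩ := hW.exists_not_snoc hT F
  exact hn ⟨hmem _ (hF n).1, hmem _ (hF _).1, (hF n).2⟩

end

variable [RealQuant M]

/-- The Kleene–Brouwer order restricted to `T`. Extensions come before what they extend, so
recursion along it reaches the children of a node first. -/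
theorem exists_kb_code (hWO : M.WO) (hSF : M.SF) {T : M.F} (hT : M.IsTree T) (hW : M.IsWFTree T) :
    ∃ W : M.F, M.IsWOCode W ∧ (∀ s, M.Dom W s ↔ M.Mem s T) ∧
      ∀ s a, M.Mem s T → M.Mem (snoc s a) T → M.Less W (snoc s a) s := by
  classical
  obtain ⟨L, hirr, htr, htot, hwf⟩ := hWO
  simp only [forall_true_left, pairVal_iff] at hirr htr htot
  let lt (a b : M.R) : Prop := L (pair a b) = 1
  have hwf' : ∀ f, ∃ n, ¬ lt (row f (n + 1)) (row f n) := fun f => by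
    by_contra! h
    exact hwf ⟨f, fun n => ⟨_, _, isRow_iff.2 rfl, isRow_iff.2 rfl, trivial, trivial,
      pairVal_iff.2 (h n)⟩⟩
  have hlt : Eff M fun x : M.R × M.R => lt x.1 x.2 := by fun_prop
  have hK : Eff M fun x : M.R => KB lt (evens x) (odds x) := by
    unfold KB; fun_prop
  obtain ⟨W, hWv⟩ := exists_functional (M := M) (g := fun x =>
    if M.Mem (evens x) T ∧ M.Mem (odds x) T then if KB lt (evens x) (odds x) then 0 else 1
    else 1 + 1) (by fun_prop)
  have h01 : (0 : M.N) ≠ 1 := zero_ne_one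
  have h02 : (0 : M.N) ≠ 1 + 1 := (add_one_ne_zero' 1).symm
  have h12 : (1 : M.N) ≠ 1 + 1 := one_lt_two'.ne
  have h2 : ∀ a b, W (pair a b) = 1 + 1 ↔ ¬ (M.Mem a T ∧ M.Mem b T) := fun a b => by
    rw [hWv, evens_pair, odds_pair]
    split_ifs with h h' <;> simp [h, h02, h12]
  have h0 : ∀ a b, M.Less W a b ↔ (M.Mem a T ∧ M.Mem b T) ∧ KB lt a b := fun a b => by
    rw [less_iff, hWv, evens_pair, odds_pair]
    split_ifs with h h'
    · simp [h, h']
    · simp [h', h01.symm]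
    · simp [h, h02.symm]
  have hD : ∀ s, M.Dom W s ↔ M.Mem s T := fun s => by
    rw [Dom, pairVal_iff, h2, not_not, and_self]
  refine ⟨W, ⟨fun x => ?_, fun a b => ?_, fun a _ => ?_, fun a b c _ _ _ => ?_, fun a b ha hb => ?_,
    ?_⟩, hD, fun s a hs ha => (h0 _ _).2 ⟨⟨ha, hs⟩, kb_snoc s a⟩⟩
  · rw [hWv]
    split_ifs <;> simp
  · rw [pairVal_iff, h2, hD, hD]
  · rw [h0]
    exact fun h => KB.irrefl hirr a h.2
  · rw [h0, h0, h0]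
    exact fun h h' => ⟨⟨h.1.1, h'.1.2⟩, h.2.trans htr h'.2⟩
  · rw [hD] at ha hb
    rw [h0, h0]
    exact (KB.total htot ha.1 hb.1).imp (fun h => ⟨⟨ha, hb⟩, h⟩)
      (Or.imp_right fun h => ⟨⟨hb, ha⟩, h⟩)
  · rintro ⟨f, hf⟩
    simp only [isRow_iff] at hf
    have hf' : ∀ n, M.Less W (row f (n + 1)) (row f n) := fun n => by
      obtain ⟨_, _, rfl, rfl, -, -, h⟩ := hf n
      exact h
    obtain ⟨n, hn⟩ := hSF.kb_wellFounded hlt hwf' hirr htr hT hW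
      (f := f) fun n => ((h0 _ _).1 (hf' n)).1.2
    exact hn ((h0 _ _).1 (hf' n)).2

/-- Only the diagonal values `X(⟨s, s⟩)` matter: such a value is 1 if some child `t` of `s` in `T`
has `X(⟨t, t⟩) = 0`. The children lie below `s`, so the restricted functional agrees with `X` there.
-/
theorem br1_of_tr1 (hTR : M.TR1) (hWO : M.WO) (hSF : M.SF) : M.BR1 := by
  classical
  intro T hT hW
  obtain ⟨W, hWc, hD, hl⟩ := exists_kb_code hWO hSF hT hW
  -- The quantified real `z` codes a node and a child of it in `T`; `B` extracts the node and `C`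
  -- the diagonal position of the child.
  obtain ⟨A, hA⟩ := exists_characteristic (M := M)
    (p := fun z => M.Mem (odds z) T ∧ ∃ a, odds z = snoc (evens z) a) (by fun_prop)
  obtain ⟨B, hB⟩ := exists_operation (M := M) (Φ := evens) (by fun_prop)
  obtain ⟨C, hC⟩ := exists_operation (M := M) (Φ := fun z => pair (odds z) (odds z)) (by fun_prop)
  obtain ⟨X, hX⟩ := hTR.exists_recursive hWc A B C
  have h01 : (0 : M.N) ≠ 1 := zero_ne_one
  have hex : ∀ s, M.Mem s T →
      (X (pair s s) = 0 ∨ X (pair s s) = 1) ∧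
      (X (pair s s) = 1 ↔ ∃ a, M.Mem (snoc s a) T ∧ X (pair (snoc s a) (snoc s a)) = 0) := by
    intro s hs
    obtain ⟨Y, hY, hYb⟩ := hX s ((hD s).2 hs)
    obtain ⟨h1, h0⟩ := hYb s
    have key : (∃ z, M.star B z = s ∧ A z = 1 ∧ Y (M.star C z) = 0) ↔
        ∃ a, M.Mem (snoc s a) T ∧ X (pair (snoc s a) (snoc s a)) = 0 := by
      have hYX : ∀ a, M.Mem (snoc s a) T →
          Y (pair (snoc s a) (snoc s a)) = X (pair (snoc s a) (snoc s a)) := fun a ha =>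
        (hY _ _ _ (isPair_pair _ _)).1 (hl s a hs ha)
      constructor
      · rintro ⟨z, rfl, hz, hz'⟩
        rw [hA] at hz
        rw [hB, hC] at *
        by_cases hc : M.Mem (odds z) T ∧ ∃ a, odds z = snoc (evens z) a
        · obtain ⟨hc, a, ha⟩ := hc
          rw [ha] at hc hz'
          exact ⟨a, hc, by rwa [← hYX a hc]⟩
        · rw [if_neg hc] at hz
          exact absurd hz h01
      · rintro ⟨a, ha, h⟩
        refine ⟨pair s (snoc s a), by rw [hB, evens_pair], ?_, ?_⟩
        · rw [hA, if_pos]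
          simpa using ha
        · rwa [hC, odds_pair, hYX a ha]
    rw [key] at h1 h0
    refine ⟨?_, fun h => ?_, h1⟩
    · by_cases h : ∃ a, M.Mem (snoc s a) T ∧ X (pair (snoc s a) (snoc s a)) = 0
      · exact .inr (h1 h)
      · exact .inl (h0 h)
    · by_contra hn
      exact h01 ((h0 hn).symm.trans h)
  obtain ⟨h, hh⟩ := exists_characteristic (M := M) (p := fun s => M.Mem s T ∧ X (pair s s) = 1)
    (by fun_prop)
  refine ⟨h, fun x => ?_, fun s hs => ?_⟩
  · rw [hh]
    split_ifs <;> simp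
  · have hh0 : h s = 0 ↔ ¬ X (pair s s) = 1 := by
      rw [hh]
      split_ifs with hc <;> simp_all
    rw [hh0, (hex s hs).2]
    constructor
    · intro hn a t hst ht
      obtain rfl := (isSnoc_iff_eq.1 hst).2
      rw [hh, if_pos]
      exact ⟨ht, (hex _ ht).1.resolve_left fun h => hn ⟨a, ht, h⟩⟩
    · rintro hn ⟨a, ha, ha'⟩
      have := hn a _ (isSnoc_iff_eq.2 ⟨hs.1, rfl⟩) ha
      rw [hh, if_neg (by rw [ha']; exact fun h => h01 h.2)] at this
      exact h01 this

end L3Structure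

/-! ### The three implications -/

theorem mainTheorem4 (M : L3Structure.{u}) (hM : M.IsModelRCA03) :
    (M.ClopenDet → M.TR1 ∧ M.SF) ∧
    (M.ClopenDet ↔ M.BR1 ∧ M.SF) ∧
    (M.TR1 ∧ M.WO ∧ M.SF → M.ClopenDet) := by
  -- Structures may have empty sorts. Without reals or without functionals every principle concerned
  -- holds trivially; otherwise `Model` applies.
  rcases isEmpty_or_nonempty M.R with hR | hR
  · have hdet : M.ClopenDet := fun T hT => hR.elim hT.1.choose
    have hsf : M.SF := fun f _ => ⟨f, fun r => hR.elim r⟩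
    have htr : M.TR1 := fun W _ φ _ v => hR.elim (v (.s1, 0))
    have hbr : M.BR1 := fun T hT => hR.elim hT.1.choose
    exact ⟨fun _ => ⟨htr, hsf⟩, ⟨fun _ => ⟨hbr, hsf⟩, fun _ => hdet⟩, fun _ => hdet⟩
  rcases isEmpty_or_nonempty M.F with hF | hF
  · have hdet : M.ClopenDet := fun T => hF.elim T
    have hsf : M.SF := fun f => hF.elim f
    have htr : M.TR1 := fun W => hF.elim W
    have hbr : M.BR1 := fun T => hF.elim T
    exact ⟨fun _ => ⟨htr, hsf⟩, ⟨fun _ => ⟨hbr, hsf⟩, fun _ => hdet⟩, fun _ => hdet⟩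
  have : M.Model := ⟨hM, hR, hF⟩
  refine ⟨fun hdet => ?_, ⟨fun hdet => ?_, fun ⟨hbr, hsf⟩ => ?_⟩, fun ⟨htr, hwo, hsf⟩ => ?_⟩
  · have := hdet.realQuant
    exact ⟨hdet.tr1, hdet.sf⟩
  · have := hdet.realQuant
    exact ⟨hdet.br1, hdet.sf⟩
  · have := hbr.realQuant
    exact L3Structure.clopenDet_of_br1 hbr hsf
  · have := L3Structure.realQuant_of_wo_of_tr1 hwo htr
    exact L3Structure.clopenDet_of_br1 (L3Structure.br1_of_tr1 htr hwo hsf) hsf
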